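/- **Words and tableaux.** Let $i\ge 1$. In a word $w$ of natural numbers, regard each letter $i$ as a right bracket and each letter $i+1$ as a left bracket, and match brackets as usual; the unmatched ones form a subword $i^a(i+1)^b$. The raising operator $e_i$ turns the leftmost unmatched $i+1$ of $w$ into $i$ (and $e_i(w)=\emptyset$ if $b=0$); the lowering operator $f_i$ turns the rightmost unmatched $i$ into $i+1$ (and $f_i(w)=\emptyset$ if $a=0$). They act on a semistandard Young tableau with positive entries through its reading word (rows from bottom to top, each from left to right). $\mathrm{SSYT}(\nu)$ is the set of semistandard Young tableaux of shape $\nu$ with positive integer entries, with this crystal structure, and $\mathrm{SSYT}(\nu,\alpha)$ is the subset of those of content $\alpha$. On a tableau $Q$ whose transpose $Q^t$ is semistandard, $e_i(Q):=(e_i(Q^t))^t$, and likewise for $f_i$. **Fillings.** Let $\lambda/\mu$ be a skew shape (English notation). $\mathrm{COF}(\lambda/\mu)$ is the set of fillings $F$ of $\lambda/\mu$ by positive integers such that each column has distinct entries, the first column is strictly decreasing from top to bottom, and for any two boxes $\beta,\gamma$ in one column other than the first, with $\gamma$ below $\beta$, the following holds for $b=F(\beta)$, $c=F(\gamma)$ and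 $a$ the entry of the position just to the left of $\beta$ (with $a=\infty$ if that position is not in $\lambda/\mu$): $a<c<b$ or $c<b\le a$ or $b\le a<c$. **Biwords.** A Burge word is a finite sequence of distinct biletters $\binom{x}{y}$, with $x,y$ positive integers, sorted increasingly in $x$ and, for equal $x$, decreasingly in $y$. A crystal biword is sorted decreasingly in $y$ and, for equal $y$, decreasingly in $x$. For $F\in\mathrm{COF}(\lambda/\mu)$ take one biletter $\binom{x}{y}$ for each box with value $x$ in column $y$; sorting gives the Burge word $W(F)$ and the crystal biword $\tilde W(F)$. RSK applied to a Burge word $W$ reads it from left to right, inserts the bottom entries by the usual row insertion (an entry bumps the leftmost strictly larger one), and records the top entries; the result is $(\mathrm{ins}(W),\mathrm{rec}(W))$. Put $\mathrm{ins}(F)=\mathrm{ins}(W(F))$, $\mathrm{rec}(F)=\mathrm{rec}(W(F))$. The operators $\tilde e_i,\tilde f_i:\mathrm{COF}(\lambda/\mu)\to\mathrm{COF}(\lambda/\mu)\cup\{\emptyset\}$ apply $e_i$, $f_i$ to the top row of $\tilde W(F)$ and return the filling of shape $\lambda/\mu$ with the resulting crystal biword. **Theorem.** Let $\lambda/\mu$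 be a skew shape. 1. The operators $\tilde e_i,\tilde f_i$ $(i\ge1)$ are well defined: $F\mapsto\tilde W(F)$ is injective on $\mathrm{COF}(\lambda/\mu)$, and whenever $e_i$ (respectively $f_i$) applied to the top row of $\tilde W(F)$ is not $\emptyset$, the result is the crystal biword of some filling in $\mathrm{COF}(\lambda/\mu)$. 2. Let $F\in\mathrm{COF}(\lambda/\mu)$ and $i\ge 1$. If $\tilde e_i(F)\ne\emptyset$, then $\mathrm{ins}(\tilde e_i(F))=\mathrm{ins}(F)$ and $\mathrm{rec}(\tilde e_i(F))=e_i(\mathrm{rec}(F))$. If $\tilde e_i(F)=\emptyset$, then $e_i(\mathrm{rec}(F))=\emptyset$. The same holds for $\tilde f_i$ and $f_i$. 3. Let $W$ be a Burge word, $\tilde W$ its reordering as a crystal biword, and $i\ge1$. If $e_i$ applied to the top row of $\tilde W$ is not $\emptyset$, then the resulting biword, sorted, is a Burge word $W'$, and $\mathrm{ins}(W')=\mathrm{ins}(W)$, $\mathrm{rec}(W')=e_i(\mathrm{rec}(W))$. If it is $\emptyset$, then $e_i(\mathrm{rec}(W))=\emptyset$. The same holds for $f_i$. 4. With $\mathrm{wt}(F)_k$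 the number of entries of $F$ equal to $k$, the operators $\tilde e_i,\tilde f_i$ $(i\geq 1)$ make $\mathrm{COF}(\lambda/\mu)$ a seminormal crystal of type $A$: $\tilde e_i(F)=G$ if and only if $\tilde f_i(G)=F$; in that case $\mathrm{wt}(G)=\mathrm{wt}(F)+\epsilon_i-\epsilon_{i+1}$, where $\epsilon_k$ is the $k$th unit vector; and $\varphi_i(F)-\varepsilon_i(F)=\mathrm{wt}(F)_i-\mathrm{wt}(F)_{i+1}$, where $\varepsilon_i(F)$ and $\varphi_i(F)$ are the (finite) maximal numbers of times that $\tilde e_i$ and $\tilde f_i$ can be applied to $F$. Moreover $F\mapsto(\mathrm{ins}(F),\mathrm{rec}(F)^t)$ is a bijection $$\mathrm{COF}(\lambda/\mu)\;\longrightarrow\;\bigsqcup_{\nu}\mathrm{SSYT}(\nu,\alpha)\times\mathrm{SSYT}(\nu'),\qquad \alpha_j=\lambda'_j-\mu'_j ,$$ over all partitions $\nu$ (primes denote conjugation), under which $\mathrm{wt}$, $\tilde e_i$, $\tilde f_i$ correspond to the weight (content), $e_i$, $f_i$ on the second factor, the first factor being fixed. So $\mathrm{COF}(\lambda/\mu)$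 is isomorphic to a disjoint union of crystals of semistandard Young tableaux. -/

import Mathlib

/-! ### Words and bracketing -/

/-- Left-to-right scan of a word for the bracketing of the letters `i` (right bracket) and
`i + 1` (left bracket); `p` is the position of the next letter.  In the state `(R, L)` the list
`R` holds the positions of the unmatched letters `i`, and `L` those of the letters `i + 1` that
are not matched so far, both with the rightmost position first. -/
def bracketScan (i : ℕ) : ℕ → List ℕ × List ℕ → List ℕ → List ℕ × List ℕ
  | _, s, [] => s
  | p, (R, L), a :: w =>
    if a = i + 1 then bracketScan i (p + 1) (R, p :: L) w
    else if a = i then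
      match L with
      | [] => bracketScan i (p + 1) (p :: R, []) w
      | _ :: L' => bracketScan i (p + 1) (R, L') w
    else bracketScan i (p + 1) (R, L) w

/-- Positions of the unmatched letters `i` and of the unmatched letters `i + 1` of a word, each
listed from right to left. -/
def unmatched (i : ℕ) (w : List ℕ) : List ℕ × List ℕ := bracketScan i 0 ([], []) w

/-- Raising operator on words: the leftmost unmatched `i + 1` becomes `i`
(`none` if there is no unmatched `i + 1`). -/
def wordE (i : ℕ) (w : List ℕ) : Option (List ℕ) :=
  (unmatched i w).2.getLast?.map fun p => w.set p i

/-- Lowering operator on words: the rightmost unmatched `i` becomes `i + 1`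
(`none` if there is no unmatched `i`). -/
def wordF (i : ℕ) (w : List ℕ) : Option (List ℕ) :=
  (unmatched i w).1.head?.map fun p => w.set p (i + 1)

/-! ### Tableaux as lists of rows, and the crystal operators on them

A tableau is given by its list of rows, from top to bottom. -/

/-- Transposition of a tableau. -/
def transposeRows (T : List (List ℕ)) : List (List ℕ) :=
  (List.range (T.headD []).length).map fun j => T.filterMap fun r => r[j]?

/-- Reading word: rows from bottom to top, each row from left to right. -/
def readingWord (T : List (List ℕ)) : List ℕ := T.reverse.flatten

/-- The tableau with the same row lengths as `T` and with reading word `w`. -/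
def refill (T : List (List ℕ)) (w : List ℕ) : List (List ℕ) :=
  (List.splitLengths (T.reverse.map List.length) w).reverse

/-- Raising operator on (semistandard) tableaux, through the reading word. -/
def tabE (i : ℕ) (T : List (List ℕ)) : Option (List (List ℕ)) :=
  (wordE i (readingWord T)).map (refill T)

/-- Lowering operator on (semistandard) tableaux, through the reading word. -/
def tabF (i : ℕ) (T : List (List ℕ)) : Option (List (List ℕ)) :=
  (wordF i (readingWord T)).map (refill T)

/-- Raising operator on tableaux whose transpose is semistandard (recording tableaux). -/
def recE (i : ℕ) (Q : List (List ℕ)) : Option (List (List ℕ)) :=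
  (tabE i (transposeRows Q)).map transposeRows

/-- Lowering operator on tableaux whose transpose is semistandard (recording tableaux). -/
def recF (i : ℕ) (Q : List (List ℕ)) : Option (List (List ℕ)) :=
  (tabF i (transposeRows Q)).map transposeRows

/-! ### Biwords and RSK

A biword is a list of biletters `(top entry, bottom entry)`. -/

/-- Row insertion of `x` into a row: `x` replaces the leftmost entry larger than `x`, which is
bumped out; if there is none then `x` is put at the end. -/
def rowInsert (x : ℕ) : List ℕ → List ℕ × Option ℕ
  | [] => ([x], none)
  | y :: r => if x < y then (x :: r, some y) else (y :: (rowInsert x r).1, (rowInsert x r).2)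

/-- Insert `x` into the insertion tableau (first list) by row bumping, and put `a` in the new box
of the recording tableau (second list). -/
def rskInsert (a : ℕ) : ℕ → List (List ℕ) → List (List ℕ) → List (List ℕ) × List (List ℕ)
  | x, [], _ => ([[x]], [[a]])
  | x, r :: P, Q =>
    match rowInsert x r with
    | (r', none) => (r' :: P, (Q.headD [] ++ [a]) :: Q.tail)
    | (r', some y) => (r' :: (rskInsert a y P Q.tail).1, Q.headD [] :: (rskInsert a y P Q.tail).2)

/-- RSK: the biletters are processed from left to right, the bottom entry is inserted and the top
entry is recorded.  The result is (insertion tableau, recording tableau). -/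
def rsk (W : List (ℕ × ℕ)) : List (List ℕ) × List (List ℕ) :=
  W.foldl (fun s b => rskInsert b.1 b.2 s.1 s.2) ([], [])

/-- The order of the biletters of a Burge word: increasing in the top entry, and decreasing in the
bottom entry among equal top entries. -/
def burgeLE (p q : ℕ × ℕ) : Prop := p.1 < q.1 ∨ (p.1 = q.1 ∧ q.2 ≤ p.2)

/-- The order of the biletters of a crystal biword: decreasing in the bottom entry, and decreasing
in the top entry among equal bottom entries. -/
def crystalLE (p q : ℕ × ℕ) : Prop := q.2 < p.2 ∨ (p.2 = q.2 ∧ q.1 ≤ p.1)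

instance : DecidableRel burgeLE := fun p q =>
  inferInstanceAs (Decidable (p.1 < q.1 ∨ (p.1 = q.1 ∧ q.2 ≤ p.2)))

instance : DecidableRel crystalLE := fun p q =>
  inferInstanceAs (Decidable (q.2 < p.2 ∨ (p.2 = q.2 ∧ q.1 ≤ p.1)))

/-- Burge words: positive entries, distinct biletters, sorted. -/
def IsBurge (W : List (ℕ × ℕ)) : Prop :=
  (∀ b ∈ W, 0 < b.1 ∧ 0 < b.2) ∧ W.Nodup ∧ W.Pairwise burgeLE

/-- Reordering of a biword in the order of Burge words. -/
def burgeSort (W : List (ℕ × ℕ)) : List (ℕ × ℕ) := W.insertionSort burgeLE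

/-- Reordering of a biword in the order of crystal biwords. -/
def crystalSort (W : List (ℕ × ℕ)) : List (ℕ × ℕ) := W.insertionSort crystalLE

/-- The raising operator applied to the top row of a biword. -/
def topE (i : ℕ) (W : List (ℕ × ℕ)) : Option (List (ℕ × ℕ)) :=
  (wordE i (W.map Prod.fst)).map fun u => u.zip (W.map Prod.snd)

/-- The lowering operator applied to the top row of a biword. -/
def topF (i : ℕ) (W : List (ℕ × ℕ)) : Option (List (ℕ × ℕ)) :=
  (wordF i (W.map Prod.fst)).map fun u => u.zip (W.map Prod.snd)

/-! ### Skew coinversion-free fillings -/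

/-- `a` is just to the left of `b`, and `c` is below `b` in the column of `b`.  The triple is an
inversion triple if its entries increase counter-clockwise (in the cyclic order `a`, `c`, `b`);
among equal entries, that of `a` counts as largest and that of `b` as smallest. -/
def IsInversionTriple (a : ℕ∞) (b c : ℕ) : Prop :=
  (a < c ∧ c < b) ∨ (c < b ∧ (b : ℕ∞) ≤ a) ∨ ((b : ℕ∞) ≤ a ∧ a < c)

/-- Skew coinversion-free fillings of `lam / mu`.  Rows and columns are numbered from `0`, and the
entry is set to `0` outside of the skew diagram. -/
@[ext]
structure COF (lam mu : YoungDiagram) where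
  entry : ℕ → ℕ → ℕ
  zeros : ∀ i j, (i, j) ∉ lam.cells \ mu.cells → entry i j = 0
  pos : ∀ i j, (i, j) ∈ lam.cells \ mu.cells → 0 < entry i j
  column_distinct : ∀ i i' j, i < i' → (i, j) ∈ lam.cells \ mu.cells →
    (i', j) ∈ lam.cells \ mu.cells → entry i j ≠ entry i' j
  first_column : ∀ i i', i < i' → (i, 0) ∈ lam.cells \ mu.cells →
    (i', 0) ∈ lam.cells \ mu.cells → entry i' 0 < entry i 0
  /-- A box to the left of `(i, j + 1)` that is outside of the skew diagram has value `∞`. -/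
  triple : ∀ i i' j, i < i' → (i, j + 1) ∈ lam.cells \ mu.cells →
    (i', j + 1) ∈ lam.cells \ mu.cells →
    IsInversionTriple (if (i, j) ∈ lam.cells \ mu.cells then (entry i j : ℕ∞) else ⊤)
      (entry i (j + 1)) (entry i' (j + 1))

/-- One biletter (value of the box, column of the box) for each box of the filling, in an
unspecified order; columns are numbered from `1` here. -/
noncomputable def COF.biletters {lam mu : YoungDiagram} (F : COF lam mu) : List (ℕ × ℕ) :=
  (lam.cells \ mu.cells).toList.map fun c => (F.entry c.1 c.2, c.2 + 1)

/-- The Burge word `W` of a filling. -/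
noncomputable def COF.burgeWord {lam mu : YoungDiagram} (F : COF lam mu) : List (ℕ × ℕ) :=
  burgeSort F.biletters

/-- The crystal biword of a filling. -/
noncomputable def COF.crystalBiword {lam mu : YoungDiagram} (F : COF lam mu) : List (ℕ × ℕ) :=
  crystalSort F.biletters

/-- The insertion tableau of a filling. -/
noncomputable def COF.insTab {lam mu : YoungDiagram} (F : COF lam mu) : List (List ℕ) :=
  (rsk F.burgeWord).1

/-- The recording tableau of a filling. -/
noncomputable def COF.recTab {lam mu : YoungDiagram} (F : COF lam mu) : List (List ℕ) :=
  (rsk F.burgeWord).2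

/-- Raising operator on fillings: apply the raising operator to the top row of the crystal biword
and take the filling of the same skew shape with the resulting crystal biword. -/
noncomputable def COF.raise {lam mu : YoungDiagram} (i : ℕ) (F : COF lam mu) :
    Option (COF lam mu) :=
  (topE i F.crystalBiword).bind (Function.partialInv COF.crystalBiword)

/-- Lowering operator on fillings: apply the lowering operator to the top row of the crystal biword
and take the filling of the same skew shape with the resulting crystal biword. -/
noncomputable def COF.lower {lam mu : YoungDiagram} (i : ℕ) (F : COF lam mu) :
    Option (COF lam mu) :=
  (topF i F.crystalBiword).bind (Function.partialInv COF.crystalBiword)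

/-! ### Crystals of type `A` -/

/-- The data of a crystal with weights in `ℤ^ℕ` and raising and lowering operators indexed by
natural numbers, of which only those with index `i ≥ 1` are used. -/
structure CrystalData (X : Type*) where
  wt : X → ℕ → ℤ
  e : ℕ → X → Option X
  f : ℕ → X → Option X

/-- Iteration of a partial operator. -/
def opIter {X : Type*} (g : X → Option X) : ℕ → X → Option X
  | 0, x => some x
  | k + 1, x => (opIter g k x).bind g

/-- Axioms of a seminormal (Kashiwara) crystal of type `A`: `e i` and `f i` are partial inverses of
each other, `e i` adds the `i`th simple root to the weight, and `x` can be raised (lowered) in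
direction `i` at most `ε` (at most `φ`) times, where `φ - ε` is the pairing of the weight with the
`i`th simple coroot. -/
structure IsCrystal {X : Type*} (C : CrystalData X) : Prop where
  e_iff_f : ∀ i, 1 ≤ i → ∀ x y, C.e i x = some y ↔ C.f i y = some x
  wt_e : ∀ i, 1 ≤ i → ∀ x y, C.e i x = some y →
    C.wt y = C.wt x + Pi.single i 1 - Pi.single (i + 1) 1
  string : ∀ i, 1 ≤ i → ∀ x, ∃ ε φ : ℕ,
    IsGreatest {k | opIter (C.e i) k x ≠ none} ε ∧
    IsGreatest {k | opIter (C.f i) k x ≠ none} φ ∧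
    (φ : ℤ) - ε = C.wt x i - C.wt x (i + 1)

/-- Semistandard Young tableaux of shape `nu` with positive entries. -/
abbrev PosSSYT (nu : YoungDiagram) : Type :=
  {T : SemistandardYoungTableau nu // ∀ i j, (i, j) ∈ nu → 0 < T i j}

/-- The list of rows of a tableau. -/
def PosSSYT.rows {nu : YoungDiagram} (T : PosSSYT nu) : List (List ℕ) :=
  (List.range (nu.colLen 0)).map fun i => (List.range (nu.rowLen i)).map fun j => T.1 i j

/-- Content: the number of entries equal to `k`. -/
def PosSSYT.content {nu : YoungDiagram} (T : PosSSYT nu) (k : ℕ) : ℕ :=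
  (nu.cells.filter fun c => T.1 c.1 c.2 = k).card

/-- The crystal of semistandard Young tableaux of shape `nu`. -/
noncomputable def tableauCrystal (nu : YoungDiagram) : CrystalData (PosSSYT nu) where
  wt T k := T.content k
  e i T := (tabE i T.rows).bind (Function.partialInv PosSSYT.rows)
  f i T := (tabF i T.rows).bind (Function.partialInv PosSSYT.rows)

/-- The crystal of skew coinversion-free fillings; the weight counts the entries equal to `k`. -/
noncomputable def cofCrystal (lam mu : YoungDiagram) : CrystalData (COF lam mu) where
  wt F k := ((lam.cells \ mu.cells).filter fun c => F.entry c.1 c.2 = k).card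
  e i F := F.raise i
  f i F := F.lower i

/-- Semistandard tableaux of shape `nu` whose content is given by the column lengths of
`lam / mu`. -/
abbrev ColumnContentSSYT (lam mu nu : YoungDiagram) : Type :=
  {P : PosSSYT nu // ∀ j, P.content (j + 1) = lam.colLen j - mu.colLen j}

/-!
# Crystal operators on coinversion-free fillings and RSK

The argument rests on the symmetry of RSK, `run_symm`: the recording tableau of a Burge word `W` is
the tableau obtained by *dual* row insertion (an entry bumps the leftmost entry that is at least as
large) of the top entries of `W`, inserted in the order in which the crystal biword, read from right
to left, presents them; the insertion tableau of `W` is then the recording tableau of this dual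
process.  It is proved by induction on the length, by comparing the two processes on the words with
the last biletter of either order removed: adding a largest entry to a tableau commutes with an
insertion, except when both create the same box (`insT_addAt`).

The operators `e_i` and `f_i` change the top row of the crystal biword, so it suffices to see what
dual insertion does to them.  Inserting a letter into a strictly increasing row, and reading the new
row from right to left followed by the bumped letter, neither changes the numbers of unmatched `i`
and `i + 1` nor interferes with the raising operator (`phi_eps_bump`, `raises_bump`).  By the tensor
product rule for words this carries over to a whole tableau (`raises_insT`) and to a whole word
(`raises_run`): the recording tableau of the dual process is fixed, and the dual insertion tableau,
read by rows from right to left, is raised.  This reading is the column reading of the transpose,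
whereas the operators on tableaux are defined through the row reading.  The two readings have the
same unmatched boxes (`signature_transposed`), because a column can be moved past the rows to its
right one letter at a time (`signature_swap`).  Thus the raising operator on crystal biwords
corresponds to that on recording tableaux with the insertion tableau fixed (`rsk_of_raises`).

For the bijection, RSK on Burge words is inverted by removing the lowest of the largest entries of
the recording tableau and reverse bumping (`rsk_injective`, `exists_rsk_eq`).  A filling is the same
as the list of its columns as *sets*: given the entries to the left of a column, a set of entries
can be arranged in the column in exactly one way (`exists_column`, `column_unique`), since the
inversion triple conditions select its top entry.  So the fillings of `lam / mu` correspond to the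
sets of biletters with the prescribed number of biletters for each column.  The crystal operators on
biwords keep the columns and the distinctness of the biletters, which makes them well defined on
fillings.  The crystal axioms are those for words, read off the top rows.
-/

/-! ### Signatures of words -/

/-- Product of signatures: the letters `i` of the second word are matched with the letters `i + 1`
of the first one.  As in `bracketScan`, a signature lists the unmatched `i` and the unmatched
`i + 1`, from right to left. -/
def signatureMul {α : Type*} (s t : List α × List α) : List α × List α :=
  (t.1.take (t.1.length - s.2.length) ++ s.1, t.2 ++ s.2.drop t.1.length)

/-- Labels of the unmatched letters `i` and of the unmatched letters `i + 1` of a word whose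
letters carry labels, each listed from right to left. -/
def signature {α : Type*} (i : ℕ) : List (ℕ × α) → List α × List α
  | [] => ([], [])
  | c :: w =>
    if c.1 = i + 1 then
      (if (signature i w).1.length = 0 then ([], (signature i w).2 ++ [c.2])
        else ((signature i w).1.dropLast, (signature i w).2))
    else if c.1 = i then ((signature i w).1 ++ [c.2], (signature i w).2)
    else signature i w

/-- The signature of a concatenation: bracketing can be done for the two parts first. -/
theorem signature_append {α : Type*} (i : ℕ) (u v : List (ℕ × α)) :
    signature i (u ++ v) = signatureMul (signature i u) (signature i v) := by
  induction u with
  | nil => simp [signature, signatureMul]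
  | cons c u ih =>
    simp only [List.cons_append, signature, ih]
    generalize signature i u = s
    generalize signature i v = t
    obtain ⟨s1, s2⟩ := s
    obtain ⟨t1, t2⟩ := t
    split_ifs with h1 h2 h3 h4 h4
    · simp only [signatureMul, List.length_append, List.length_take] at *
      have hs : s1 = [] := List.length_eq_zero_iff.1 h3
      subst hs
      have h5 : t1.length ≤ s2.length := by omega
      simp only [List.drop_append, List.length_singleton,
        Prod.mk.injEq, List.append_nil, List.append_assoc, List.append_cancel_left_eq]
      rw [Nat.sub_eq_zero_of_le h5]
      constructor
      · rw [show t1.length - (s2.length + 1) = 0 by omega]; simp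
      · simp
    · simp only [signatureMul, List.length_append, List.length_take] at *
      omega
    · simp only [signatureMul, List.length_append, List.length_take] at *
      have hs : s1 = [] := List.length_eq_zero_iff.1 h4
      subst hs
      have h5 : s2.length < t1.length :=
        Nat.lt_of_not_le fun h => h2 (by rw [Nat.sub_eq_zero_of_le h]; simp)
      simp only [List.append_nil, List.length_singleton, Prod.mk.injEq]
      rw [List.dropLast_eq_take, List.take_take]
      constructor
      · congr 1
        simp
        omega
      · rw [List.drop_eq_nil_of_le (by omega), List.drop_eq_nil_of_le (by simp; omega)]
    · have hs : s1 ≠ [] := fun h => h4 (by simp [h])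
      simp [signatureMul, List.dropLast_append_of_ne_nil hs]
    · simp [signatureMul]
    · simp [signatureMul]

/-- The left-to-right scan with state `s` multiplies `s` by the signature of the remaining word,
labelled with positions. -/
theorem bracketScan_eq (i p : ℕ) (s : List ℕ × List ℕ) (w : List ℕ) :
    bracketScan i p s w = signatureMul s (signature i (w.zipIdx p)) := by
  induction w generalizing p s with
  | nil => simp [bracketScan, signature, signatureMul]
  | cons a w ih =>
    obtain ⟨R, L⟩ := s
    rw [List.zipIdx_cons]
    simp only [bracketScan, signature]
    generalize hs : signature i (w.zipIdx (p + 1)) = s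
    obtain ⟨s1, s2⟩ := s
    split_ifs with h1 h2 h3
    · rw [ih, hs]
      obtain rfl := List.length_eq_zero_iff.1 h2
      simp [signatureMul]
    · rw [ih, hs]
      simp only [signatureMul, List.length_cons, List.length_dropLast, Prod.mk.injEq] at h2 ⊢
      obtain ⟨k, hk⟩ := Nat.exists_eq_succ_of_ne_zero h2
      rw [hk]
      constructor
      · rw [List.dropLast_eq_take, List.take_take, hk]
        congr 2
        omega
      · simp
    · rcases L with _ | ⟨z, L⟩
      · simp only; rw [ih, hs]; simp [signatureMul, List.take_of_length_le]
      · simp only; rw [ih, hs]; simp only [signatureMul]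
        simp only [List.length_append, List.length_cons, List.length_nil, List.drop_succ_cons,
          Prod.mk.injEq, and_true, zero_add, Nat.reduceSubDiff]
        rw [List.take_append_of_le_length (by omega)]
    · rw [ih, hs]

/-- Number of unmatched letters `i` of a word.  The truncated subtraction accounts for a letter
`i + 1` that stays unmatched itself. -/
def phi (i : ℕ) : List ℕ → ℕ
  | [] => 0
  | a :: w => if a = i + 1 then phi i w - 1 else if a = i then phi i w + 1 else phi i w

/-- Number of unmatched letters `i + 1` of a word. -/
def eps (i : ℕ) : List ℕ → ℕ
  | [] => 0
  | a :: w => if a = i + 1 ∧ phi i w = 0 then eps i w + 1 else eps i w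

theorem phi_eps_append (i : ℕ) (u v : List ℕ) :
    phi i (u ++ v) = phi i u + (phi i v - eps i u) ∧
      eps i (u ++ v) = eps i v + (eps i u - phi i v) := by
  induction u with
  | nil => simp [phi, eps]
  | cons a u ih =>
    obtain ⟨h1, h2⟩ := ih
    simp only [List.cons_append, phi, eps, h1, h2]
    split_ifs <;> omega

/-- The `phi i v` unmatched `i` of `v` are matched with the `eps i u` unmatched `i + 1` of `u`
as far as possible, whence the truncated subtraction. -/
theorem phi_append (i : ℕ) (u v : List ℕ) :
    phi i (u ++ v) = phi i u + (phi i v - eps i u) := (phi_eps_append i u v).1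

theorem eps_append (i : ℕ) (u v : List ℕ) :
    eps i (u ++ v) = eps i v + (eps i u - phi i v) := (phi_eps_append i u v).2

theorem length_signature {α : Type*} (i : ℕ) (w : List (ℕ × α)) :
    (signature i w).1.length = phi i (w.map Prod.fst) ∧
      (signature i w).2.length = eps i (w.map Prod.fst) := by
  induction w with
  | nil => simp [signature, phi, eps]
  | cons c w ih =>
    obtain ⟨h1, h2⟩ := ih
    simp only [signature, List.map_cons, phi, eps]
    split_ifs <;> simp_all

theorem phi_sub_eps (i : ℕ) (w : List ℕ) :
    (phi i w : ℤ) - eps i w = w.count i - w.count (i + 1) := by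
  induction w with
  | nil => simp [phi, eps]
  | cons a w ih =>
    simp only [phi, eps, List.count_cons, beq_iff_eq]
    split_ifs <;> omega

/-- `u` arises from `w` by the raising operator: one letter `i + 1` becomes `i`, and neither an
`i` to its right nor an `i + 1` to its left is left unmatched by the letters on its own side. -/
def Raises (i : ℕ) (w u : List ℕ) : Prop :=
  ∃ a b, w = a ++ (i + 1) :: b ∧ u = a ++ i :: b ∧ phi i b = 0 ∧ eps i a = 0

/-- The leftmost unmatched letter `i + 1`, together with its label. -/
theorem exists_of_signature_snd {α : Type*} {i : ℕ} {w : List (ℕ × α)} {p : α}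
    (h : (signature i w).2.getLast? = some p) :
    ∃ a b, w = a ++ (i + 1, p) :: b ∧ phi i (b.map Prod.fst) = 0 ∧
      eps i (a.map Prod.fst) = 0 := by
  induction w with
  | nil => simp [signature] at h
  | cons c w ih =>
    obtain ⟨x, q⟩ := c
    by_cases h0 : x = i + 1 ∧ (signature i w).1.length = 0
    · simp only [signature, h0, if_true, List.getLast?_append, List.getLast?_singleton,
        Option.some_or, Option.some.injEq] at h
      exact ⟨[], w, by simp [h0, h], by rw [← (length_signature i w).1]; exact h0.2, rfl⟩
    · have h' : (signature i w).2.getLast? = some p := by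
        simp only [signature] at h
        split_ifs at h <;> simp_all
      obtain ⟨a, b, rfl, hb, ha⟩ := ih h'
      refine ⟨(x, q) :: a, b, rfl, hb, ?_⟩
      rw [(length_signature i _).1] at h0
      simp only [List.map_cons, List.map_append, eps, phi_append, phi] at h0 ⊢
      rw [if_neg (by rintro ⟨rfl, h⟩; apply h0; simp [hb] at h ⊢; omega), ha]

/-- The rightmost unmatched letter `i`, together with its label. -/
theorem exists_of_signature_fst {α : Type*} {i : ℕ} {w : List (ℕ × α)} {p : α}
    (h : (signature i w).1.head? = some p) :
    ∃ a b, w = a ++ (i, p) :: b ∧ phi i (b.map Prod.fst) = 0 ∧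
      eps i (a.map Prod.fst) = 0 := by
  induction w with
  | nil => simp [signature] at h
  | cons c w ih =>
    obtain ⟨x, q⟩ := c
    have hlen := (length_signature i w).1
    by_cases h1 : x = i + 1
    · have h' : 2 ≤ (signature i w).1.length ∧ (signature i w).1.head? = some p := by
        simp only [signature, h1, if_true] at h
        split_ifs at h
        · simp at h
        · clear hlen
          generalize (signature i w).1 = l at *
          rcases l with _ | ⟨y, _ | ⟨z, l⟩⟩ <;> simp_all
      obtain ⟨a, b, rfl, hb, ha⟩ := ih h'.2
      refine ⟨(x, q) :: a, b, rfl, hb, ?_⟩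
      have h2 := h'.1
      rw [hlen] at h2
      simp only [List.map_cons, List.map_append, eps, phi_append, phi] at h2 ⊢
      rw [if_neg (by rintro ⟨-, h⟩; simp [h, hb, ha] at h2), ha]
    · by_cases h2 : x = i ∧ (signature i w).1.length = 0
      · have h3 := List.length_eq_zero_iff.1 h2.2
        simp [signature, h2.1, h3] at h
        exact ⟨[], w, by simp [h, h2], by rw [← hlen]; exact h2.2, rfl⟩
      · have h' : (signature i w).1.head? = some p := by
          simp only [signature, h1, if_false] at h
          split_ifs at h
          · generalize (signature i w).1 = l at *
            rcases l with _ | ⟨y, l⟩ <;> simp_all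
          · exact h
        obtain ⟨a, b, rfl, hb, ha⟩ := ih h'
        exact ⟨(x, q) :: a, b, rfl, hb, by simp [eps, h1, ha]⟩

theorem Raises.eps_phi {i : ℕ} {w u : List ℕ} (h : Raises i w u) :
    eps i w = eps i u + 1 ∧ phi i u = phi i w + 1 := by
  obtain ⟨a, b, rfl, rfl, hb, ha⟩ := h
  simp [eps_append, phi_append, eps, phi, hb, ha]

theorem Raises.right_unique {i : ℕ} {w u v : List ℕ} (h : Raises i w u) (h' : Raises i w v) :
    u = v := by
  obtain ⟨a, b, rfl, rfl, hb, ha⟩ := h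
  obtain ⟨a', b', hw, rfl, hb', ha'⟩ := h'
  rcases List.append_eq_append_iff.1 hw with ⟨c, rfl, hc⟩ | ⟨c, rfl, hc⟩ <;>
    rcases c with _ | ⟨z, c⟩ <;> simp at hc
  · simp [hc]
  · obtain ⟨rfl, rfl⟩ := hc
    simp [eps_append, phi_append, eps, phi] at ha' hb
    simp [hb] at ha'
  · simp [hc]
  · obtain ⟨rfl, rfl⟩ := hc
    simp [eps_append, phi_append, eps, phi] at ha hb'
    simp [hb'] at ha

theorem Raises.left_unique {i : ℕ} {w u v : List ℕ} (h : Raises i u w) (h' : Raises i v w) :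
    u = v := by
  obtain ⟨a, b, rfl, rfl, hb, ha⟩ := h
  obtain ⟨a', b', rfl, hw, hb', ha'⟩ := h'
  rcases List.append_eq_append_iff.1 hw with ⟨c, hc', hc⟩ | ⟨c, hc', hc⟩ <;> subst hc' <;>
    rcases c with _ | ⟨z, c⟩ <;> simp at hc
  · simp [hc]
  · obtain ⟨rfl, rfl⟩ := hc
    simp [eps_append, phi_append, eps, phi] at ha' hb
    omega
  · simp [hc]
  · obtain ⟨rfl, rfl⟩ := hc
    simp [eps_append, phi_append, eps, phi] at ha hb'
    omega

theorem unmatched_eq (i : ℕ) (w : List ℕ) : unmatched i w = signature i w.zipIdx := by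
  rw [unmatched, bracketScan_eq]
  simp [signatureMul]

theorem map_fst_zipIdx (w : List ℕ) (n : ℕ) : (w.zipIdx n).map Prod.fst = w := by
  simp

theorem set_of_zipIdx_eq {w : List ℕ} {x p y : ℕ} {a b : List (ℕ × ℕ)}
    (h : w.zipIdx = a ++ (x, p) :: b) :
    w = a.map Prod.fst ++ x :: b.map Prod.fst ∧
      w.set p y = a.map Prod.fst ++ y :: b.map Prod.fst := by
  have h1 := congrArg (List.map Prod.fst) h
  have h2 := congrArg (fun l => l[a.length]?) h
  simp only [map_fst_zipIdx, List.map_append, List.map_cons] at h1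
  simp [h1] at h2
  refine ⟨h1, ?_⟩
  rw [h1, ← h2, List.set_append_right _ _ (by simp)]
  simp

theorem wordE_eq_none (i : ℕ) (w : List ℕ) : wordE i w = none ↔ eps i w = 0 := by
  rw [wordE, unmatched_eq, Option.map_eq_none_iff, List.getLast?_eq_none_iff,
    ← List.length_eq_zero_iff, (length_signature i _).2, map_fst_zipIdx]

theorem wordF_eq_none (i : ℕ) (w : List ℕ) : wordF i w = none ↔ phi i w = 0 := by
  rw [wordF, unmatched_eq, Option.map_eq_none_iff, List.head?_eq_none_iff,
    ← List.length_eq_zero_iff, (length_signature i _).1, map_fst_zipIdx]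

theorem raises_of_wordE {i : ℕ} {w u : List ℕ} (h : wordE i w = some u) : Raises i w u := by
  rw [wordE, unmatched_eq, Option.map_eq_some_iff] at h
  obtain ⟨p, hp, rfl⟩ := h
  obtain ⟨a, b, h, hb, ha⟩ := exists_of_signature_snd hp
  obtain ⟨h1, h2⟩ := set_of_zipIdx_eq (y := i) h
  exact ⟨_, _, h1, h2, hb, ha⟩

theorem raises_of_wordF {i : ℕ} {w u : List ℕ} (h : wordF i w = some u) : Raises i u w := by
  rw [wordF, unmatched_eq, Option.map_eq_some_iff] at h
  obtain ⟨p, hp, rfl⟩ := h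
  obtain ⟨a, b, h, hb, ha⟩ := exists_of_signature_fst hp
  obtain ⟨h1, h2⟩ := set_of_zipIdx_eq (y := i + 1) h
  exact ⟨_, _, h2, h1, hb, ha⟩

theorem wordE_eq_some (i : ℕ) (w u : List ℕ) : wordE i w = some u ↔ Raises i w u := by
  refine ⟨raises_of_wordE, fun h => ?_⟩
  rcases h' : wordE i w with _ | v
  · rw [wordE_eq_none] at h'
    have := h.eps_phi
    omega
  · rw [h.right_unique (raises_of_wordE h')]

theorem wordF_eq_some (i : ℕ) (w u : List ℕ) : wordF i w = some u ↔ Raises i u w := by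
  refine ⟨raises_of_wordF, fun h => ?_⟩
  rcases h' : wordF i w with _ | v
  · rw [wordF_eq_none] at h'
    have := h.eps_phi
    omega
  · rw [h.left_unique (raises_of_wordF h')]

theorem exists_raises {i : ℕ} {w : List ℕ} (h : eps i w ≠ 0) : ∃ u, Raises i w u := by
  rcases h' : wordE i w with _ | v
  · exact absurd ((wordE_eq_none i w).1 h') h
  · exact ⟨v, raises_of_wordE h'⟩

theorem Raises.eps_ne_zero {i : ℕ} {w u : List ℕ} (h : Raises i w u) : eps i w ≠ 0 := by
  have := h.eps_phi
  omega

theorem Raises.length_eq {i : ℕ} {w u : List ℕ} (h : Raises i w u) : u.length = w.length := by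
  obtain ⟨a, b, rfl, rfl, -⟩ := h
  simp

/-- The tensor product rule, when the raising operator acts on the left factor. -/
theorem Raises.append_right {i : ℕ} {u u' : List ℕ} (h : Raises i u u') {v : List ℕ}
    (hv : phi i v < eps i u) : Raises i (u ++ v) (u' ++ v) := by
  obtain ⟨a, b, rfl, rfl, hb, ha⟩ := h
  refine ⟨a, b ++ v, by simp, by simp, ?_, ha⟩
  simp [eps_append, eps, ha, hb] at hv
  rw [phi_append]
  omega

/-- The tensor product rule, when the raising operator acts on the right factor. -/
theorem Raises.append_left {i : ℕ} {v v' : List ℕ} (h : Raises i v v') {u : List ℕ}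
    (hu : eps i u ≤ phi i v) : Raises i (u ++ v) (u ++ v') := by
  obtain ⟨a, b, rfl, rfl, hb, ha⟩ := h
  refine ⟨u ++ a, b, by simp, by simp, hb, ?_⟩
  simp [phi_append, phi, ha, hb] at hu
  rw [eps_append]
  omega

theorem raises_append {i : ℕ} {u v w : List ℕ} (h : Raises i (u ++ v) w) :
    (phi i v < eps i u ∧ ∃ u', Raises i u u' ∧ w = u' ++ v) ∨
      (eps i u ≤ phi i v ∧ ∃ v', Raises i v v' ∧ w = u ++ v') := by
  rcases lt_or_ge (phi i v) (eps i u) with h' | h'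
  · obtain ⟨u', hu'⟩ := exists_raises (i := i) (w := u) (by omega)
    exact .inl ⟨h', u', hu', h.right_unique (hu'.append_right h')⟩
  · have := h.eps_ne_zero
    rw [eps_append] at this
    obtain ⟨v', hv'⟩ := exists_raises (i := i) (w := v) (by omega)
    exact .inr ⟨h', v', hv', h.right_unique (hv'.append_left h')⟩

/-! ### Row insertion and its dual -/

/-- Row insertion with parameter `d`: `x` replaces the leftmost entry `y` with `x < y + d`.  For
`d = 0` this is the usual row insertion `rowInsert`, for `d = 1` its dual, in which an entry is
also bumped by an equal one. -/
def rowIns (d x : ℕ) : List ℕ → List ℕ × Option ℕ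
  | [] => ([x], none)
  | y :: r => if x < y + d then (x :: r, some y) else (y :: (rowIns d x r).1, (rowIns d x r).2)

/-- Insertion of `x` into a tableau, by the row insertion with parameter `d`. -/
def insT (d : ℕ) : ℕ → List (List ℕ) → List (List ℕ)
  | x, [] => [[x]]
  | x, r :: P =>
    match rowIns d x r with
    | (r', none) => r' :: P
    | (r', some y) => r' :: insT d y P

/-- The row of the new box when `x` is inserted into a tableau. -/
def newRow (d : ℕ) : ℕ → List (List ℕ) → ℕ
  | _, [] => 0
  | x, r :: P =>
    match rowIns d x r with
    | (_, none) => 0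
    | (_, some y) => newRow d y P + 1

/-- Put `a` at the end of the row with index `k`. -/
def addAt {α : Type*} : ℕ → α → List (List α) → List (List α)
  | 0, a, Q => (Q.headD [] ++ [a]) :: Q.tail
  | k + 1, a, Q => Q.headD [] :: addAt k a Q.tail

theorem rowIns_of_forall {d x : ℕ} {r : List ℕ} (h : ∀ p ∈ r, p + d ≤ x) :
    rowIns d x r = (r ++ [x], none) := by
  induction r with
  | nil => rfl
  | cons y r ih =>
    have h1 := h y (by simp)
    rw [rowIns, if_neg (by omega), ih (fun p hp => h p (by simp [hp]))]
    simp

theorem rowIns_append_cons {d x z : ℕ} {a b : List ℕ} (h : ∀ p ∈ a, p + d ≤ x)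
    (hz : x < z + d) : rowIns d x (a ++ z :: b) = (a ++ x :: b, some z) := by
  induction a with
  | nil => simp [rowIns, hz]
  | cons y r ih =>
    have h1 := h y (by simp)
    rw [List.cons_append, rowIns, if_neg (by omega), ih (fun p hp => h p (by simp [hp]))]
    simp

theorem forall_or_exists_bump (d x : ℕ) (r : List ℕ) :
    (∀ p ∈ r, p + d ≤ x) ∨
      ∃ a z b, r = a ++ z :: b ∧ (∀ p ∈ a, p + d ≤ x) ∧ x < z + d := by
  induction r with
  | nil => simp
  | cons y r ih =>
    rcases lt_or_ge x (y + d) with h | h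
    · exact .inr ⟨[], y, r, rfl, by simp, h⟩
    · rcases ih with h' | ⟨a, z, b, rfl, ha, hz⟩
      · left; simpa [h] using h'
      · exact .inr ⟨y :: a, z, b, rfl, by simpa [h] using ha, hz⟩

theorem insT_of_forall {d x : ℕ} {r : List ℕ} {P : List (List ℕ)} (h : ∀ p ∈ r, p + d ≤ x) :
    insT d x (r :: P) = (r ++ [x]) :: P := by
  simp [insT, rowIns_of_forall h]

theorem newRow_of_forall {d x : ℕ} {r : List ℕ} {P : List (List ℕ)} (h : ∀ p ∈ r, p + d ≤ x) :
    newRow d x (r :: P) = 0 := by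
  simp [newRow, rowIns_of_forall h]

theorem insT_bump {d x z : ℕ} {a b : List ℕ} {P : List (List ℕ)} (h : ∀ p ∈ a, p + d ≤ x)
    (hz : x < z + d) : insT d x ((a ++ z :: b) :: P) = (a ++ x :: b) :: insT d z P := by
  simp [insT, rowIns_append_cons h hz]

theorem newRow_bump {d x z : ℕ} {a b : List ℕ} {P : List (List ℕ)} (h : ∀ p ∈ a, p + d ≤ x)
    (hz : x < z + d) : newRow d x ((a ++ z :: b) :: P) = newRow d z P + 1 := by
  simp [newRow, rowIns_append_cons h hz]

theorem rowInsert_eq (x : ℕ) (r : List ℕ) : rowInsert x r = rowIns 0 x r := by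
  induction r with
  | nil => rfl
  | cons y r ih => simp [rowInsert, rowIns, ih]

theorem rskInsert_eq (a x : ℕ) (P Q : List (List ℕ)) (h : P.length = Q.length) :
    rskInsert a x P Q = (insT 0 x P, addAt (newRow 0 x P) a Q) := by
  induction P generalizing x Q with
  | nil =>
    obtain rfl := List.length_eq_zero_iff.1 h.symm
    simp [rskInsert, insT, newRow, addAt]
  | cons r P ih =>
    have h' : P.length = Q.tail.length := by simp [← h]
    rcases forall_or_exists_bump 0 x r with h1 | ⟨b, z, c, rfl, hb, hz⟩
    · rw [insT_of_forall h1, newRow_of_forall h1]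
      simp [rskInsert, rowInsert_eq, rowIns_of_forall h1, addAt]
    · rw [insT_bump hb hz, newRow_bump hb hz]
      simp [rskInsert, rowInsert_eq, rowIns_append_cons hb hz, addAt, ih _ _ h']

theorem map_length_addAt {α β : Type*} {k : ℕ} (a : α) (b : β) {P : List (List α)}
    {Q : List (List β)} (h : P.map List.length = Q.map List.length) :
    (addAt k a P).map List.length = (addAt k b Q).map List.length := by
  induction k generalizing P Q with
  | zero => rcases P with _ | ⟨r, P⟩ <;> rcases Q with _ | ⟨s, Q⟩ <;> simp_all [addAt]
  | succ k ih =>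
    have := ih (P := P.tail) (Q := Q.tail) (by simp [h])
    rcases P with _ | ⟨r, P⟩ <;> rcases Q with _ | ⟨s, Q⟩ <;> simp_all [addAt]

theorem map_length_insT (d x : ℕ) (P : List (List ℕ)) :
    (insT d x P).map List.length = (addAt (newRow d x P) x P).map List.length := by
  induction P generalizing x with
  | nil => simp [insT, newRow, addAt]
  | cons r P ih =>
    rcases forall_or_exists_bump d x r with h1 | ⟨b, z, c, rfl, hb, hz⟩
    · rw [insT_of_forall h1, newRow_of_forall h1]
      simp [addAt]
    · rw [insT_bump hb hz, newRow_bump hb hz]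
      simp [addAt, ih, map_length_addAt z x (P := P) rfl]

theorem getD_addAt {α : Type*} (k : ℕ) (a : α) (Q : List (List α)) (j : ℕ) :
    (addAt k a Q).getD j [] = if j = k then Q.getD k [] ++ [a] else Q.getD j [] := by
  induction k generalizing Q j with
  | zero => rcases Q with _ | ⟨r, Q⟩ <;> rcases j with _ | j <;> simp [addAt]
  | succ k ih =>
    rcases j with _ | j
    · rcases Q with _ | ⟨r, Q⟩ <;> simp [addAt]
    · have := ih Q.tail j
      rcases Q with _ | ⟨r, Q⟩ <;> simp_all [addAt]

theorem flatten_addAt_perm {α : Type*} (k : ℕ) (a : α) (Q : List (List α)) :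
    (addAt k a Q).flatten.Perm (a :: Q.flatten) := by
  induction k generalizing Q with
  | zero =>
    rcases Q with _ | ⟨r, Q⟩
    · simp [addAt]
    · simp only [addAt, List.headD_cons, List.tail_cons, List.flatten_cons, List.append_assoc]
      exact List.perm_middle
  | succ k ih =>
    rcases Q with _ | ⟨r, Q⟩
    · simpa [addAt] using ih []
    · simp only [addAt, List.headD_cons, List.tail_cons, List.flatten_cons]
      exact ((ih Q).append_left r).trans List.perm_middle

theorem flatten_insT_perm (d x : ℕ) (P : List (List ℕ)) :
    (insT d x P).flatten.Perm (x :: P.flatten) := by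
  induction P generalizing x with
  | nil => simp [insT]
  | cons r P ih =>
    rcases forall_or_exists_bump d x r with h1 | ⟨b, z, c, rfl, hb, hz⟩
    · rw [insT_of_forall h1]
      simp only [List.flatten_cons, List.append_assoc]
      exact List.perm_middle
    · rw [insT_bump hb hz]
      simp only [List.flatten_cons, List.append_assoc, List.cons_append]
      refine List.perm_middle.trans (.cons x (.append_left b ?_))
      exact ((ih z).append_left c).trans List.perm_middle

/-! ### Tableaux with parameter `d` -/

/-- The row `r` may stand above the row `s`: it is at least as long, and the columns satisfy the
column condition with parameter `d`. -/
def Over (d : ℕ) (r s : List ℕ) : Prop :=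
  ∀ j b : ℕ, s[j]? = some b → ∃ a : ℕ, r[j]? = some a ∧ a < b + d

/-- Row condition with parameter `d`: weakly increasing for `d = 0`, strictly for `d = 1`. -/
def SortedRow (d : ℕ) (r : List ℕ) : Prop := r.Pairwise fun a b => a + d ≤ b

/-- Lists of rows of a tableau.  For `d = 0` this is semistandardness; for `d = 1` the transpose
is semistandard, i.e. the rows are strict and the columns weak. -/
structure IsTab (d : ℕ) (P : List (List ℕ)) : Prop where
  ne_nil : ∀ r ∈ P, r ≠ []
  sorted : ∀ r ∈ P, SortedRow d r
  chain : P.IsChain (Over d)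

theorem Over.append_right {d : ℕ} {r s : List ℕ} (h : Over d r s) (t : List ℕ) :
    Over d (r ++ t) s := by
  intro j b hj
  obtain ⟨a, ha, hab⟩ := h j b hj
  refine ⟨a, ?_, hab⟩
  rw [List.getElem?_append_left (List.getElem?_eq_some_iff.1 ha).1, ha]

theorem getElem?_append_cons {α : Type*} (a : List α) (x : α) (b : List α) (j : ℕ) :
    (a ++ x :: b)[j]? =
      if j < a.length then a[j]? else if j = a.length then some x else b[j - a.length - 1]? := by
  rw [List.getElem?_append]
  split_ifs with h1 h2
  · rfl
  · simp [h2]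
  · rw [List.getElem?_cons, if_neg (by omega)]

/-- The entry bumped out of a row is inserted into the next row at the same position or further to
the left, so that the columns stay increasing. -/
theorem Over.bump {d x z : ℕ} {a b s : List ℕ} (hd : d ≤ 1) (h : Over d (a ++ z :: b) s)
    (ha : ∀ p ∈ a, p + d ≤ x) (hz : x < z + d) :
    Over d (a ++ x :: b) (rowIns d z s).1 := by
  -- the position of `z` in the lower row is at most its position in the upper row
  have left : ∀ u : List ℕ, (∀ p ∈ u, p + d ≤ z) → (∃ t, s = u ++ t) → u.length ≤ a.length := by
    rintro u hu ⟨t, rfl⟩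
    by_contra hlt
    obtain ⟨w, hw⟩ : ∃ w, u[a.length]? = some w :=
      ⟨_, List.getElem?_eq_getElem (by omega)⟩
    obtain ⟨q, hq, hq'⟩ := h a.length w
      (by rw [List.getElem?_append_left (by omega), hw])
    rw [getElem?_append_cons, if_neg (by omega), if_pos rfl, Option.some.injEq] at hq
    have := hu _ (List.mem_of_getElem? hw)
    omega
  have new : ∀ j ≤ a.length, ∃ q, (a ++ x :: b)[j]? = some q ∧ q < z + d := by
    intro j hj
    rcases hj.lt_or_eq with hj | rfl
    · have := ha _ (List.getElem_mem (l := a) hj)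
      exact ⟨a[j], by rw [getElem?_append_cons, if_pos hj, List.getElem?_eq_getElem], by omega⟩
    · exact ⟨x, by rw [getElem?_append_cons, if_neg (by omega), if_pos rfl], hz⟩
  have old : ∀ j q : ℕ, s[j]? = some q → ∃ p, (a ++ x :: b)[j]? = some p ∧ p < q + d := by
    intro j q hj
    obtain ⟨p, hp, hpq⟩ := h j q hj
    rw [getElem?_append_cons] at hp ⊢
    split_ifs at hp ⊢ with h1 h2
    · exact ⟨p, hp, hpq⟩
    · obtain rfl : z = p := by simpa using hp
      exact ⟨x, rfl, by omega⟩
    · exact ⟨p, hp, hpq⟩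
  rcases forall_or_exists_bump d z s with h1 | ⟨a', z', b', rfl, ha', hz'⟩
  · rw [rowIns_of_forall h1]
    have := left s h1 ⟨[], by simp⟩
    intro j q hj
    rw [getElem?_append_cons] at hj
    split_ifs at hj with h2 h3
    · exact old j q hj
    · obtain rfl : z = q := by simpa using hj
      exact new j (by omega)
    · simp at hj
  · rw [rowIns_append_cons ha' hz']
    have := left a' ha' ⟨_, rfl⟩
    intro j q hj
    have h4 := old j q
    rw [getElem?_append_cons] at hj h4
    split_ifs at hj h4 with h2 h3
    · exact h4 hj
    · obtain rfl : z = q := by simpa using hj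
      exact new j (by omega)
    · exact h4 hj

theorem SortedRow.append_singleton {d x : ℕ} {r : List ℕ} (h : SortedRow d r)
    (hx : ∀ p ∈ r, p + d ≤ x) : SortedRow d (r ++ [x]) := by
  simp only [SortedRow, List.pairwise_append, List.pairwise_singleton, List.mem_singleton,
    forall_eq, true_and]
  exact ⟨h, hx⟩

theorem SortedRow.bump {d x z : ℕ} {a b : List ℕ} (hd : d ≤ 1) (h : SortedRow d (a ++ z :: b))
    (ha : ∀ p ∈ a, p + d ≤ x) (hz : x < z + d) : SortedRow d (a ++ x :: b) := by
  simp only [SortedRow, List.pairwise_append, List.pairwise_cons, List.mem_cons,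
    forall_eq_or_imp] at h ⊢
  refine ⟨h.1, ⟨fun p hp => ?_, h.2.1.2⟩, fun p hp => ⟨ha p hp, (h.2.2 p hp).2⟩⟩
  have := h.2.1.1 p hp
  omega

theorem insT_eq_cons (d x : ℕ) (P : List (List ℕ)) :
    ∃ P', insT d x P = (rowIns d x (P.headD [])).1 :: P' := by
  rcases P with _ | ⟨r, P⟩
  · exact ⟨[], rfl⟩
  · rw [insT]
    rw [List.headD_cons]
    rcases rowIns d x r with ⟨r', _ | y⟩ <;> exact ⟨_, rfl⟩

theorem isTab_cons {d : ℕ} {r : List ℕ} {P : List (List ℕ)} :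
    IsTab d (r :: P) ↔ r ≠ [] ∧ SortedRow d r ∧ Over d r (P.headD []) ∧ IsTab d P := by
  constructor
  · rintro ⟨h1, h2, h3⟩
    refine ⟨h1 r (by simp), h2 r (by simp), ?_, fun s hs => h1 s (by simp [hs]),
      fun s hs => h2 s (by simp [hs]), h3.of_cons⟩
    rcases P with _ | ⟨s, P⟩
    · intro j b hj; simp at hj
    · exact (List.isChain_cons_cons.1 h3).1
  · rintro ⟨h1, h2, h3, h4⟩
    refine ⟨by simpa [h1] using h4.ne_nil, by simpa [h2] using h4.sorted, ?_⟩
    rcases P with _ | ⟨s, P⟩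
    · exact .singleton _
    · exact List.isChain_cons_cons.2 ⟨h3, h4.chain⟩

theorem isTab_nil (d : ℕ) : IsTab d [] := ⟨by simp, by simp, .nil⟩

theorem IsTab.insT {d x : ℕ} {P : List (List ℕ)} (hd : d ≤ 1) (h : IsTab d P) :
    IsTab d (insT d x P) := by
  induction P generalizing x with
  | nil =>
    refine isTab_cons.2 ⟨by simp, by simp [SortedRow], ?_, isTab_nil d⟩
    intro j b hj; simp at hj
  | cons r P ih =>
    rw [isTab_cons] at h
    rcases forall_or_exists_bump d x r with h1 | ⟨a, z, b, rfl, ha, hz⟩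
    · rw [insT_of_forall h1]
      exact isTab_cons.2 ⟨by simp, h.2.1.append_singleton h1, h.2.2.1.append_right _, h.2.2.2⟩
    · rw [insT_bump ha hz]
      refine isTab_cons.2 ⟨by simp, h.2.1.bump hd ha hz, ?_, ih h.2.2.2⟩
      obtain ⟨P', hP'⟩ := insT_eq_cons d z P
      rw [hP']
      exact h.2.2.1.bump hd ha hz

/-! ### Comparing successive insertions -/

/-- Row bumping lemma: if the second inserted letter does not come before the first one, then its
new box is weakly higher. -/
theorem newRow_insT_le {d x x' : ℕ} {P : List (List ℕ)} (h : ∀ r ∈ P, SortedRow d r)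
    (hx : x + d ≤ x') : newRow d x' (insT d x P) ≤ newRow d x P := by
  induction P generalizing x x' with
  | nil =>
    rw [insT, newRow_of_forall (by simpa using hx)]
    exact Nat.zero_le _
  | cons r P ih =>
    rcases forall_or_exists_bump d x r with h1 | ⟨a, z, b, rfl, ha, hz⟩
    · rw [insT_of_forall h1, newRow_of_forall]
      · exact Nat.zero_le _
      · intro p hp
        rcases List.mem_append.1 hp with hp | hp
        · have := h1 p hp; omega
        · simp at hp; omega
    · rw [insT_bump ha hz, newRow_bump ha hz]
      have hax : ∀ p ∈ a ++ [x], p + d ≤ x' := by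
        intro p hp
        rcases List.mem_append.1 hp with hp | hp
        · have := ha p hp; omega
        · simp at hp; omega
      rcases forall_or_exists_bump d x' b with h2 | ⟨a', z', b', rfl, ha', hz'⟩
      · rw [newRow_of_forall]
        · exact Nat.zero_le _
        · intro p hp
          rcases List.mem_append.1 hp with hp | hp
          · exact hax p (by simp [hp])
          · rcases List.mem_cons.1 hp with rfl | hp
            · exact hx
            · exact h2 p hp
      · rw [show a ++ x :: (a' ++ z' :: b') = (a ++ x :: a') ++ z' :: b' by simp,
          newRow_bump _ hz']
        -- the entry bumped by `x'` is to the right of the entry bumped by `x`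
        · have h3 := h _ (List.mem_cons_self ..)
          simp only [SortedRow, List.pairwise_append, List.pairwise_cons] at h3
          exact Nat.succ_le_succ (ih (fun s hs => h s (by simp [hs])) (h3.2.1.1 z' (by simp)))
        · intro p hp
          rcases List.mem_append.1 hp with hp | hp
          · exact hax p (by simp [hp])
          · rcases List.mem_cons.1 hp with rfl | hp
            · exact hx
            · exact ha' p hp

/-- Row bumping lemma: if the second inserted letter comes before the first one, then its new box
is strictly lower. -/
theorem newRow_lt_newRow_insT {d x x' : ℕ} {P : List (List ℕ)} (hx : x' < x + d) :
    newRow d x P < newRow d x' (insT d x P) := by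
  induction P generalizing x x' with
  | nil =>
    rw [insT, newRow, ← List.nil_append [x], newRow_bump (by simp) hx]
    exact Nat.succ_pos _
  | cons r P ih =>
    rcases forall_or_exists_bump d x r with h1 | ⟨a, z, b, rfl, ha, hz⟩
    · rw [insT_of_forall h1, newRow_of_forall h1]
      rcases forall_or_exists_bump d x' r with h2 | ⟨a', z', b', rfl, ha', hz'⟩
      · rw [newRow_bump h2 hx]; exact Nat.succ_pos _
      · rw [List.append_assoc, List.cons_append, newRow_bump ha' hz']; exact Nat.succ_pos _
    · rw [insT_bump ha hz, newRow_bump ha hz]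
      rcases forall_or_exists_bump d x' a with h2 | ⟨a', z', b', rfl, ha', hz'⟩
      · rw [newRow_bump h2 hx]
        exact Nat.succ_lt_succ (ih hz)
      · rw [List.append_assoc, List.cons_append, newRow_bump ha' hz']
        refine Nat.succ_lt_succ (ih ?_)
        have := ha z' (by simp)
        omega

/-- Insertion of `x` into a tableau in which a dominant entry `y` has been put at the end of row
`k`.  It commutes with adding `y`, unless the insertion of `x` ends in row `k`; then `y` is bumped
to the end of the next row. -/
theorem insT_addAt {d x y k : ℕ} {P : List (List ℕ)} (hxy : x < y + d)
    (hlt : ∀ j < k, ∀ p ∈ P.getD j [], p < y + d)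
    (hle : ∀ j, k ≤ j → ∀ p ∈ P.getD j [], p + d ≤ y) :
    insT d x (addAt k y P) =
        addAt (if newRow d x P = k then k + 1 else k) y (insT d x P) ∧
      newRow d x (addAt k y P) =
        if newRow d x P = k then k + 1 else newRow d x P := by
  induction k generalizing x P with
  | zero =>
    have last : ∀ P : List (List ℕ), (∀ p ∈ P.headD [], p + d ≤ y) →
        insT d y P = addAt 0 y P ∧ newRow d y P = 0 := by
      intro P hP
      rcases P with _ | ⟨r, P⟩
      · simp [insT, addAt, newRow]
      · simp only [List.headD_cons] at hP
        simp [insT_of_forall hP, newRow_of_forall hP, addAt]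
    have h1 : ∀ p ∈ P.tail.headD [], p + d ≤ y := by
      have := hle 1 (by omega)
      rcases P with _ | ⟨r, _ | ⟨s, P⟩⟩
      · simp
      · simp
      · simpa using this
    rcases forall_or_exists_bump d x (P.headD []) with h2 | ⟨a, z, b, hr, ha, hz⟩
    · have h3 : newRow d x P = 0 ∧ insT d x P = (P.headD [] ++ [x]) :: P.tail := by
        rcases P with _ | ⟨r, P⟩
        · simp [insT, newRow]
        · exact ⟨newRow_of_forall h2, insT_of_forall h2⟩
      rw [if_pos h3.1, if_pos h3.1, h3.2, addAt, insT_bump h2 hxy, newRow_bump h2 hxy,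
        (last _ h1).1, (last _ h1).2]
      simp [addAt]
    · obtain ⟨P', rfl⟩ : ∃ P', P = (a ++ z :: b) :: P' := by
        rcases P with _ | ⟨r, P⟩
        · simp at hr
        · simp at hr; simp [hr]
      simp only [addAt, List.headD_cons, List.tail_cons, List.append_assoc, List.cons_append]
      rw [insT_bump ha hz, newRow_bump ha hz, insT_bump ha hz, newRow_bump ha hz]
      simp [addAt]
  | succ k ih =>
    rcases P with _ | ⟨r, P⟩
    · simp only [addAt, List.headD_nil, List.tail_nil]
      rw [insT_of_forall (by simp), newRow_of_forall (by simp)]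
      simp [insT, newRow, addAt]
    · have hlt' : ∀ j < k, ∀ p ∈ P.getD j [], p < y + d := fun j hj => by
        simpa using hlt (j + 1) (by omega)
      have hle' : ∀ j, k ≤ j → ∀ p ∈ P.getD j [], p + d ≤ y := fun j hj => by
        simpa using hle (j + 1) (by omega)
      have h0 := hlt 0 (by omega)
      simp only [List.getD_cons_zero] at h0
      simp only [addAt, List.headD_cons, List.tail_cons]
      rcases forall_or_exists_bump d x r with h2 | ⟨a, z, b, rfl, ha, hz⟩
      · simp [insT_of_forall h2, newRow_of_forall h2, addAt]
      · obtain ⟨h3, h4⟩ := ih (x := z) (h0 z (by simp)) hlt' hle'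
        rw [insT_bump ha hz, newRow_bump ha hz, insT_bump ha hz, newRow_bump ha hz, h3, h4]
        by_cases h5 : newRow d z P = k <;> simp [h5, addAt]

/-! ### The symmetry of RSK -/

/-- One step of RSK with parameter `d`: the second entry of the biletter is inserted into the first
tableau and the first entry is recorded in the second tableau. -/
def insRec (d : ℕ) (b : ℕ × ℕ) (s : List (List ℕ) × List (List ℕ)) :
    List (List ℕ) × List (List ℕ) :=
  (insT d b.2 s.1, addAt (newRow d b.2 s.1) b.1 s.2)

/-- RSK with parameter `d`, processing the biletters from right to left. -/
def run (d : ℕ) (L : List (ℕ × ℕ)) : List (List ℕ) × List (List ℕ) :=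
  L.foldr (insRec d) ([], [])

theorem run_cons (d : ℕ) (b : ℕ × ℕ) (L : List (ℕ × ℕ)) :
    run d (b :: L) = insRec d b (run d L) := rfl

theorem map_length_run (d : ℕ) (L : List (ℕ × ℕ)) :
    (run d L).1.map List.length = (run d L).2.map List.length := by
  induction L with
  | nil => rfl
  | cons b L ih =>
    rw [run_cons, insRec, map_length_insT]
    exact map_length_addAt _ _ ih

theorem length_run (d : ℕ) (L : List (ℕ × ℕ)) : (run d L).1.length = (run d L).2.length := by
  simpa using congrArg List.length (map_length_run d L)

theorem flatten_run_fst_perm (d : ℕ) (L : List (ℕ × ℕ)) :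
    (run d L).1.flatten.Perm (L.map Prod.snd) := by
  induction L with
  | nil => exact .nil
  | cons b L ih => exact (flatten_insT_perm _ _ _).trans (ih.cons _)

theorem flatten_run_snd_perm (d : ℕ) (L : List (ℕ × ℕ)) :
    (run d L).2.flatten.Perm (L.map Prod.fst) := by
  induction L with
  | nil => exact .nil
  | cons b L ih => exact (flatten_addAt_perm _ _ _).trans (ih.cons _)

theorem isTab_run {d : ℕ} (hd : d ≤ 1) (L : List (ℕ × ℕ)) : IsTab d (run d L).1 := by
  induction L with
  | nil => exact isTab_nil d
  | cons b L ih => exact ih.insT hd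

theorem rsk_eq_run (W : List (ℕ × ℕ)) : rsk W = run 0 W.reverse := by
  rw [rsk, run, ← List.foldl_reverse, List.reverse_reverse]
  induction W using List.reverseRecOn with
  | nil => rfl
  | append_singleton W b ih =>
    simp only [List.foldl_append, List.foldl_cons, List.foldl_nil, ih]
    rw [rskInsert_eq, insRec]
    have := length_run 0 W.reverse
    rwa [run, ← List.foldl_reverse, List.reverse_reverse] at this

/-- `b` comes strictly after `c` in a Burge word. -/
def BurgeAfter (b c : ℕ × ℕ) : Prop := c.1 < b.1 ∨ (c.1 = b.1 ∧ b.2 < c.2)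

/-- Strict lexicographic order.  Applied to swapped biletters, this says that `b` comes strictly
before `c` in a crystal biword. -/
def LexAfter (b c : ℕ × ℕ) : Prop := c.1 < b.1 ∨ (c.1 = b.1 ∧ c.2 < b.2)

theorem mem_flatten_of_mem_getD {α : Type*} {Q : List (List α)} {j : ℕ} {p : α}
    (h : p ∈ Q.getD j []) : p ∈ Q.flatten := by
  rw [List.getD_eq_getElem?_getD] at h
  rcases hj : Q[j]? with _ | r
  · simp [hj] at h
  · rw [hj] at h
    exact List.mem_flatten.2 ⟨r, List.mem_of_getElem? hj, h⟩

theorem exists_mem_of_mem_record {d j p : ℕ} {L : List (ℕ × ℕ)}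
    (h : p ∈ (run d L).2.getD j []) : ∃ c ∈ L, c.1 = p := by
  have := (flatten_run_snd_perm d L).mem_iff.1 (mem_flatten_of_mem_getD h)
  simpa using this

/-- Among the rows of the recording tableau of a Burge word, equal largest entries are recorded
further and further down. -/
theorem lt_of_mem_record_burge {b : ℕ × ℕ} {L : List (ℕ × ℕ)}
    (h : (b :: L).Pairwise BurgeAfter) (j : ℕ) (hj : newRow 0 b.2 (run 0 L).1 ≤ j) (p : ℕ)
    (hp : p ∈ (run 0 L).2.getD j []) : p < b.1 := by
  induction L generalizing b j p with
  | nil => simp [run] at hp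
  | cons c L ih =>
    rw [List.pairwise_cons] at h
    rcases h.1 c (by simp) with h1 | ⟨h1, h2⟩
    · obtain ⟨c', hc', rfl⟩ := exists_mem_of_mem_record hp
      rcases List.mem_cons.1 hc' with rfl | hc'
      · exact h1
      · have := (List.pairwise_cons.1 h.2).1 c' hc'
        rcases this with h3 | ⟨h3, -⟩ <;> omega
    · have h3 := newRow_lt_newRow_insT (P := (run 0 L).1) (d := 0) (x := c.2) h2
      rw [run_cons] at hj hp
      simp only [insRec] at hj hp
      rw [getD_addAt, if_neg (by omega)] at hp
      rw [← h1]
      exact ih h.2 _ (by omega) _ hp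

/-- In the dual process, equal largest entries are recorded further and further up. -/
theorem lt_of_mem_record_lex {b : ℕ × ℕ} {L : List (ℕ × ℕ)}
    (h : (b :: L).Pairwise LexAfter) (j : ℕ) (hj : j < newRow 1 b.2 (run 1 L).1) (p : ℕ)
    (hp : p ∈ (run 1 L).2.getD j []) : p < b.1 := by
  induction L generalizing b j p with
  | nil => simp [run] at hp
  | cons c L ih =>
    rw [List.pairwise_cons] at h
    rcases h.1 c (by simp) with h1 | ⟨h1, h2⟩
    · obtain ⟨c', hc', rfl⟩ := exists_mem_of_mem_record hp
      rcases List.mem_cons.1 hc' with rfl | hc'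
      · exact h1
      · have := (List.pairwise_cons.1 h.2).1 c' hc'
        rcases this with h3 | ⟨h3, -⟩ <;> omega
    · have h3 := newRow_insT_le (P := (run 1 L).1) (d := 1) (x := c.2) (x' := b.2)
        (isTab_run le_rfl L).sorted (by omega)
      rw [run_cons] at hj hp
      simp only [insRec] at hj hp
      rw [getD_addAt, if_neg (by omega)] at hp
      rw [← h1]
      exact ih h.2 _ (by omega) _ hp

theorem insT_eq_addAt_zero {d x : ℕ} {P : List (List ℕ)} (h : ∀ p ∈ P.getD 0 [], p + d ≤ x) :
    insT d x P = addAt 0 x P ∧ newRow d x P = 0 := by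
  rcases P with _ | ⟨r, P⟩
  · simp [insT, newRow, addAt]
  · simp only [List.getD_cons_zero] at h
    simp [insT_of_forall h, newRow_of_forall h, addAt]

/-- Symmetry of RSK: the recording tableau of a Burge word is obtained by inserting the top
entries by dual insertion, in the order of increasing bottom entries and increasing top entries
for equal bottom entries; the insertion tableau then records the bottom entries. -/
theorem run_symm {L M : List (ℕ × ℕ)} (hL : L.Pairwise BurgeAfter) (hM : M.Pairwise LexAfter)
    (h : M.Perm (L.map Prod.swap)) : run 0 L = (run 1 M).swap := by
  induction hn : L.length using Nat.strong_induction_on generalizing L M with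
  | _ n ih =>
  rcases L with _ | ⟨⟨x', y'⟩, L⟩
  · obtain rfl : M = [] := by simpa using h
    rfl
  rcases M with _ | ⟨⟨y, x⟩, M⟩
  · simpa using h.length_eq
  have hL' := List.pairwise_cons.1 hL
  have hM' := List.pairwise_cons.1 hM
  -- If the same biletter is last in both orders, it is dominant in both entries, so that both
  -- processes put it at the end of the first row.
  by_cases heq : (x, y) = (x', y')
  · obtain ⟨rfl, rfl⟩ := Prod.mk.inj heq
    have hp : M.Perm (L.map Prod.swap) := by simpa using h
    have h1 := ih L.length (by simp [← hn]) hL'.2 hM'.2 hp rfl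
    have h2 : ∀ p ∈ (run 0 L).1.getD 0 [], p + 0 ≤ y := by
      intro p hp
      rw [h1] at hp
      obtain ⟨c', hc', rfl⟩ := exists_mem_of_mem_record hp
      rcases hM'.1 c' hc' with h3 | ⟨h3, -⟩ <;> simp at h3 <;> omega
    have h3 : ∀ p ∈ (run 1 M).1.getD 0 [], p + 1 ≤ x := by
      intro p hq
      rw [← Prod.snd_swap, ← h1] at hq
      obtain ⟨c', hc', rfl⟩ := exists_mem_of_mem_record hq
      have h3 := hM'.1 c'.swap (hp.mem_iff.2 (List.mem_map_of_mem hc'))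
      have h4 := hL'.1 c' hc'
      simp only [LexAfter, BurgeAfter, Prod.fst_swap, Prod.snd_swap] at h3 h4
      omega
    rw [run_cons, run_cons, insRec, insRec]
    simp only
    rw [(insT_eq_addAt_zero h2).1, (insT_eq_addAt_zero h2).2, (insT_eq_addAt_zero h3).1,
      (insT_eq_addAt_zero h3).2, h1]
    rfl
  -- Otherwise both last biletters are removed; `y` is dominant in the insertion tableau and `x'` in
  -- the recording tableau, and `insT_addAt` describes how they are put back.
  · have hx : (x, y) ∈ L := by
      have : (y, x) ∈ ((x', y') :: L).map Prod.swap := h.mem_iff.1 (by simp)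
      simp only [List.map_cons, List.mem_cons, List.mem_map, Prod.swap_prod_mk] at this
      rcases this with h1 | ⟨⟨u, v⟩, h1, h2⟩
      · simp at h1 heq; tauto
      · simp at h2; rwa [← h2.1, ← h2.2]
    have hy : (y', x') ∈ M := by
      have : (y', x') ∈ (y, x) :: M := h.mem_iff.2 (by simp)
      simp only [List.mem_cons] at this
      rcases this with h1 | h1
      · simp at h1 heq; tauto
      · exact h1
    set N := L.erase (x, y)
    set K := M.erase (y', x')
    have hN : L.Perm ((x, y) :: N) := List.perm_cons_erase hx
    have hK : M.Perm ((y', x') :: K) := List.perm_cons_erase hy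
    have hNK : K.Perm (N.map Prod.swap) := by
      have h1 : ((y, x) :: (y', x') :: K).Perm ((y, x) :: (y', x') :: N.map Prod.swap) := by
        refine (hK.symm.cons _).trans (h.trans ?_)
        refine ((hN.map Prod.swap).cons _).trans ?_
        exact .swap _ _ _
      simpa using h1
    have hlen := hN.length_eq
    have sN : N.Sublist L := List.erase_sublist
    have sK : K.Sublist M := List.erase_sublist
    simp only [List.length_cons] at hn hlen
    have hA := ih N.length (by omega) (hL'.2.sublist sN) (hM'.2.sublist sK) hNK rfl
    have pB : ((y, x) :: K).Pairwise LexAfter := hM.sublist (sK.cons_cons _)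
    have pC : ((x', y') :: N).Pairwise BurgeAfter := hL.sublist (sN.cons_cons _)
    have hB := ih L.length (by omega) hL'.2 pB
      ((hNK.cons _).trans (hN.map Prod.swap).symm) rfl
    have hC := ih (N.length + 1) (by omega) pC hM'.2 (hK.trans (hNK.cons _)) (by simp)
    have hC' : run 1 M = (run 0 ((x', y') :: N)).swap := by rw [hC, Prod.swap_swap]
    have hA' : run 1 K = (run 0 N).swap := by rw [hA, Prod.swap_swap]
    rw [run_cons, hB, run_cons 1, hA', run_cons 1, hC', run_cons]
    have i1 := lt_of_mem_record_lex pB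
    have i0 := lt_of_mem_record_burge pC
    have hyx := hL'.1 _ hx
    have hxy := hM'.1 _ hy
    simp only [LexAfter, BurgeAfter] at hyx hxy
    have g1 : ∀ j, ∀ p ∈ (run 1 K).2.getD j [], p ≤ y := by
      intro j p hp
      obtain ⟨c', hc', rfl⟩ := exists_mem_of_mem_record hp
      rcases (List.pairwise_cons.1 pB).1 c' hc' with h3 | ⟨h3, -⟩ <;> simp at h3 <;> omega
    have g0 : ∀ j, ∀ p ∈ (run 0 N).2.getD j [], p ≤ x' := by
      intro j p hp
      obtain ⟨c', hc', rfl⟩ := exists_mem_of_mem_record hp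
      rcases (List.pairwise_cons.1 pC).1 c' hc' with h3 | ⟨h3, -⟩ <;> simp at h3 <;> omega
    rw [hA'] at i1 g1
    simp only [Prod.fst_swap, Prod.snd_swap] at i1 g1 i0
    generalize run 0 N = s at *
    obtain ⟨P, Q⟩ := s
    simp only [insRec, Prod.swap_prod_mk] at i1 i0 g1 g0 ⊢
    obtain ⟨e1, e2⟩ := insT_addAt (d := 0) (x := y') (y := y) (k := newRow 1 x Q) (P := P)
      (by omega) (fun j hj p hp => i1 j hj p hp) (fun j hj p hp => g1 j p hp)
    obtain ⟨e3, e4⟩ := insT_addAt (d := 1) (x := x) (y := x') (k := newRow 0 y' P) (P := Q)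
      (by omega) (fun j hj p hp => Nat.lt_succ_of_le (g0 j p hp)) (fun j hj p hp => i0 j hj p hp)
    rw [e1, e2, e3, e4]
    by_cases hkl : newRow 0 y' P = newRow 1 x Q
    · simp [hkl]
    · simp [hkl, Ne.symm hkl]

instance : Std.Total burgeLE := ⟨fun p q => by unfold burgeLE; omega⟩
instance : IsTrans (ℕ × ℕ) burgeLE := ⟨fun p q r => by unfold burgeLE; omega⟩
instance : Std.Total crystalLE := ⟨fun p q => by unfold crystalLE; omega⟩
instance : IsTrans (ℕ × ℕ) crystalLE := ⟨fun p q r => by unfold crystalLE; omega⟩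

theorem perm_burgeSort (W : List (ℕ × ℕ)) : (burgeSort W).Perm W := List.perm_insertionSort _ W

theorem perm_crystalSort (W : List (ℕ × ℕ)) : (crystalSort W).Perm W :=
  List.perm_insertionSort _ W

theorem pairwise_burgeSort (W : List (ℕ × ℕ)) : (burgeSort W).Pairwise burgeLE :=
  List.pairwise_insertionSort _ W

theorem pairwise_crystalSort (W : List (ℕ × ℕ)) : (crystalSort W).Pairwise crystalLE :=
  List.pairwise_insertionSort _ W

theorem pairwise_burgeAfter_reverse {W : List (ℕ × ℕ)} (h : W.Pairwise burgeLE)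
    (hW : W.Nodup) : W.reverse.Pairwise BurgeAfter := by
  rw [List.pairwise_reverse]
  refine (h.and hW).imp ?_
  rintro ⟨a, b⟩ ⟨c, e⟩ ⟨h1, h2⟩
  simp only [burgeLE, BurgeAfter, ne_eq, Prod.mk.injEq] at *
  omega

theorem pairwise_lexAfter_map_swap {W : List (ℕ × ℕ)} (h : W.Pairwise crystalLE)
    (hW : W.Nodup) : (W.map Prod.swap).Pairwise LexAfter := by
  rw [List.pairwise_map]
  refine (h.and hW).imp ?_
  rintro ⟨a, b⟩ ⟨c, e⟩ ⟨h1, h2⟩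
  simp only [crystalLE, LexAfter, ne_eq, Prod.mk.injEq, Prod.swap_prod_mk] at *
  omega

/-- The symmetry of RSK in terms of Burge words and crystal biwords. -/
theorem rsk_eq_dual {W C : List (ℕ × ℕ)} (h : W.Pairwise burgeLE) (hW : W.Nodup)
    (hC : C.Pairwise crystalLE) (hp : C.Perm W) : rsk W = (run 1 (C.map Prod.swap)).swap := by
  rw [rsk_eq_run]
  refine run_symm (pairwise_burgeAfter_reverse h hW)
    (pairwise_lexAfter_map_swap hC (hp.nodup_iff.2 hW)) ?_
  exact (hp.trans (List.reverse_perm W).symm).map _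

/-! ### Dual insertion and the crystal operators -/

/-- Column reading word of the transpose of `Q`: the rows of `Q` from top to bottom, each from
right to left. -/
def columnWord {α : Type*} (Q : List (List α)) : List α := (Q.map List.reverse).flatten

@[simp] theorem columnWord_cons {α : Type*} (r : List α) (Q : List (List α)) :
    columnWord (r :: Q) = r.reverse ++ columnWord Q := by simp [columnWord]

theorem phi_eps_reverse {i : ℕ} {s : List ℕ} (hs : SortedRow 1 s) :
    phi i s.reverse = (if i ∈ s ∧ i + 1 ∉ s then 1 else 0) ∧
      eps i s.reverse = (if i + 1 ∈ s ∧ i ∉ s then 1 else 0) := by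
  induction s with
  | nil => simp [phi, eps]
  | cons y s ih =>
    have hs' := List.pairwise_cons.1 hs
    obtain ⟨h1, h2⟩ := ih hs'.2
    have h3 : i ∈ s → y < i := fun h => hs'.1 i h
    have h4 : i + 1 ∈ s → y < i + 1 := fun h => hs'.1 (i + 1) h
    rw [List.reverse_cons, phi_append, eps_append, h1, h2]
    simp only [phi, eps, List.mem_cons]
    constructor <;> split_ifs <;> first | rfl | omega | (exfalso; grind)

theorem phi_reverse {i : ℕ} {s : List ℕ} (hs : SortedRow 1 s) :
    phi i s.reverse = if i ∈ s ∧ i + 1 ∉ s then 1 else 0 := (phi_eps_reverse hs).1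

theorem eps_reverse {i : ℕ} {s : List ℕ} (hs : SortedRow 1 s) :
    eps i s.reverse = if i + 1 ∈ s ∧ i ∉ s then 1 else 0 := (phi_eps_reverse hs).2

theorem phi_eps_singleton (i x : ℕ) :
    (x = i ∧ phi i [x] = 1 ∧ eps i [x] = 0) ∨ (x = i + 1 ∧ phi i [x] = 0 ∧ eps i [x] = 1) ∨
      (x ≠ i ∧ x ≠ i + 1 ∧ phi i [x] = 0 ∧ eps i [x] = 0) := by
  by_cases h1 : x = i
  · simp [phi, eps, h1]
  · by_cases h2 : x = i + 1 <;> simp [phi, eps, h1, h2]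

theorem raises_singleton {i x : ℕ} {w : List ℕ} : Raises i [x] w ↔ x = i + 1 ∧ w = [i] := by
  constructor
  · rintro ⟨a, b, h, rfl, -⟩
    rcases a with _ | ⟨y, a⟩ <;> simp at h
    obtain ⟨rfl, rfl⟩ := h
    simp
  · rintro ⟨rfl, rfl⟩
    exact ⟨[], [], rfl, rfl, rfl, rfl⟩

/-- The raising operator on a strictly decreasing word. -/
theorem raises_reverse {i : ℕ} {s w : List ℕ} (hs : SortedRow 1 s) :
    Raises i s.reverse w ↔
      ∃ c e, s = c ++ (i + 1) :: e ∧ w = (c ++ i :: e).reverse ∧ ∀ p ∈ c, p < i := by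
  constructor
  · rintro ⟨a, b, h, rfl, hb, ha⟩
    obtain rfl : s = b.reverse ++ (i + 1) :: a.reverse := by
      rw [← List.reverse_reverse s, h]; simp
    refine ⟨b.reverse, a.reverse, rfl, by simp, fun p hp => ?_⟩
    have h1 := List.pairwise_append.1 hs
    have h2 := h1.2.2 p hp (i + 1) (by simp)
    have h3 : i ∉ b.reverse := by
      intro h4
      rw [← List.reverse_reverse b, phi_reverse h1.1, if_pos] at hb
      · simp at hb
      · refine ⟨h4, fun h5 => ?_⟩
        have := h1.2.2 _ h5 (i + 1) (by simp)
        omega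
    have h4 : p ≠ i := fun h => h3 (h ▸ hp)
    omega
  · rintro ⟨c, e, rfl, rfl, hc⟩
    have h1 := List.pairwise_append.1 hs
    have h2 := List.pairwise_cons.1 h1.2.1
    refine ⟨e.reverse, c.reverse, by simp, by simp, ?_, ?_⟩
    · rw [phi_reverse h1.1, if_neg]
      exact fun h => absurd (hc _ h.1) (by omega)
    · rw [eps_reverse h2.2, if_neg]
      exact fun h => absurd (h2.1 _ h.1) (by omega)

/-- A strictly increasing row stays so when its `i + 1` is raised, unless it contains `i`. -/
theorem SortedRow.raise {i : ℕ} {c e : List ℕ} (hs : SortedRow 1 (c ++ (i + 1) :: e))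
    (hc : ∀ p ∈ c, p < i) : SortedRow 1 (c ++ i :: e) := by
  simp only [SortedRow, List.pairwise_append, List.pairwise_cons, List.mem_cons,
    forall_eq_or_imp] at hs ⊢
  refine ⟨hs.1, ⟨fun p hp => ?_, hs.2.1.2⟩, fun p hp => ⟨hc p hp, (hs.2.2 p hp).2⟩⟩
  have := hs.2.1.1 p hp
  omega

/-- Bumping out of a strictly increasing row does not change the signature of the word that
consists of the inserted letter and the reversed row. -/
theorem phi_eps_bump {i x z : ℕ} {a b : List ℕ} (hs : SortedRow 1 (a ++ z :: b))
    (ha : ∀ p ∈ a, p + 1 ≤ x) (hz : x < z + 1) :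
    phi i (x :: (a ++ z :: b).reverse) = phi i ((a ++ x :: b).reverse ++ [z]) ∧
      eps i (x :: (a ++ z :: b).reverse) = eps i ((a ++ x :: b).reverse ++ [z]) := by
  have h1 : SortedRow 1 a := (List.pairwise_append.1 hs).1
  have h2 := List.pairwise_cons.1 (List.pairwise_append.1 hs).2.1
  have h3 : SortedRow 1 b := h2.2
  have f1 : phi i a.reverse = 0 ∨ (phi i a.reverse = 1 ∧ i < x) := by
    rw [phi_reverse h1]; split_ifs with h <;> simp; exact ha i h.1
  have f2 : eps i a.reverse = 0 ∨ (eps i a.reverse = 1 ∧ i + 1 < x) := by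
    rw [eps_reverse h1]; split_ifs with h <;> simp; exact ha (i + 1) h.1
  have f3 : phi i b.reverse = 0 ∨ (phi i b.reverse = 1 ∧ z < i) := by
    rw [phi_reverse h3]; split_ifs with h <;> simp; exact h2.1 i h.1
  have f4 : eps i b.reverse = 0 ∨ (eps i b.reverse = 1 ∧ z < i + 1) := by
    rw [eps_reverse h3]; split_ifs with h <;> simp; have := h2.1 _ h.1; omega
  have e1 : x :: (a ++ z :: b).reverse = [x] ++ (b.reverse ++ ([z] ++ a.reverse)) := by simp
  have e2 : (a ++ x :: b).reverse ++ [z] = b.reverse ++ ([x] ++ (a.reverse ++ [z])) := by simp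
  rw [e1, e2]
  have sx := phi_eps_singleton i x
  have sz := phi_eps_singleton i z
  simp only [phi_append, eps_append]
  -- each of the four pieces contributes at most one letter of either kind, so that finitely many
  -- cases remain; the inequalities rule out those in which the two products differ
  generalize phi i a.reverse = pa at *
  generalize eps i a.reverse = ea at *
  generalize phi i b.reverse = pb at *
  generalize eps i b.reverse = eb at *
  generalize phi i [x] = px at *
  generalize eps i [x] = ex at *
  generalize phi i [z] = pz at *
  generalize eps i [z] = ez at *
  rcases sx with ⟨sx, rfl, rfl⟩ | ⟨sx, rfl, rfl⟩ | ⟨sx, sx', rfl, rfl⟩ <;>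
    rcases sz with ⟨sz, rfl, rfl⟩ | ⟨sz, rfl, rfl⟩ | ⟨sz, sz', rfl, rfl⟩ <;>
    rcases f1 with rfl | ⟨rfl, f1⟩ <;> rcases f2 with rfl | ⟨rfl, f2⟩ <;>
    rcases f3 with rfl | ⟨rfl, f3⟩ <;> rcases f4 with rfl | ⟨rfl, f4⟩ <;>
    first | exact ⟨rfl, rfl⟩ | (exfalso; omega)

/-- A raising operator on the word of an inserted letter and a reversed row, seen after the
letter has been inserted into the row and an entry has been bumped. -/
theorem raises_bump {i x z : ℕ} {a b w : List ℕ} (hs : SortedRow 1 (a ++ z :: b))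
    (ha : ∀ p ∈ a, p + 1 ≤ x) (hz : x < z + 1)
    (hw : Raises i (x :: (a ++ z :: b).reverse) w) :
    ∃ x' r' r'' z', w = x' :: r'.reverse ∧ SortedRow 1 r' ∧ rowIns 1 x' r' = (r'', some z') ∧
      Raises i ((a ++ x :: b).reverse ++ [z]) (r''.reverse ++ [z']) := by
  have h1 : SortedRow 1 a := (List.pairwise_append.1 hs).1
  have h2 := List.pairwise_cons.1 (List.pairwise_append.1 hs).2.1
  have h3 : SortedRow 1 b := h2.2
  have hab : ∀ p ∈ a, p < z := fun p hp => (List.pairwise_append.1 hs).2.2 p hp z (by simp)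
  have f1 : phi i a.reverse ≤ 1 ∧ (phi i a.reverse = 1 → i < x) := by
    rw [phi_reverse h1]; split_ifs with h <;> simp; exact ha i h.1
  have f2 : eps i a.reverse ≤ 1 ∧ (eps i a.reverse = 1 → i + 1 < x) := by
    rw [eps_reverse h1]; split_ifs with h <;> simp; exact ha (i + 1) h.1
  have f3 : phi i b.reverse ≤ 1 ∧ (phi i b.reverse = 1 → z < i) := by
    rw [phi_reverse h3]; split_ifs with h <;> simp; exact h2.1 i h.1
  have f4 : eps i b.reverse ≤ 1 ∧ (eps i b.reverse = 1 → z < i + 1) := by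
    rw [eps_reverse h3]; split_ifs with h <;> simp; have := h2.1 _ h.1; omega
  have e1 : ∀ x z : ℕ, ∀ a b : List ℕ,
    x :: (a ++ z :: b).reverse = [x] ++ (b.reverse ++ ([z] ++ a.reverse)) := by simp
  have e2 : ∀ x z : ℕ, ∀ a b : List ℕ,
    (a ++ x :: b).reverse ++ [z] = b.reverse ++ ([x] ++ (a.reverse ++ [z])) := by simp
  have sx := phi_eps_singleton i x
  have sz := phi_eps_singleton i z
  have si := phi_eps_singleton i i
  rw [e1] at hw
  rcases raises_append hw with ⟨hc, w₁, hw₁, rfl⟩ | ⟨hc, w₁, hw₁, rfl⟩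
  · -- the inserted letter is raised
    obtain ⟨rfl, rfl⟩ := raises_singleton.1 hw₁
    simp only [phi_append] at hc
    by_cases hi : i ∈ a
    · -- the raised letter bumps the `i` of the row instead of `z = i + 1`
      have hi' : i + 1 ∉ a := fun h => absurd (ha _ h) (by omega)
      have hpa : phi i a.reverse = 1 := by rw [phi_reverse h1, if_pos ⟨hi, hi'⟩]
      obtain rfl : z = i + 1 := by omega
      obtain ⟨a', t, rfl⟩ := List.append_of_mem hi
      have h5 := List.pairwise_append.1 h1
      obtain rfl : t = [] := by
        rcases t with _ | ⟨y, t⟩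
        · rfl
        · have := (List.pairwise_cons.1 h5.2.1).1 y (by simp)
          have := ha y (by simp)
          omega
      refine ⟨i, a' ++ [i] ++ (i + 1) :: b, a' ++ [i] ++ (i + 1) :: b, i, by simp, hs, ?_, ?_⟩
      · have := rowIns_append_cons (d := 1) (x := i) (z := i) (a := a') (b := (i + 1) :: b)
          (fun p hp => h5.2.2 p hp i (by simp)) (by omega)
        simpa using this
      · refine Raises.append_left (raises_singleton.2 ⟨rfl, rfl⟩) ?_
        rw [eps_reverse hs, if_neg (by simp)]
        exact Nat.zero_le _
    · refine ⟨i, a ++ z :: b, a ++ i :: b, z, by simp, hs, ?_, ?_⟩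
      · refine rowIns_append_cons (fun p hp => ?_) (by omega)
        have := ha p hp
        have : p ≠ i := fun h => hi (h ▸ hp)
        omega
      · rw [e2, e2]
        have hpa : phi i a.reverse = 0 := by rw [phi_reverse h1, if_neg (fun h => hi h.1)]
        have hpb : phi i b.reverse = 0 := by omega
        refine Raises.append_left (Raises.append_right (raises_singleton.2 ⟨rfl, rfl⟩) ?_) ?_
        · simp only [phi_append]
          omega
        · simp only [phi_append, hpa] at hc ⊢
          omega
  rcases raises_append hw₁ with ⟨hd, w₂, hw₂, rfl⟩ | ⟨hd, w₂, hw₂, rfl⟩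
  · -- an entry to the right of `z` is raised
    have he := hw₂.eps_ne_zero
    obtain ⟨u, e, rfl, rfl, hu⟩ := (raises_reverse h3).1 hw₂
    simp only [phi_append] at hc hd
    have hzi : z < i := by omega
    refine ⟨x, a ++ z :: (u ++ i :: e), a ++ x :: (u ++ i :: e), z, by simp, ?_,
      rowIns_append_cons ha hz, ?_⟩
    · have := SortedRow.raise (i := i) (c := a ++ z :: u) (e := e) (by simpa using hs) ?_
      · simpa using this
      · intro p hp
        simp only [List.mem_append, List.mem_cons] at hp
        rcases hp with hp | rfl | hp
        · exact (hab p hp).trans hzi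
        · exact hzi
        · exact hu p hp
    · rw [e2, e2]
      refine Raises.append_right hw₂ ?_
      simp only [phi_append] at hc hd ⊢
      omega
  rcases raises_append hw₂ with ⟨he, w₃, hw₃, rfl⟩ | ⟨he, w₃, hw₃, rfl⟩
  · -- `z` is raised
    obtain ⟨rfl, rfl⟩ := raises_singleton.1 hw₃
    simp only [phi_append] at hc hd he
    have hxi : x ≠ i + 1 := by
      rintro rfl
      omega
    have hpa : phi i a.reverse = 0 := by omega
    have hai : ∀ p ∈ a, p < i := by
      intro p hp
      have := ha p hp
      omega
    have hsr := SortedRow.raise hs hai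
    refine ⟨x, a ++ i :: b, a ++ x :: b, i, by simp, hsr, rowIns_append_cons ha (by omega), ?_⟩
    refine Raises.append_left (raises_singleton.2 ⟨rfl, rfl⟩) ?_
    rw [List.reverse_append, List.reverse_cons]
    simp only [eps_append] at hc hd ⊢
    omega
  · -- an entry to the left of `z` is raised
    have hf := hw₃.eps_ne_zero
    obtain ⟨u, e, rfl, rfl, hu⟩ := (raises_reverse h1).1 hw₃
    have hx : i + 1 < x := ha (i + 1) (by simp)
    have ha' : ∀ p ∈ u ++ i :: e, p + 1 ≤ x := by
      intro p hp
      simp only [List.mem_append, List.mem_cons] at hp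
      rcases hp with hp | rfl | hp
      · exact ha p (by simp [hp])
      · omega
      · exact ha p (by simp [hp])
    refine ⟨x, (u ++ i :: e) ++ z :: b, (u ++ i :: e) ++ x :: b, z, by simp, ?_,
      rowIns_append_cons ha' hz, ?_⟩
    · have := SortedRow.raise (i := i) (c := u) (e := e ++ z :: b) (by simpa using hs) hu
      simpa using this
    · rw [e2, e2 x z (u ++ i :: e)]
      refine Raises.append_left (Raises.append_left (Raises.append_right hw₃ ?_) ?_) ?_ <;>
      · simp only [phi_append] at hc hd he ⊢
        omega

theorem SortedRow.raises {i : ℕ} {s w : List ℕ} (hs : SortedRow 1 s)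
    (h : Raises i s.reverse w) : ∃ s', w = s'.reverse ∧ SortedRow 1 s' := by
  obtain ⟨u, e, rfl, rfl, hu⟩ := (raises_reverse hs).1 h
  exact ⟨_, rfl, hs.raise hu⟩

/-- Dual insertion of a letter does not change the signature of the column word. -/
theorem phi_eps_insT {i x : ℕ} {Q : List (List ℕ)} (hQ : ∀ r ∈ Q, SortedRow 1 r) :
    phi i (x :: columnWord Q) = phi i (columnWord (insT 1 x Q)) ∧
      eps i (x :: columnWord Q) = eps i (columnWord (insT 1 x Q)) := by
  induction Q generalizing x with
  | nil => simp [insT]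
  | cons r Q ih =>
    rcases forall_or_exists_bump 1 x r with h1 | ⟨a, z, b, rfl, ha, hz⟩
    · rw [insT_of_forall h1]
      simp
    · rw [insT_bump ha hz, columnWord_cons, columnWord_cons]
      obtain ⟨h2, h3⟩ := phi_eps_bump (i := i) (hQ _ List.mem_cons_self) ha hz
      obtain ⟨h4, h5⟩ := ih (x := z) (fun s hs => hQ s (by simp [hs]))
      rw [← List.cons_append, phi_append, eps_append, h2, h3, ← phi_append, ← eps_append,
        List.append_assoc, List.singleton_append, phi_append, eps_append, h4, h5, ← phi_append,
        ← eps_append]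
      exact ⟨rfl, rfl⟩

/-- Two lists of rows of the same lengths with the same column word are equal. -/
theorem columnWord_injective {α : Type*} {Q R : List (List α)}
    (h : columnWord Q = columnWord R) (hl : Q.map List.length = R.map List.length) : Q = R := by
  induction Q generalizing R with
  | nil => symm; simpa using hl
  | cons r Q ih =>
    rcases R with _ | ⟨s, R⟩
    · simp at hl
    · simp only [List.map_cons, List.cons.injEq, columnWord_cons] at h hl
      obtain ⟨h1, h2⟩ := List.append_inj h (by simp [hl.1])
      rw [List.reverse_inj.1 h1, ih h2 hl.2]

/-- Dual insertion commutes with the raising operators. -/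
theorem raises_insT {i x x' : ℕ} {Q Q' : List (List ℕ)} (hQ : ∀ r ∈ Q, SortedRow 1 r)
    (hl : Q'.map List.length = Q.map List.length)
    (h : Raises i (x :: columnWord Q) (x' :: columnWord Q')) :
    Raises i (columnWord (insT 1 x Q)) (columnWord (insT 1 x' Q')) ∧
      newRow 1 x' Q' = newRow 1 x Q := by
  induction Q generalizing x x' Q' with
  | nil =>
    obtain rfl : Q' = [] := by simpa using hl
    simpa [insT, newRow] using h
  | cons r Q ih =>
    rcases Q' with _ | ⟨r', Q'⟩
    · simp at hl
    have hr := hQ r (by simp)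
    have hQ' : ∀ s ∈ Q, SortedRow 1 s := fun s hs => hQ s (by simp [hs])
    simp only [List.map_cons, List.cons.injEq] at hl
    rw [columnWord_cons, columnWord_cons, ← List.cons_append, ← List.cons_append] at h
    rcases forall_or_exists_bump 1 x r with h1 | ⟨a, z, b, rfl, ha, hz⟩
    -- `x` is put at the end of the first row; then so is `x'`, as `r' ++ [x']` is increasing too
    · have hrx := hr.append_singleton h1
      have hcons : ∀ (x : ℕ) (r : List ℕ), x :: r.reverse = (r ++ [x]).reverse := by simp
      have h2 : ∀ p ∈ r', p + 1 ≤ x' := by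
        rcases raises_append h with ⟨-, u, hu, hw⟩ | ⟨-, u, hu, hw⟩
        · obtain ⟨h3, -⟩ := List.append_inj hw
            (by simp only [hu.length_eq, hl.1, List.length_cons, List.length_reverse])
          rw [hcons] at hu
          obtain ⟨s, rfl, hs⟩ := hrx.raises hu
          rw [hcons, List.reverse_inj] at h3
          rw [← h3] at hs
          exact fun p hp => (List.pairwise_append.1 hs).2.2 p hp x' (by simp)
        · obtain ⟨h3, -⟩ := List.append_inj hw (by simp [hl.1])
          simp only [List.cons.injEq, List.reverse_inj] at h3
          rw [h3.1, h3.2]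
          exact h1
      rw [insT_of_forall h1, newRow_of_forall h1, insT_of_forall h2, newRow_of_forall h2]
      rw [hcons, hcons] at h
      exact ⟨by simpa using h, rfl⟩
    · rw [insT_bump ha hz, newRow_bump ha hz, columnWord_cons]
      obtain ⟨g1, g2⟩ := phi_eps_bump (i := i) hr ha hz
      rcases raises_append h with ⟨hc, u, hu, hw⟩ | ⟨hc, u, hu, hw⟩
      -- the raised letter is `x` or in the first row
      · obtain ⟨h3, h4⟩ := List.append_inj hw
          (by simp only [hu.length_eq, hl.1, List.length_cons, List.length_reverse])
        obtain rfl := columnWord_injective h4 hl.2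
        obtain ⟨y, r₀, r₁, y', rfl, hr₀, hins, h6⟩ := raises_bump hr ha hz hu
        simp only [List.cons.injEq, List.reverse_inj] at h3
        obtain ⟨rfl, rfl⟩ := h3
        have h7 : insT 1 x' (r' :: Q') = r₁ :: insT 1 y' Q' := by simp [insT, hins]
        have h8 : newRow 1 x' (r' :: Q') = newRow 1 y' Q' + 1 := by simp [newRow, hins]
        rw [h7, h8, columnWord_cons]
        have hlen : (r₁.reverse).length = ((a ++ x :: b).reverse).length := by
          have := h6.length_eq
          simp only [List.length_append, List.length_singleton] at this
          omega
        rw [g2] at hc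
        rcases raises_append h6 with ⟨hd, v, hv, hv'⟩ | ⟨hd, v, hv, hv'⟩
        · obtain ⟨rfl, h9⟩ := List.append_inj hv' (by rw [hlen, hv.length_eq])
          obtain rfl : y' = z := by simpa using h9
          refine ⟨hv.append_right ?_, rfl⟩
          rw [← (phi_eps_insT hQ').1, ← List.singleton_append, phi_append]
          rw [eps_append] at hc
          omega
        · obtain ⟨h9, rfl⟩ := List.append_inj hv' hlen
          obtain rfl : r₁ = a ++ x :: b := List.reverse_inj.1 h9
          have h10 : Raises i (z :: columnWord Q') (y' :: columnWord Q') := by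
            refine hv.append_right (v := columnWord Q') ?_
            rw [eps_append] at hc
            omega
          obtain ⟨h11, h12⟩ := ih hQ' rfl h10
          refine ⟨h11.append_left ?_, by rw [h12]⟩
          rw [← (phi_eps_insT hQ').1, ← List.singleton_append (l := columnWord Q'), phi_append]
          omega
      -- the raised letter is below the first row
      · obtain ⟨h3, rfl⟩ := List.append_inj hw
          (by simp only [hl.1, List.length_cons, List.length_reverse])
        simp only [List.cons.injEq, List.reverse_inj] at h3
        obtain ⟨rfl, rfl⟩ := h3
        rw [insT_bump ha hz, newRow_bump ha hz, columnWord_cons]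
        rw [g2, eps_append] at hc
        have h10 : Raises i (z :: columnWord Q) (z :: columnWord Q') := by
          refine hu.append_left (u := [z]) ?_
          omega
        obtain ⟨h11, h12⟩ := ih hQ' hl.2 h10
        refine ⟨h11.append_left ?_, by rw [h12]⟩
        rw [← (phi_eps_insT hQ').1, ← List.singleton_append (l := columnWord Q), phi_append]
        omega

theorem eq_of_map_fst_snd {α β : Type*} {L L' : List (α × β)}
    (h1 : L'.map Prod.fst = L.map Prod.fst) (h2 : L'.map Prod.snd = L.map Prod.snd) :
    L' = L := by
  rw [← List.zip_unzip L', ← List.zip_unzip L, List.unzip_fst, List.unzip_fst, List.unzip_snd,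
    List.unzip_snd, h1, h2]

/-- The word of the inserted letters and the dual insertion tableau have the same numbers of
unmatched letters. -/
theorem phi_eps_run (i : ℕ) (L : List (ℕ × ℕ)) :
    phi i (L.map Prod.snd) = phi i (columnWord (run 1 L).1) ∧
      eps i (L.map Prod.snd) = eps i (columnWord (run 1 L).1) := by
  induction L with
  | nil => simp [run, columnWord]
  | cons b L ih =>
    obtain ⟨h1, h2⟩ := phi_eps_insT (i := i) (x := b.2) (isTab_run le_rfl L).sorted
    rw [run_cons, insRec]
    simp only
    rw [← h1, ← h2, List.map_cons, ← List.singleton_append, phi_append, eps_append, ih.1, ih.2,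
      ← phi_append, ← eps_append]
    exact ⟨rfl, rfl⟩

/-- The raising operator on the word of letters that are inserted by dual insertion acts as the
raising operator on the tableau, and the recording tableau stays the same. -/
theorem raises_run {i : ℕ} {L L' : List (ℕ × ℕ)} (hfst : L'.map Prod.fst = L.map Prod.fst)
    (h : Raises i (L.map Prod.snd) (L'.map Prod.snd)) :
    (run 1 L').2 = (run 1 L).2 ∧
      Raises i (columnWord (run 1 L).1) (columnWord (run 1 L').1) := by
  induction L generalizing L' with
  | nil => exact absurd rfl h.eps_ne_zero
  | cons b L ih =>
    rcases L' with _ | ⟨b', L'⟩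
    · simp at hfst
    simp only [List.map_cons, List.cons.injEq] at hfst h
    have hs := (isTab_run le_rfl L).sorted
    have h0 := (phi_eps_run i L).1
    rw [run_cons, run_cons, insRec, insRec]
    suffices h3 : (run 1 L').2 = (run 1 L).2 ∧
        Raises i (b.2 :: columnWord (run 1 L).1) (b'.2 :: columnWord (run 1 L').1) by
      have hl : (run 1 L').1.map List.length = (run 1 L).1.map List.length := by
        rw [map_length_run, map_length_run, h3.1]
      obtain ⟨h4, h5⟩ := raises_insT hs hl h3.2
      exact ⟨by rw [h5, h3.1, hfst.1], h4⟩
    rw [← List.singleton_append] at h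
    rcases raises_append h with ⟨h1, u, hu, hw⟩ | ⟨h1, u, hu, hw⟩
    · obtain ⟨h2, rfl⟩ := raises_singleton.1 hu
      simp only [List.singleton_append, List.cons.injEq] at hw
      obtain rfl := eq_of_map_fst_snd hfst.2 hw.2
      refine ⟨rfl, ?_⟩
      rw [hw.1]
      exact hu.append_right (v := columnWord (run 1 L').1) (by rwa [← h0])
    · simp only [List.singleton_append, List.cons.injEq] at hw
      rw [← hw.2] at hu
      obtain ⟨h3, h4⟩ := ih hfst.2 hu
      refine ⟨h3, ?_⟩
      rw [hw.1]
      exact h4.append_left (u := [b.2]) (by omega)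

/-! ### Transposition -/

/-- Put a new first column `q` in front of the rows `T`. -/
def consCol {α : Type*} : List α → List (List α) → List (List α)
  | [], _ => []
  | a :: q, T => (a :: T.headD []) :: consCol q T.tail

/-- Transposition by recursion on the rows, for entries in an arbitrary type. -/
def transposed {α : Type*} (Q : List (List α)) : List (List α) := Q.foldr consCol []

theorem transposed_cons {α : Type*} (q : List α) (Q : List (List α)) :
    transposed (q :: Q) = consCol q (transposed Q) := rfl

theorem length_consCol {α : Type*} (q : List α) (T : List (List α)) :
    (consCol q T).length = q.length := by
  induction q generalizing T with
  | nil => rfl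
  | cons a q ih => simp [consCol, ih]

theorem getElem?_consCol {α : Type*} (q : List α) (T : List (List α)) (j : ℕ) :
    (consCol q T)[j]? = q[j]?.map fun a => a :: T.getD j [] := by
  induction q generalizing T j with
  | nil => simp [consCol]
  | cons a q ih =>
    rcases j with _ | j
    · rcases T with _ | ⟨t, T⟩ <;> simp [consCol]
    · rcases T with _ | ⟨t, T⟩ <;> simp [consCol, ih]

theorem length_transposed {α : Type*} (Q : List (List α)) :
    (transposed Q).length = (Q.headD []).length := by
  rcases Q with _ | ⟨q, Q⟩
  · rfl
  · exact length_consCol _ _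

theorem transposeRows_eq_of_pairwise {Q : List (List ℕ)}
    (h : Q.Pairwise fun r s => s.length ≤ r.length) : transposeRows Q = transposed Q := by
  have main : ∀ j, (transposed Q).getD j [] = Q.filterMap fun r => r[j]? := by
    induction Q with
    | nil => simp [transposed]
    | cons q Q ih =>
      rw [List.pairwise_cons] at h
      intro j
      rw [transposed_cons, List.getD_eq_getElem?_getD, getElem?_consCol, ih h.2,
        List.filterMap_cons]
      rcases hj : q[j]? with _ | a
      · simp only [Option.map_none, Option.getD_none]
        symm
        rw [List.filterMap_eq_nil_iff]
        intro r hr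
        have := h.1 r hr
        simp at hj ⊢
        omega
      · rfl
  apply List.ext_getElem?
  intro j
  have hl := length_transposed Q
  have hl' : (transposeRows Q).length = (Q.headD []).length := by simp [transposeRows]
  rcases lt_or_ge j (Q.headD []).length with hj | hj
  · have h1 := main j
    rw [List.getD_eq_getElem _ _ (by omega)] at h1
    rw [List.getElem?_eq_getElem (l := transposed Q) (by omega), h1]
    simp only [transposeRows, List.getElem?_map, List.getElem?_range hj, Option.map_some]
  · rw [List.getElem?_eq_none (by omega), List.getElem?_eq_none (by omega)]

theorem consCol_map {α β : Type*} (f : α → β) (q : List α) (T : List (List α)) :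
    (consCol q T).map (List.map f) = consCol (q.map f) (T.map (List.map f)) := by
  induction q generalizing T with
  | nil => rfl
  | cons a q ih => rcases T with _ | ⟨t, T⟩ <;> simp [consCol, ih]

theorem transposed_map {α β : Type*} (f : α → β) (Q : List (List α)) :
    (transposed Q).map (List.map f) = transposed (Q.map (List.map f)) := by
  induction Q with
  | nil => rfl
  | cons q Q ih => rw [transposed_cons, consCol_map, ih, List.map_cons, transposed_cons]

theorem transposed_consCol {α : Type*} {q : List α} {T : List (List α)} (hq : q ≠ [])
    (h : T.length ≤ q.length) : transposed (consCol q T) = q :: transposed T := by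
  induction q generalizing T with
  | nil => exact absurd rfl hq
  | cons a q ih =>
    rcases q with _ | ⟨b, q⟩
    · rcases T with _ | ⟨t, _ | ⟨s, T⟩⟩
      · simp [consCol, transposed]
      · simp [consCol, transposed]
      · simp at h
    · rw [consCol, transposed_cons, ih (by simp) (by simp at h ⊢; omega), consCol]
      rcases T with _ | ⟨t, T⟩ <;> simp [transposed, consCol]

theorem flatten_consCol_perm {α : Type*} {q : List α} {T : List (List α)}
    (h : T.length ≤ q.length) : (consCol q T).flatten.Perm (q ++ T.flatten) := by
  induction q generalizing T with
  | nil =>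
    obtain rfl : T = [] := by simpa using h
    simp [consCol]
  | cons a q ih =>
    rcases T with _ | ⟨t, T⟩
    · simpa [consCol] using ih (T := []) (by simp)
    · simp only [consCol, List.headD_cons, List.tail_cons, List.flatten_cons, List.cons_append]
      refine .cons a (((ih (T := T) (by simpa using h)).append_left t).trans ?_)
      rw [← List.append_assoc, ← List.append_assoc]
      exact List.perm_append_comm.append_right _

theorem IsTab.pairwise_length {d : ℕ} {Q : List (List ℕ)} (h : IsTab d Q) :
    Q.Pairwise fun r s => s.length ≤ r.length := by
  have : IsTrans (List ℕ) fun r s => s.length ≤ r.length := ⟨fun _ _ _ h1 h2 => h2.trans h1⟩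
  rw [← List.isChain_iff_pairwise]
  refine h.chain.imp fun r s hrs => ?_
  by_contra hlt
  obtain ⟨a, ha, -⟩ := hrs r.length _ (List.getElem?_eq_getElem (by omega))
  simp at ha

theorem IsTab.length_le {d : ℕ} {q : List ℕ} {Q : List (List ℕ)} (h : IsTab d (q :: Q)) :
    (transposed Q).length ≤ q.length := by
  rw [length_transposed]
  rcases Q with _ | ⟨r, Q⟩
  · simp
  · exact (List.pairwise_cons.1 h.pairwise_length).1 r (by simp)

theorem flatten_transposed_perm {Q : List (List ℕ)} {d : ℕ} (h : IsTab d Q) {α : Type*}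
    {f : α → ℕ} {R : List (List α)} (hR : R.map (List.map f) = Q) :
    (transposed R).flatten.Perm R.flatten := by
  subst hR
  induction R with
  | nil => exact .nil
  | cons r R ih =>
    rw [transposed_cons, List.flatten_cons]
    refine (flatten_consCol_perm ?_).trans (List.Perm.append_left _ (ih (isTab_cons.1 h).2.2.2))
    have := IsTab.length_le h
    rwa [← transposed_map, List.length_map, List.length_map] at this

/-- The column `q` may stand to the left of the rows `T`: it is at least as long, and each of its
entries is at most (for `e = 0`) or less than (for `e = 1`) the entries of the row next to it. -/
def LeftOf (e : ℕ) (q : List ℕ) (T : List (List ℕ)) : Prop :=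
  ∀ (j : ℕ) (t : List ℕ), T[j]? = some t → ∃ a, q[j]? = some a ∧ ∀ p ∈ t, a + e ≤ p

theorem LeftOf.length_le {e : ℕ} {q : List ℕ} {T : List (List ℕ)} (h : LeftOf e q T) :
    T.length ≤ q.length := by
  by_contra hlt
  obtain ⟨a, ha, -⟩ := h q.length _ (List.getElem?_eq_getElem (by omega))
  simp at ha

theorem isTab_consCol {d e : ℕ} (hde : d + e = 1) {q : List ℕ} {T : List (List ℕ)}
    (hq : SortedRow d q) (hT : IsTab e T) (h : LeftOf e q T) : IsTab e (consCol q T) := by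
  induction q generalizing T with
  | nil => exact isTab_nil e
  | cons a q ih =>
    have hq' := List.pairwise_cons.1 hq
    have htail : IsTab e T.tail ∧ SortedRow e (T.headD []) ∧
        Over e (T.headD []) (T.tail.headD []) ∧ ∀ p ∈ T.headD [], a + e ≤ p := by
      rcases T with _ | ⟨t, T⟩
      · refine ⟨hT, List.Pairwise.nil, fun j b hj => ?_, by simp⟩
        simp at hj
      · obtain ⟨-, h1, h2, h3⟩ := isTab_cons.1 hT
        obtain ⟨a', ha', h4⟩ := h 0 t rfl
        simp only [List.getElem?_cons_zero, Option.some.injEq] at ha'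
        exact ⟨h3, h1, h2, ha' ▸ h4⟩
    obtain ⟨h1, h2, h3, h4⟩ := htail
    rw [consCol, isTab_cons]
    refine ⟨by simp, List.pairwise_cons.2 ⟨h4, h2⟩, ?_, ih hq'.2 h1 ?_⟩
    · intro j b hj
      rcases q with _ | ⟨a', q⟩
      · simp [consCol] at hj
      · have := hq'.1 a' (by simp)
        simp only [consCol, List.headD_cons] at hj
        rcases j with _ | j
        · simp only [List.getElem?_cons_zero, Option.some.injEq] at hj
          exact ⟨a, rfl, by omega⟩
        · exact h3 j b (by simpa using hj)
    · intro j t hj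
      obtain ⟨a', ha', h5⟩ := h (j + 1) t (by rw [← hj, List.getElem?_tail])
      exact ⟨a', by simpa using ha', h5⟩

theorem leftOf_transposed {d e : ℕ} (hde : d + e = 1) {q : List ℕ} {Q : List (List ℕ)}
    (h : Over d q (Q.headD [])) (hQ : IsTab e (transposed Q)) : LeftOf e q (transposed Q) := by
  intro j t hj
  rcases Q with _ | ⟨r, Q⟩
  · simp [transposed] at hj
  · have hs := hQ.sorted t (List.mem_of_getElem? hj)
    rw [transposed_cons, getElem?_consCol] at hj
    obtain ⟨b, hb, rfl⟩ := Option.map_eq_some_iff.1 hj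
    obtain ⟨a, ha, hab⟩ := h j b hb
    refine ⟨a, ha, fun p hp => ?_⟩
    rcases List.mem_cons.1 hp with rfl | hp
    · omega
    · have := (List.pairwise_cons.1 hs).1 p hp
      omega

theorem IsTab.isTab_transposed {d e : ℕ} (hde : d + e = 1) {Q : List (List ℕ)} (h : IsTab d Q) :
    IsTab e (transposed Q) := by
  induction Q with
  | nil => exact isTab_nil e
  | cons q Q ih =>
    obtain ⟨h1, h2, h3, h4⟩ := isTab_cons.1 h
    exact isTab_consCol hde h2 (ih h4) (leftOf_transposed hde h3 (ih h4))

theorem transposed_transposed {d : ℕ} {Q : List (List ℕ)} (h : IsTab d Q) :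
    transposed (transposed Q) = Q := by
  induction Q with
  | nil => rfl
  | cons q Q ih =>
    have h1 := isTab_cons.1 h
    rw [transposed_cons, transposed_consCol h1.1 h.length_le, ih h1.2.2.2]

theorem IsTab.transposeRows_eq {d : ℕ} {Q : List (List ℕ)} (h : IsTab d Q) :
    transposeRows Q = transposed Q := transposeRows_eq_of_pairwise h.pairwise_length

theorem IsTab.isTab_transposeRows {d e : ℕ} (hde : d + e = 1) {Q : List (List ℕ)}
    (h : IsTab d Q) : IsTab e (transposeRows Q) := by
  rw [h.transposeRows_eq]
  exact h.isTab_transposed hde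

theorem transposeRows_transposeRows {d : ℕ} (hd : d ≤ 1) {Q : List (List ℕ)}
    (h : IsTab d Q) : transposeRows (transposeRows Q) = Q := by
  rw [(h.isTab_transposeRows (e := 1 - d) (by omega)).transposeRows_eq, h.transposeRows_eq,
    transposed_transposed h]

/-! ### Row reading and column reading -/

theorem signature_eq_nil {α : Type*} {i : ℕ} {w : List (ℕ × α)}
    (h : ∀ c ∈ w, c.1 ≠ i ∧ c.1 ≠ i + 1) : signature i w = ([], []) := by
  induction w with
  | nil => rfl
  | cons c w ih =>
    have := h c (by simp)
    rw [signature, if_neg this.2, if_neg this.1, ih fun c hc => h c (by simp [hc])]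

theorem signatureMul_nil_left {α : Type*} (s : List α × List α) :
    signatureMul ([], []) s = s := by simp [signatureMul]

theorem signature_skip {α : Type*} {i : ℕ} {w : List (ℕ × α)}
    (h : ∀ c ∈ w, c.1 ≠ i ∧ c.1 ≠ i + 1) (u v : List (ℕ × α)) :
    signature i (u ++ (w ++ v)) = signature i (u ++ v) := by
  rw [signature_append, signature_append i w, signature_eq_nil h, signatureMul_nil_left,
    ← signature_append]

theorem count_le_count_of_over {i : ℕ} {t s : List ℕ} (h : Over 0 t s) (ht : ∀ p ∈ t, i ≤ p) :
    s.count (i + 1) ≤ t.count i := by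
  induction s generalizing t with
  | nil => simp
  | cons y s ih =>
    obtain ⟨x, hx, hxy⟩ := h 0 y rfl
    rcases t with _ | ⟨x', t⟩
    · simp at hx
    · obtain rfl : x' = x := by simpa using hx
      have h1 := ih (t := t) (fun j b hj => by simpa using h (j + 1) b (by simpa using hj))
        (fun p hp => ht p (by simp [hp]))
      have h2 := ht x' (by simp)
      simp only [List.count_cons, beq_iff_eq]
      split_ifs <;> omega

theorem count_le_phi {i : ℕ} {t : List ℕ} (h : SortedRow 0 t) : t.count i ≤ phi i t := by
  induction t with
  | nil => simp
  | cons x t ih =>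
    have h' := List.pairwise_cons.1 h
    have h1 := ih h'.2
    simp only [phi, List.count_cons, beq_iff_eq]
    have h2 : x = i + 1 → t.count i = 0 := by
      rintro rfl
      rw [List.count_eq_zero]
      exact fun hi => absurd (h'.1 i hi) (by omega)
    split_ifs <;> omega

theorem readingWord_map {α : Type*} (f : α → ℕ) (T : List (List α)) :
    readingWord (T.map (List.map f)) = T.reverse.flatten.map f := by
  rw [readingWord, ← List.map_reverse, List.map_flatten]

theorem readingWord_perm (T : List (List ℕ)) : (readingWord T).Perm T.flatten :=
  (List.reverse_perm T).flatten

theorem phi_le_count (i : ℕ) (w : List ℕ) : phi i w ≤ w.count i := by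
  induction w with
  | nil => simp [phi]
  | cons x w ih =>
    simp only [phi, List.count_cons, beq_iff_eq]
    split_ifs <;> omega

/-- Going down from a row whose entries are at least `a`, all entries are larger than `a`. -/
theorem lt_of_mem_rows_below {a : ℕ} {t : List ℕ} {T : List (List ℕ)} (h : IsTab 0 (t :: T))
    (ht : ∀ p ∈ t, a ≤ p) : ∀ s ∈ T, ∀ p ∈ s, a < p := by
  induction T generalizing a t with
  | nil => simp
  | cons s T ih =>
    obtain ⟨-, -, h1, h2⟩ := isTab_cons.1 h
    have h3 : ∀ p ∈ s, a < p := by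
      intro p hp
      obtain ⟨j, hj, rfl⟩ := List.getElem_of_mem hp
      obtain ⟨b, hb, hbp⟩ := h1 j _ (List.getElem?_eq_getElem hj)
      have := ht b (List.mem_of_getElem? hb)
      omega
    intro r hr p hp
    rcases List.mem_cons.1 hr with rfl | hr
    · exact h3 p hp
    · have := ih h2 (a := a + 1) h3 r hr p hp
      omega

/-- In the signature, a letter `i` can be moved past unmatched letters `i + 1`, if these find their
partners further right and the letter `i` finds its partner on the left. -/
theorem signatureMul_swap {α : Type*} {a c : α} {u v w : List α} (h : u.length ≤ v.length) :
    signatureMul ([], [c]) (signatureMul ([], u) (signatureMul ([a], []) (v, w))) =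
      signatureMul ([], [c]) (signatureMul ([a], []) (signatureMul ([], u) (v, w))) := by
  obtain ⟨n, hn⟩ := Nat.exists_eq_add_of_le h
  have h1 : signatureMul ([a], []) (v, w) = (v ++ [a], w) := by
    simp [signatureMul]
  have h2 : signatureMul ([], u) (v ++ [a], w) = ((v ++ [a]).take (n + 1), w) := by
    simp only [signatureMul, List.append_nil, List.length_append, List.length_singleton]
    rw [List.drop_eq_nil_of_le (by omega), List.append_nil]
    congr 2
    omega
  have h3 : signatureMul ([], u) (v, w) = (v.take n, w) := by
    simp only [signatureMul, List.append_nil]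
    rw [List.drop_eq_nil_of_le (by omega), List.append_nil]
    congr 2
    omega
  have h4 : signatureMul ([a], []) (v.take n, w) = (v.take n ++ [a], w) := by
    simp [signatureMul, List.take_take]
  have h5 : ((v ++ [a]).take (n + 1)).length = n + 1 := by simp; omega
  have h6 : (v.take n ++ [a]).length = n + 1 := by simp; omega
  rw [h1, h2, h3, h4]
  simp only [signatureMul, h5, h6, List.length_singleton, Nat.add_sub_cancel, List.append_nil]
  rw [List.take_take, List.take_append_of_le_length (by omega),
    List.take_append_of_le_length (by simp; omega), List.take_take]
  simp

/-- The rows below the top row `t` of a tableau can be read before or after a letter `a` that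
stands to the left of `t` and above the column `q`. -/
theorem signature_swap {α : Type*} {i : ℕ} {a : ℕ × α} {q t : List (ℕ × α)}
    {T : List (List (ℕ × α))} (hq : SortedRow 1 ((a :: q).map Prod.fst))
    (hT : IsTab 0 ((t :: T).map (List.map Prod.fst)))
    (h : LeftOf 0 ((a :: q).map Prod.fst) ((t :: T).map (List.map Prod.fst))) :
    signature i (q.reverse ++ (T.reverse.flatten ++ ([a] ++ t))) =
      signature i (q.reverse ++ ([a] ++ (T.reverse.flatten ++ t))) := by
  have hT' := isTab_cons.1 hT
  obtain ⟨a', ha', hat⟩ := h 0 _ rfl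
  simp only [List.map_cons, List.getElem?_cons_zero, Option.some.injEq] at ha'
  subst ha'
  have hqa := List.pairwise_cons.1 hq
  -- all entries below the top row are larger than `a`
  have hTa := lt_of_mem_rows_below (by simpa using hT) hat
  -- a letter `a` other than `i` and `i + 1` has no influence
  by_cases h1 : a.1 ≠ i ∧ a.1 ≠ i + 1
  · have h2 : ∀ c ∈ [a], c.1 ≠ i ∧ c.1 ≠ i + 1 := by simpa using h1
    rw [signature_skip h2, ← List.append_assoc, signature_skip h2, List.append_assoc]
  by_cases h2 : i + 1 ∈ (T.map (List.map Prod.fst)).flatten ∧ a.1 = i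
  · obtain ⟨h2, ha⟩ := h2
    rcases T with _ | ⟨s, T⟩
    · simp at h2
    obtain ⟨-, hts, hs, hT''⟩ := hT'
    simp only [List.map_cons, List.headD_cons] at hs hT''
    have hsa : ∀ p ∈ s.map Prod.fst, i + 1 ≤ p := fun p hp => ha ▸ hTa _ (by simp) p hp
    have hbelow := lt_of_mem_rows_below hT'' hsa
    have his : i + 1 ∈ s.map Prod.fst := by
      rw [List.map_cons, List.flatten_cons, List.mem_append] at h2
      rcases h2 with h2 | h2
      · exact h2
      · obtain ⟨r, hr, hir⟩ := List.mem_flatten.1 h2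
        exact absurd (hbelow r hr _ hir) (by omega)
    -- the column `q` starts with `i + 1`, which is matched with `a`
    obtain ⟨b, hb, hbs⟩ := h 1 _ rfl
    rcases q with _ | ⟨c, q⟩
    · simp at hb
    obtain rfl : c.1 = b := by simpa using hb
    have hc : c.1 = i + 1 := by
      have g1 := hbs _ his
      have g2 := hqa.1 c.1 (by simp)
      omega
    rw [List.reverse_cons, List.append_assoc, List.append_assoc, signature_append,
      signature_append i q.reverse]
    congr 1
    -- the letters `i + 1` below the top row `t` are matched with letters `i` of `t`
    have hR : (signature i (s :: T).reverse.flatten).1 = [] ∧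
        (signature i (s :: T).reverse.flatten).2.length ≤ (signature i t).1.length := by
      rw [← List.length_eq_zero_iff, (length_signature i _).1, (length_signature i _).1,
        (length_signature i _).2]
      have g0 := readingWord_map Prod.fst (s :: T)
      have g1 : ∀ x, (readingWord ((s :: T).map (List.map Prod.fst))).count x =
          ((s :: T).map (List.map Prod.fst)).flatten.count x :=
        fun x => (readingWord_perm _).count_eq x
      rw [← g0]
      have g2 : ((s :: T).map (List.map Prod.fst)).flatten.count i = 0 := by
        rw [List.count_eq_zero]
        intro hi
        obtain ⟨r, hr, hir⟩ := List.mem_flatten.1 hi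
        exact absurd (hTa r hr _ hir) (by omega)
      have g3 : (T.map (List.map Prod.fst)).flatten.count (i + 1) = 0 := by
        rw [List.count_eq_zero]
        intro hi
        obtain ⟨r, hr, hir⟩ := List.mem_flatten.1 hi
        exact absurd (hbelow r hr _ hir) (by omega)
      have g4 := phi_le_count i (readingWord ((s :: T).map (List.map Prod.fst)))
      have g5 := phi_sub_eps i (readingWord ((s :: T).map (List.map Prod.fst)))
      have g6 := count_le_count_of_over (i := i) hs (fun p hp => ha ▸ hat p hp)
      have g7 := count_le_phi (i := i) hts
      rw [g1] at g4 g5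
      rw [g1, List.map_cons, List.flatten_cons, List.count_append (a := i + 1), g3,
        ← List.flatten_cons, ← List.map_cons] at g5
      omega
    have hsa : signature i [a] = ([a.2], []) := by simp [signature, ha]
    have hsc : signature i [c] = ([], [c.2]) := by simp [signature, hc]
    obtain ⟨hR1, hR2⟩ := hR
    simp only [signature_append, hsa, hsc]
    generalize signature i (s :: T).reverse.flatten = u at *
    generalize signature i t = v at *
    obtain ⟨u1, u2⟩ := u
    obtain ⟨v1, v2⟩ := v
    simp only at hR1 hR2
    subst hR1
    exact signatureMul_swap hR2
  -- in the remaining case the rows below have no influence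
  · have h3 : ∀ c ∈ T.reverse.flatten, c.1 ≠ i ∧ c.1 ≠ i + 1 := by
      intro c hc
      obtain ⟨s, hs, hcs⟩ := List.mem_flatten.1 hc
      have hs' : s.map Prod.fst ∈ T.map (List.map Prod.fst) :=
        List.mem_map_of_mem (List.mem_reverse.1 hs)
      have h4 := hTa _ hs' c.1 (List.mem_map_of_mem hcs)
      have h5 : a.1 = i → c.1 ≠ i + 1 := fun ha hi => h2
        ⟨List.mem_flatten.2 ⟨_, hs', hi ▸ List.mem_map_of_mem hcs⟩, ha⟩
      omega
    rw [signature_skip h3, ← List.append_assoc, ← List.append_assoc, signature_skip h3,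
      List.append_assoc]

/-- The first column can be read before the rest of the rows. -/
theorem signature_consCol {α : Type*} {i : ℕ} {q : List (ℕ × α)}
    {T : List (List (ℕ × α))} (hq : SortedRow 1 (q.map Prod.fst))
    (hT : IsTab 0 (T.map (List.map Prod.fst)))
    (h : LeftOf 0 (q.map Prod.fst) (T.map (List.map Prod.fst))) :
    signature i (consCol q T).reverse.flatten =
      signature i (q.reverse ++ T.reverse.flatten) := by
  induction q generalizing T with
  | nil =>
    obtain rfl : T = [] := by simpa using h.length_le
    rfl
  | cons a q ih =>
    rcases T with _ | ⟨t, T⟩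
    · have h1 := ih (T := []) (List.pairwise_cons.1 hq).2 hT (fun j t hj => by simp at hj)
      simp only [consCol, List.headD_nil, List.tail_nil, List.reverse_cons, List.flatten_append,
        List.reverse_nil, List.flatten_nil, List.append_nil, List.flatten_singleton] at h1 ⊢
      rw [signature_append, h1, ← signature_append]
    · have h1 := ih (T := T) (List.pairwise_cons.1 hq).2 (isTab_cons.1 hT).2.2.2
        (fun j s hj => by simpa using h (j + 1) s (by simpa using hj))
      simp only [consCol, List.headD_cons, List.tail_cons, List.reverse_cons,
        List.flatten_append, List.flatten_singleton]
      rw [signature_append, h1, ← signature_append, List.append_assoc, List.append_assoc]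
      exact signature_swap hq hT h

/-- The row reading and the column reading of a semistandard tableau have the same signature,
even when the letters carry the boxes as labels. -/
theorem signature_transposed {α : Type*} {i : ℕ} {Q : List (List (ℕ × α))}
    (hQ : IsTab 1 (Q.map (List.map Prod.fst))) :
    signature i (transposed Q).reverse.flatten = signature i (columnWord Q) := by
  induction Q with
  | nil => rfl
  | cons q Q ih =>
    obtain ⟨h1, h2, h3, h4⟩ := isTab_cons.1 hQ
    have h5 := h4.isTab_transposed (e := 0) rfl
    have h6 := leftOf_transposed (e := 0) rfl h3 h5
    rw [transposed_cons, columnWord_cons, signature_consCol h2, signature_append, ih h4,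
      ← signature_append]
    · rwa [transposed_map]
    · rwa [transposed_map]

/-- The boxes of a tableau can be given distinct labels. -/
theorem exists_labels (Q : List (List ℕ)) (n : ℕ) :
    ∃ R : List (List (ℕ × ℕ)), R.map (List.map Prod.fst) = Q ∧
      R.flatten.map Prod.snd = List.range' n Q.flatten.length := by
  induction Q generalizing n with
  | nil => exact ⟨[], rfl, rfl⟩
  | cons q Q ih =>
    obtain ⟨R, h1, h2⟩ := ih (n + q.length)
    refine ⟨q.zipIdx n :: R, by simp [h1], ?_⟩
    rw [List.flatten_cons, List.map_append, h2, List.flatten_cons, List.length_append,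
      ← List.range'_append_1]
    simp

/-- Replace the letter with the label `p` by `i`. -/
def relabel (i p : ℕ) (c : ℕ × ℕ) : ℕ := if c.2 = p then i else c.1

theorem raises_relabel {i p : ℕ} {w : List (ℕ × ℕ)} (hw : (w.map Prod.snd).Nodup)
    (h : (signature i w).2.getLast? = some p) :
    Raises i (w.map Prod.fst) (w.map (relabel i p)) := by
  obtain ⟨a, b, rfl, hb, ha⟩ := exists_of_signature_snd h
  have key : ∀ u : List (ℕ × ℕ), (∀ c ∈ u, c.2 ≠ p) → u.map (relabel i p) = u.map Prod.fst :=
    fun u hu => List.map_congr_left fun c hc => by simp [relabel, hu c hc]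
  simp only [List.map_append, List.map_cons, List.nodup_append, List.nodup_cons] at hw
  refine ⟨a.map Prod.fst, b.map Prod.fst, by simp, ?_, hb, ha⟩
  rw [List.map_append, List.map_cons, key a, key b]
  · simp [relabel]
  · rintro c hc rfl
    exact hw.2.1.1 (List.mem_map_of_mem hc)
  · rintro c hc rfl
    exact hw.2.2 c.2 (List.mem_map_of_mem hc) c.2 (by simp) rfl

theorem columnWord_map {α β : Type*} (f : α → β) (Q : List (List α)) :
    columnWord (Q.map (List.map f)) = (columnWord Q).map f := by
  induction Q with
  | nil => rfl
  | cons r Q ih => simp [ih]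

theorem columnWord_perm {α : Type*} (Q : List (List α)) : (columnWord Q).Perm Q.flatten := by
  induction Q with
  | nil => exact .nil
  | cons r Q ih =>
    rw [columnWord_cons, List.flatten_cons]
    exact (List.reverse_perm r).append ih

theorem phi_eps_readingWord {i : ℕ} {Q : List (List ℕ)} (hQ : IsTab 1 Q) :
    phi i (readingWord (transposeRows Q)) = phi i (columnWord Q) ∧
      eps i (readingWord (transposeRows Q)) = eps i (columnWord Q) := by
  obtain ⟨R, rfl, -⟩ := exists_labels Q 0
  rw [hQ.transposeRows_eq, ← transposed_map, readingWord_map, columnWord_map,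
    ← (length_signature i _).1, ← (length_signature i _).2, ← (length_signature i _).1,
    ← (length_signature i _).2, signature_transposed hQ]
  exact ⟨rfl, rfl⟩

/-- The raising operator acts on the same box in the row reading and in the column reading. -/
theorem raises_readingWord {i : ℕ} {Q Q' : List (List ℕ)} (hQ : IsTab 1 Q)
    (hl : Q'.map List.length = Q.map List.length)
    (h : Raises i (columnWord Q) (columnWord Q')) :
    Raises i (readingWord (transposed Q)) (readingWord (transposed Q')) := by
  obtain ⟨R, rfl, hR⟩ := exists_labels Q 0
  have hnd : (R.flatten.map Prod.snd).Nodup := by rw [hR]; exact List.nodup_range'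
  have h0 := h.eps_ne_zero
  rw [columnWord_map, ← (length_signature i _).2] at h0
  obtain ⟨p, hp⟩ : ∃ p, (signature i (columnWord R)).2.getLast? = some p :=
    ⟨_, List.getLast?_eq_some_getLast (fun h => h0 (by simp [h]))⟩
  have h1 := raises_relabel (((columnWord_perm R).map _).nodup_iff.2 hnd) hp
  rw [columnWord_map] at h
  obtain rfl : Q' = R.map (List.map (relabel i p)) := by
    refine columnWord_injective ?_ (by rw [hl]; simp [Function.comp_def])
    rw [columnWord_map]
    exact h.right_unique h1
  rw [← transposed_map, ← transposed_map, readingWord_map, readingWord_map]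
  refine raises_relabel ?_ (by rwa [signature_transposed hQ])
  refine List.Perm.nodup_iff ?_ |>.2 hnd
  exact (((List.reverse_perm _).flatten).trans (flatten_transposed_perm hQ rfl)).map _

theorem map_length_transposed {Q Q' : List (List ℕ)}
    (h : Q'.map List.length = Q.map List.length) :
    (transposed Q').map List.length = (transposed Q).map List.length := by
  have key : ∀ R : List (List ℕ), (transposed R).map List.length =
      (transposed ((R.map List.length).map fun n => List.replicate n ())).map List.length := by
    intro R
    have h1 := congrArg (List.map List.length) (transposed_map (fun _ => ()) R)
    have h2 : R.map (List.map fun _ => ()) =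
        (R.map List.length).map fun n => List.replicate n () := by
      rw [List.map_map]
      exact List.map_congr_left fun r _ => by simp
    rw [← h2, ← h1]
    simp [Function.comp_def]
  rw [key, key Q, h]

theorem refill_readingWord {T T' : List (List ℕ)}
    (h : T'.map List.length = T.map List.length) : refill T (readingWord T') = T' := by
  have key : ∀ U : List (List ℕ), List.splitLengths (U.map List.length) U.flatten = U := by
    intro U
    induction U with
    | nil => rfl
    | cons u U ih => simp [List.splitLengths_cons, ih]
  rw [refill, readingWord, List.map_reverse, ← h, ← List.map_reverse, key, List.reverse_reverse]

/-- The crystal operators on recording tableaux in terms of the column reading. -/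
theorem rec_of_raises {i : ℕ} {Q Q' : List (List ℕ)} (hQ : IsTab 1 Q) (hQ' : IsTab 1 Q')
    (hl : Q'.map List.length = Q.map List.length)
    (h : Raises i (columnWord Q) (columnWord Q')) :
    tabE i (transposeRows Q) = some (transposeRows Q') ∧
      tabF i (transposeRows Q') = some (transposeRows Q) := by
  have h1 := raises_readingWord hQ hl h
  have h2 := map_length_transposed hl
  rw [hQ.transposeRows_eq, hQ'.transposeRows_eq, tabE, tabF, (wordE_eq_some i _ _).2 h1,
    (wordF_eq_some i _ _).2 h1, Option.map_some, Option.map_some, refill_readingWord h2,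
    refill_readingWord h2.symm]
  exact ⟨rfl, rfl⟩

theorem tabE_eq_none {i : ℕ} {Q : List (List ℕ)} (hQ : IsTab 1 Q) :
    tabE i (transposeRows Q) = none ↔ eps i (columnWord Q) = 0 := by
  rw [tabE, Option.map_eq_none_iff, wordE_eq_none, (phi_eps_readingWord hQ).2]

theorem tabF_eq_none {i : ℕ} {Q : List (List ℕ)} (hQ : IsTab 1 Q) :
    tabF i (transposeRows Q) = none ↔ phi i (columnWord Q) = 0 := by
  rw [tabF, Option.map_eq_none_iff, wordF_eq_none, (phi_eps_readingWord hQ).1]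

/-! ### The crystal operators on Burge words -/

/-- Crystal biwords with positive entries and distinct biletters. -/
def IsCrystalWord (W : List (ℕ × ℕ)) : Prop :=
  (∀ b ∈ W, 0 < b.1 ∧ 0 < b.2) ∧ (W.map Prod.swap).Pairwise LexAfter

theorem topE_eq_some {i : ℕ} {W V : List (ℕ × ℕ)} :
    topE i W = some V ↔
      V.map Prod.snd = W.map Prod.snd ∧ Raises i (W.map Prod.fst) (V.map Prod.fst) := by
  rw [topE, Option.map_eq_some_iff]
  simp only [wordE_eq_some]
  constructor
  · rintro ⟨u, hu, rfl⟩
    have := hu.length_eq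
    rw [List.map_snd_zip (by simpa using this.ge), List.map_fst_zip (by simpa using this.le)]
    exact ⟨rfl, hu⟩
  · rintro ⟨h1, h2⟩
    refine ⟨_, h2, ?_⟩
    rw [← h1, ← List.unzip_fst, ← List.unzip_snd, List.zip_unzip]

theorem topF_eq_some {i : ℕ} {W V : List (ℕ × ℕ)} :
    topF i W = some V ↔
      V.map Prod.snd = W.map Prod.snd ∧ Raises i (V.map Prod.fst) (W.map Prod.fst) := by
  rw [topF, Option.map_eq_some_iff]
  simp only [wordF_eq_some]
  constructor
  · rintro ⟨u, hu, rfl⟩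
    have := hu.length_eq
    rw [List.map_snd_zip (by simpa using this.le), List.map_fst_zip (by simpa using this.ge)]
    exact ⟨rfl, hu⟩
  · rintro ⟨h1, h2⟩
    refine ⟨_, h2, ?_⟩
    rw [← h1, ← List.unzip_fst, ← List.unzip_snd, List.zip_unzip]

theorem topE_eq_none {i : ℕ} {W : List (ℕ × ℕ)} :
    topE i W = none ↔ eps i (W.map Prod.fst) = 0 := by
  rw [topE, Option.map_eq_none_iff, wordE_eq_none]

theorem topF_eq_none {i : ℕ} {W : List (ℕ × ℕ)} :
    topF i W = none ↔ phi i (W.map Prod.fst) = 0 := by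
  rw [topF, Option.map_eq_none_iff, wordF_eq_none]

theorem IsCrystalWord.pairwise {W : List (ℕ × ℕ)} (h : IsCrystalWord W) :
    W.Pairwise crystalLE ∧ W.Nodup := by
  have h1 := List.pairwise_map.1 h.2
  refine ⟨h1.imp ?_, h1.imp ?_⟩
  · rintro ⟨a, b⟩ ⟨c, e⟩ h
    simp only [LexAfter, crystalLE, Prod.swap_prod_mk] at *
    omega
  · rintro ⟨a, b⟩ ⟨c, e⟩ h
    simp only [LexAfter, Prod.swap_prod_mk, ne_eq, Prod.mk.injEq] at *
    omega

theorem isCrystalWord_crystalSort {W : List (ℕ × ℕ)} (h : ∀ b ∈ W, 0 < b.1 ∧ 0 < b.2)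
    (hW : W.Nodup) : IsCrystalWord (crystalSort W) :=
  ⟨fun b hb => h b ((perm_crystalSort W).mem_iff.1 hb),
    pairwise_lexAfter_map_swap (pairwise_crystalSort W) ((perm_crystalSort W).nodup_iff.2 hW)⟩

theorem IsCrystalWord.isBurge {W : List (ℕ × ℕ)} (h : IsCrystalWord W) :
    IsBurge (burgeSort W) :=
  ⟨fun b hb => h.1 b ((perm_burgeSort W).mem_iff.1 hb),
    (perm_burgeSort W).nodup_iff.2 h.pairwise.2, pairwise_burgeSort W⟩

theorem eq_of_perm_of_pairwise_crystalLE {W V : List (ℕ × ℕ)} (h : W.Perm V)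
    (hW : W.Pairwise crystalLE) (hV : V.Pairwise crystalLE) : W = V := by
  refine h.eq_of_pairwise ?_ hW hV
  rintro ⟨a, b⟩ ⟨c, e⟩ - - h1 h2
  simp only [crystalLE, Prod.mk.injEq] at *
  omega

theorem eq_of_perm_of_pairwise_burgeLE {W V : List (ℕ × ℕ)} (h : W.Perm V)
    (hW : W.Pairwise burgeLE) (hV : V.Pairwise burgeLE) : W = V := by
  refine h.eq_of_pairwise ?_ hW hV
  rintro ⟨a, b⟩ ⟨c, e⟩ - - h1 h2
  simp only [burgeLE, Prod.mk.injEq] at *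
  omega

/-- Raising the top row changes a single biletter. -/
theorem exists_of_raises_biword {i : ℕ} {W V : List (ℕ × ℕ)}
    (h : V.map Prod.snd = W.map Prod.snd) (hr : Raises i (W.map Prod.fst) (V.map Prod.fst)) :
    ∃ A B y, W = A ++ (i + 1, y) :: B ∧ V = A ++ (i, y) :: B ∧
      phi i (B.map Prod.fst) = 0 ∧ eps i (A.map Prod.fst) = 0 := by
  obtain ⟨a, b, h1, h2, hb, ha⟩ := hr
  obtain ⟨A, B', rfl, rfl, h3⟩ := List.map_eq_append_iff.1 h1
  obtain ⟨⟨x, y⟩, B, rfl, h4, rfl⟩ := List.map_eq_cons_iff.1 h3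
  obtain rfl : x = i + 1 := h4
  refine ⟨A, B, y, rfl, ?_, hb, ha⟩
  apply eq_of_map_fst_snd
  · simpa using h2
  · simpa using h

/-- Raising the top row of a crystal biword gives a crystal biword with distinct biletters: were
`i` already present next to the raised `i + 1`, the two would be matched. -/
theorem IsCrystalWord.raises {i : ℕ} (hi : 1 ≤ i) {W V : List (ℕ × ℕ)} (hW : IsCrystalWord W)
    (h : V.map Prod.snd = W.map Prod.snd) (hr : Raises i (W.map Prod.fst) (V.map Prod.fst)) :
    IsCrystalWord V := by
  obtain ⟨A, B, y, rfl, rfl, hb, ha⟩ := exists_of_raises_biword h hr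
  obtain ⟨hpos, hs⟩ := hW
  rw [List.pairwise_map, List.pairwise_append, List.pairwise_cons] at hs
  refine ⟨?_, ?_⟩
  · intro b hb
    have h1 := hpos b
    have h2 := hpos (i + 1, y) (by simp)
    simp only [List.mem_append, List.mem_cons] at hb h1
    rcases hb with hb | rfl | hb
    · exact h1 (.inl hb)
    · exact ⟨hi, h2.2⟩
    · exact h1 (.inr (.inr hb))
  · rw [List.pairwise_map, List.pairwise_append, List.pairwise_cons]
    refine ⟨hs.1, ⟨?_, hs.2.1.2⟩, ?_⟩
    · rcases B with _ | ⟨c, B⟩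
      · simp
      have hc : c ≠ (i, y) := by
        rintro rfl
        simp [phi] at hb
      have h1 := hs.2.1.1 c (by simp)
      have h2 := (List.pairwise_cons.1 hs.2.1.2).1
      obtain ⟨c1, c2⟩ := c
      simp only [LexAfter, Prod.swap_prod_mk, Prod.fst_swap, Prod.snd_swap, ne_eq,
        Prod.mk.injEq] at h1 hc h2 ⊢
      intro e he
      rcases List.mem_cons.1 he with rfl | he
      · simp only; omega
      · have h3 := h2 e he
        omega
    · intro a ha' b hb
      have h1 := hs.2.2 a ha'
      rcases List.mem_cons.1 hb with rfl | hb
      · have h2 := h1 (i + 1, y) (by simp)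
        simp only [LexAfter, Prod.swap_prod_mk, Prod.fst_swap, Prod.snd_swap] at h2 ⊢
        omega
      · exact h1 b (by simp [hb])

/-- Lowering the top row of a crystal biword gives a crystal biword with distinct biletters. -/
theorem IsCrystalWord.lowers {i : ℕ} {W V : List (ℕ × ℕ)} (hW : IsCrystalWord W)
    (h : V.map Prod.snd = W.map Prod.snd) (hr : Raises i (V.map Prod.fst) (W.map Prod.fst)) :
    IsCrystalWord V := by
  obtain ⟨A, B, y, rfl, rfl, hb, ha⟩ := exists_of_raises_biword h.symm hr
  obtain ⟨hpos, hs⟩ := hW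
  rw [List.pairwise_map, List.pairwise_append, List.pairwise_cons] at hs
  refine ⟨?_, ?_⟩
  · intro b hb
    have h1 := hpos b
    have h2 := hpos (i, y) (by simp)
    simp only [List.mem_append, List.mem_cons] at hb h1
    rcases hb with hb | rfl | hb
    · exact h1 (.inl hb)
    · exact ⟨Nat.succ_pos i, h2.2⟩
    · exact h1 (.inr (.inr hb))
  · rw [List.pairwise_map, List.pairwise_append, List.pairwise_cons]
    refine ⟨hs.1, ⟨?_, hs.2.1.2⟩, ?_⟩
    · intro e he
      have h1 := hs.2.1.1 e he
      simp only [LexAfter, Prod.swap_prod_mk, Prod.fst_swap, Prod.snd_swap] at h1 ⊢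
      omega
    · intro a ha' b hb
      have h1 := hs.2.2 a ha'
      rcases List.mem_cons.1 hb with rfl | hb
      · have h2 := h1 (i, y) (by simp)
        rcases List.eq_nil_or_concat A with rfl | ⟨A, c, rfl⟩
        · simp at ha'
        have hc : c ≠ (i + 1, y) := by
          rintro rfl
          simp [eps_append, eps, phi] at ha
        have h3 := hs.2.2 c (by simp) (i, y) (by simp)
        have h4 := (List.pairwise_append.1 (by simpa using hs.1)).2.2 a
        obtain ⟨c1, c2⟩ := c
        simp only [LexAfter, Prod.swap_prod_mk, Prod.fst_swap, Prod.snd_swap, ne_eq,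
          Prod.mk.injEq, List.concat_eq_append, List.mem_append, List.mem_singleton] at *
        rcases ha' with ha' | rfl
        · have h5 := h4 ha' _ rfl
          simp only at h5
          omega
        · simp only at h2 ⊢
          omega
      · exact h1 b (by simp [hb])

/-- The insertion tableau and the transposed recording tableau of a Burge word are
semistandard. -/
theorem isTab_rsk {W : List (ℕ × ℕ)} (hW : IsBurge W) :
    IsTab 0 (rsk W).1 ∧ IsTab 1 (rsk W).2 := by
  constructor
  · rw [rsk_eq_run]
    exact isTab_run (by omega) _
  · rw [rsk_eq_dual hW.2.2 hW.2.1 (pairwise_crystalSort W) (perm_crystalSort W)]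
    exact isTab_run le_rfl _

theorem map_length_rsk (W : List (ℕ × ℕ)) :
    (rsk W).1.map List.length = (rsk W).2.map List.length := by
  rw [rsk_eq_run]
  exact map_length_run _ _

/-- RSK turns the raising operator on crystal biwords into the raising operator on recording
tableaux. -/
theorem rsk_of_raises {i : ℕ} {W W' C C' : List (ℕ × ℕ)} (hW : IsBurge W) (hW' : IsBurge W')
    (hC : C.Pairwise crystalLE) (hC' : C'.Pairwise crystalLE) (hp : C.Perm W)
    (hp' : C'.Perm W') (h : C'.map Prod.snd = C.map Prod.snd)
    (hr : Raises i (C.map Prod.fst) (C'.map Prod.fst)) :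
    (rsk W').1 = (rsk W).1 ∧
      tabE i (transposeRows (rsk W).2) = some (transposeRows (rsk W').2) ∧
      tabF i (transposeRows (rsk W').2) = some (transposeRows (rsk W).2) ∧
      recE i (rsk W).2 = some (rsk W').2 ∧ recF i (rsk W').2 = some (rsk W).2 := by
  have e1 := rsk_eq_dual hW.2.2 hW.2.1 hC hp
  have e2 := rsk_eq_dual hW'.2.2 hW'.2.1 hC' hp'
  obtain ⟨h1, h2⟩ := raises_run (i := i) (L := C.map Prod.swap) (L' := C'.map Prod.swap)
    (by simpa [Function.comp_def] using h) (by simpa [Function.comp_def] using hr)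
  have h3 : (rsk W').1 = (rsk W).1 := by rw [e1, e2]; exact h1
  have h4 : Raises i (columnWord (rsk W).2) (columnWord (rsk W').2) := by rw [e1, e2]; exact h2
  have h5 := (isTab_rsk hW).2
  have h6 := (isTab_rsk hW').2
  obtain ⟨h7, h8⟩ := rec_of_raises h5 h6
    (by rw [← map_length_rsk, ← map_length_rsk, h3]) h4
  refine ⟨h3, h7, h8, ?_, ?_⟩
  · rw [recE, h7, Option.map_some, transposeRows_transposeRows le_rfl h6]
  · rw [recF, h8, Option.map_some, transposeRows_transposeRows le_rfl h5]

theorem phi_eps_rsk {i : ℕ} {W C : List (ℕ × ℕ)} (hW : IsBurge W)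
    (hC : C.Pairwise crystalLE) (hp : C.Perm W) :
    phi i (C.map Prod.fst) = phi i (columnWord (rsk W).2) ∧
      eps i (C.map Prod.fst) = eps i (columnWord (rsk W).2) := by
  rw [rsk_eq_dual hW.2.2 hW.2.1 hC hp]
  have := phi_eps_run i (C.map Prod.swap)
  simpa [Function.comp_def] using this

theorem tab_rsk_eq_none {i : ℕ} {W C : List (ℕ × ℕ)} (hW : IsBurge W)
    (hC : C.Pairwise crystalLE) (hp : C.Perm W) :
    (tabE i (transposeRows (rsk W).2) = none ↔ topE i C = none) ∧
      (tabF i (transposeRows (rsk W).2) = none ↔ topF i C = none) := by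
  obtain ⟨h1, h2⟩ := phi_eps_rsk (i := i) hW hC hp
  rw [tabE_eq_none (isTab_rsk hW).2, tabF_eq_none (isTab_rsk hW).2, topE_eq_none, topF_eq_none,
    h1, h2]
  exact ⟨.rfl, .rfl⟩

theorem rec_rsk_eq_none {i : ℕ} {W C : List (ℕ × ℕ)} (hW : IsBurge W)
    (hC : C.Pairwise crystalLE) (hp : C.Perm W) :
    (recE i (rsk W).2 = none ↔ topE i C = none) ∧
      (recF i (rsk W).2 = none ↔ topF i C = none) := by
  rw [recE, recF, Option.map_eq_none_iff, Option.map_eq_none_iff]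
  exact tab_rsk_eq_none hW hC hp

theorem rsk_topE {i : ℕ} (hi : 1 ≤ i) {W V : List (ℕ × ℕ)} (hW : IsBurge W)
    (h : topE i (crystalSort W) = some V) :
    IsBurge (burgeSort V) ∧ (rsk (burgeSort V)).1 = (rsk W).1 ∧
      recE i (rsk W).2 = some (rsk (burgeSort V)).2 := by
  obtain ⟨h1, h2⟩ := topE_eq_some.1 h
  have hC := isCrystalWord_crystalSort hW.1 hW.2.1
  have hV := hC.raises hi h1 h2
  obtain ⟨h3, -, -, h4, -⟩ := rsk_of_raises hW hV.isBurge hC.pairwise.1 hV.pairwise.1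
    (perm_crystalSort W) (perm_burgeSort V).symm h1 h2
  exact ⟨hV.isBurge, h3, h4⟩

theorem rsk_topF {i : ℕ} {W V : List (ℕ × ℕ)} (hW : IsBurge W)
    (h : topF i (crystalSort W) = some V) :
    IsBurge (burgeSort V) ∧ (rsk (burgeSort V)).1 = (rsk W).1 ∧
      recF i (rsk W).2 = some (rsk (burgeSort V)).2 := by
  obtain ⟨h1, h2⟩ := topF_eq_some.1 h
  have hC := isCrystalWord_crystalSort hW.1 hW.2.1
  have hV := hC.lowers h1 h2
  obtain ⟨h3, -, -, -, h4⟩ := rsk_of_raises hV.isBurge hW hV.pairwise.1 hC.pairwise.1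
    (perm_burgeSort V).symm (perm_crystalSort W) h1.symm h2
  exact ⟨hV.isBurge, h3.symm, h4⟩

/-! ### RSK is bijective -/

/-- The last entry smaller than `z` of a row determines a decomposition of the row. -/
theorem eq_of_append_cons_eq {y y' z : ℕ} {a b a' b' : List ℕ}
    (h : a ++ y :: b = a' ++ y' :: b') (hb : ∀ p ∈ b, z ≤ p) (hb' : ∀ p ∈ b', z ≤ p)
    (hy : y < z) (hy' : y' < z) : a = a' ∧ y = y' ∧ b = b' := by
  rcases List.append_eq_append_iff.1 h with ⟨u, rfl, hu⟩ | ⟨u, rfl, hu⟩ <;>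
    rcases u with _ | ⟨x, u⟩ <;> simp at hu
  · simp [hu]
  · have := hb y' (by simp [hu])
    omega
  · simp [hu]
  · have := hb' y (by simp [hu])
    omega

/-- A tableau together with the row of the new box determines the inserted letter and the tableau
before the insertion. -/
theorem insT_injective {y y' : ℕ} {P P' : List (List ℕ)} (hP : IsTab 0 P) (hP' : IsTab 0 P')
    (h : insT 0 y P = insT 0 y' P') (hrow : newRow 0 y P = newRow 0 y' P') :
    y = y' ∧ P = P' := by
  induction P generalizing y y' P' with
  | nil =>
    rcases P' with _ | ⟨r', P'⟩
    · simpa [insT] using h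
    · obtain ⟨h0, -⟩ := isTab_cons.1 hP'
      rcases forall_or_exists_bump 0 y' r' with h1 | ⟨a', z', b', rfl, ha', hz'⟩
      · rw [insT_of_forall h1] at h
        have h2 := congrArg List.length (List.cons.inj h).1
        simp [h0] at h2
      · rw [newRow_bump ha' hz'] at hrow
        simp [newRow] at hrow
  | cons r P ih =>
    obtain ⟨h0, hs, -, hP1⟩ := isTab_cons.1 hP
    rcases forall_or_exists_bump 0 y r with h1 | ⟨a, z, b, rfl, ha, hz⟩
    · rw [insT_of_forall h1] at h
      rw [newRow_of_forall h1] at hrow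
      rcases P' with _ | ⟨r', P'⟩
      · have h2 := congrArg List.length (List.cons.inj h).1
        simp [h0] at h2
      · rcases forall_or_exists_bump 0 y' r' with h3 | ⟨a', z', b', rfl, ha', hz'⟩
        · rw [insT_of_forall h3] at h
          simp only [List.cons.injEq] at h
          obtain ⟨h4, h5⟩ := List.append_inj' h.1 rfl
          exact ⟨by simpa using h5, by rw [h4, h.2]⟩
        · rw [newRow_bump ha' hz'] at hrow
          omega
    · rw [insT_bump ha hz] at h
      rw [newRow_bump ha hz] at hrow
      rcases P' with _ | ⟨r', P'⟩
      · simp [newRow] at hrow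
      · obtain ⟨h0', hs', -, hP1'⟩ := isTab_cons.1 hP'
        rcases forall_or_exists_bump 0 y' r' with h3 | ⟨a', z', b', rfl, ha', hz'⟩
        · rw [newRow_of_forall h3] at hrow
          omega
        · rw [insT_bump ha' hz'] at h
          rw [newRow_bump ha' hz'] at hrow
          simp only [List.cons.injEq] at h
          obtain ⟨rfl, rfl⟩ := ih hP1 hP1' h.2 (by omega)
          have right : ∀ a b : List ℕ, SortedRow 0 (a ++ z :: b) → ∀ p ∈ b, z ≤ p :=
            fun a b hab p hp =>
              (List.pairwise_cons.1 (List.pairwise_append.1 hab).2.1).1 p hp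
          obtain ⟨rfl, rfl, rfl⟩ :=
            eq_of_append_cons_eq h.1 (right a b hs) (right a' b' hs') (by omega) (by omega)
          exact ⟨rfl, rfl⟩

theorem addAt_injective {α : Type*} {k : ℕ} {x : α} {Q Q' : List (List α)}
    (hQ : ∀ r ∈ Q, r ≠ []) (hQ' : ∀ r ∈ Q', r ≠ []) (h : addAt k x Q = addAt k x Q') :
    Q = Q' := by
  induction k generalizing Q Q' with
  | zero =>
    rcases Q with _ | ⟨r, Q⟩ <;> rcases Q' with _ | ⟨r', Q'⟩ <;> simp_all [addAt]
  | succ k ih =>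
    rcases Q with _ | ⟨r, Q⟩ <;> rcases Q' with _ | ⟨r', Q'⟩ <;>
      simp only [addAt, List.headD_cons, List.headD_nil, List.tail_cons, List.tail_nil,
        List.cons.injEq] at h
    · rfl
    · exact absurd h.1.symm (hQ' r' (by simp))
    · exact absurd h.1 (hQ r (by simp))
    · rw [h.1, ih (fun s hs => hQ s (by simp [hs])) (fun s hs => hQ' s (by simp [hs])) h.2]

theorem le_of_pairwise_burgeAfter {b : ℕ × ℕ} {L : List (ℕ × ℕ)}
    (h : (b :: L).Pairwise BurgeAfter) : ∀ p ∈ (b :: L).map Prod.fst, p ≤ b.1 := by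
  intro p hp
  obtain ⟨c, hc, rfl⟩ := List.mem_map.1 hp
  rcases List.mem_cons.1 hc with rfl | hc
  · exact le_rfl
  · rcases (List.pairwise_cons.1 h).1 c hc with h | h <;> omega

theorem ne_nil_of_mem_record {d : ℕ} (hd : d ≤ 1) (L : List (ℕ × ℕ)) :
    ∀ r ∈ (run d L).2, r ≠ [] := by
  intro r hr hr'
  have h1 : 0 ∈ (run d L).1.map List.length := by
    rw [map_length_run]
    exact List.mem_map.2 ⟨r, hr, by simp [hr']⟩
  obtain ⟨s, hs, hs'⟩ := List.mem_map.1 h1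
  exact (isTab_run hd L).ne_nil s hs (List.length_eq_zero_iff.1 hs')

/-- The process on a Burge word can be run backwards: the biletter processed last has the largest
top entry, and its box is the lowest one with this entry. -/
theorem run_injective {L L' : List (ℕ × ℕ)} (hL : L.Pairwise BurgeAfter)
    (hL' : L'.Pairwise BurgeAfter) (h : run 0 L = run 0 L') : L = L' := by
  have hlen : L.length = L'.length := by
    have h1 := (flatten_run_fst_perm 0 L).length_eq
    have h2 := (flatten_run_fst_perm 0 L').length_eq
    rw [h, h2] at h1
    simpa using h1.symm
  induction L generalizing L' with
  | nil => symm; simpa using hlen.symm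
  | cons b L ih =>
    rcases L' with _ | ⟨b', L'⟩
    · simp at hlen
    have hbb : b.1 = b'.1 := by
      have h1 : ((b :: L).map Prod.fst).Perm ((b' :: L').map Prod.fst) :=
        (flatten_run_snd_perm 0 _).symm.trans (h ▸ flatten_run_snd_perm 0 (b' :: L'))
      have h2 := le_of_pairwise_burgeAfter hL' b.1 (h1.mem_iff.1 (by simp))
      have h3 := le_of_pairwise_burgeAfter hL b'.1 (h1.mem_iff.2 (by simp))
      omega
    have hrow : ∀ {b b' : ℕ × ℕ} {L L' : List (ℕ × ℕ)}, (b' :: L').Pairwise BurgeAfter →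
        b.1 = b'.1 → run 0 (b :: L) = run 0 (b' :: L') →
        newRow 0 b.2 (run 0 L).1 ≤ newRow 0 b'.2 (run 0 L').1 := by
      intro b b' L L' hL' hb h
      by_contra hlt
      have h1 : b.1 ∈ (run 0 (b :: L)).2.getD (newRow 0 b.2 (run 0 L).1) [] := by
        rw [run_cons, insRec, getD_addAt, if_pos rfl]
        simp
      rw [h, run_cons, insRec, getD_addAt, if_neg (by omega), hb] at h1
      exact absurd (lt_of_mem_record_burge hL' _ (by omega) _ h1) (by omega)
    have hrow' := le_antisymm (hrow hL' hbb h) (hrow hL hbb.symm h.symm)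
    rw [run_cons, run_cons, insRec, insRec, Prod.mk.injEq] at h
    obtain ⟨h1, h2⟩ := insT_injective (isTab_run (by omega) L) (isTab_run (by omega) L') h.1 hrow'
    have h3 := h.2
    rw [hrow', hbb] at h3
    have h4 := addAt_injective (ne_nil_of_mem_record (by omega) L)
      (ne_nil_of_mem_record (by omega) L') h3
    rw [ih (List.pairwise_cons.1 hL).2 (List.pairwise_cons.1 hL').2 (Prod.ext h2 h4)
      (by simpa using hlen), Prod.ext hbb h1]

theorem headD_addAt_prefix {α : Type*} (k : ℕ) (x : α) (Q : List (List α)) :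
    ∃ t, (addAt k x Q).headD [] = Q.headD [] ++ t := by
  rcases k with _ | k
  · exact ⟨[x], by simp [addAt]⟩
  · exact ⟨[], by simp [addAt]⟩

theorem Over.of_append {d : ℕ} {r s t : List ℕ} (h : Over d r (s ++ t)) : Over d r s :=
  fun j b hj => h j b (by
    rw [List.getElem?_append_left (List.getElem?_eq_some_iff.1 hj).1, hj])

/-- In a tableau with strict rows, the lowest of the largest entries can be removed. -/
theorem exists_addAt_of_isTab {x : ℕ} {Q : List (List ℕ)} (hQ : IsTab 1 Q)
    (hx : x ∈ Q.flatten) (hle : ∀ p ∈ Q.flatten, p ≤ x) :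
    ∃ k Q', Q = addAt k x Q' ∧ IsTab 1 Q' ∧ ∀ j, k ≤ j → ∀ p ∈ Q'.getD j [], p < x := by
  induction Q with
  | nil => simp at hx
  | cons r Q ih =>
    obtain ⟨h1, h2, h3, h4⟩ := isTab_cons.1 hQ
    by_cases hxQ : x ∈ Q.flatten
    · obtain ⟨k, Q', rfl, h5, h6⟩ := ih h4 hxQ (fun p hp => hle p (by simp [hp]))
      refine ⟨k + 1, r :: Q', rfl, isTab_cons.2 ⟨h1, h2, ?_, h5⟩, ?_⟩
      · obtain ⟨t, ht⟩ := headD_addAt_prefix k x Q'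
        rw [ht] at h3
        exact h3.of_append
      · intro j hj p hp
        rcases j with _ | j
        · omega
        · exact h6 j (by omega) p (by simpa using hp)
    · have hxr : x ∈ r := by
        rw [List.flatten_cons, List.mem_append] at hx
        tauto
      obtain ⟨s, t, rfl⟩ := List.append_of_mem hxr
      have h2' := List.pairwise_append.1 h2
      obtain rfl : t = [] := by
        rcases t with _ | ⟨y, t⟩
        · rfl
        · have g1 := (List.pairwise_cons.1 h2'.2.1).1 y (by simp)
          have g2 := hle y (by simp)
          omega
      have hlt : ∀ p ∈ Q.flatten, p < x := fun p hp =>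
        lt_of_le_of_ne (hle p (by simp only [List.flatten_cons, List.mem_append, hp, or_true]))
          (fun h => hxQ (h ▸ hp))
      have h3' : Over 1 s (Q.headD []) := by
        intro j b hj
        obtain ⟨a, ha, hab⟩ := h3 j b hj
        rw [getElem?_append_cons] at ha
        split_ifs at ha with g1 g2
        · exact ⟨a, ha, hab⟩
        · obtain rfl : x = a := by simpa using ha
          have : b ∈ Q.flatten := by
            rcases Q with _ | ⟨q, Q⟩
            · simp at hj
            · simp only [List.headD_cons] at hj
              simp [List.mem_of_getElem? hj]
          have := hlt b this
          omega
        · simp at ha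
      rcases s with _ | ⟨y, s⟩
      · obtain rfl : Q = [] := by
          rcases Q with _ | ⟨q, Q⟩
          · rfl
          · rcases q with _ | ⟨y, q⟩
            · exact absurd rfl (h4.ne_nil [] (by simp))
            · obtain ⟨a, ha, -⟩ := h3' 0 y rfl
              simp at ha
        exact ⟨0, [], rfl, isTab_nil 1, by simp⟩
      · refine ⟨0, (y :: s) :: Q, by simp [addAt], isTab_cons.2 ⟨by simp, h2'.1, h3', h4⟩, ?_⟩
        intro j _ p hp
        rcases j with _ | j
        · exact h2'.2.2 p (by simpa using hp) x (by simp)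
        · exact hlt p (mem_flatten_of_mem_getD (by simpa using hp))

/-- The entry `y` that is removed when `z` is bumped back into the row `r`. -/
theorem exists_last_lt {z : ℕ} {r : List ℕ} (hr : SortedRow 0 r) (h : ∃ p ∈ r, p < z) :
    ∃ a y b, r = a ++ y :: b ∧ y < z ∧ ∀ p ∈ b, z ≤ p := by
  induction r with
  | nil => simp at h
  | cons q r ih =>
    have hr' := List.pairwise_cons.1 hr
    by_cases h1 : ∃ p ∈ r, p < z
    · obtain ⟨a, y, b, rfl, hy, hb⟩ := ih hr'.2 h1
      exact ⟨q :: a, y, b, rfl, hy, hb⟩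
    · push Not at h1
      refine ⟨[], q, r, rfl, ?_, h1⟩
      obtain ⟨p, hp, hpz⟩ := h
      rcases List.mem_cons.1 hp with rfl | hp
      · exact hpz
      · exact absurd (h1 p hp) (by omega)

/-- Reverse bumping out of a row: the columns stay strict. -/
theorem Over.unbump {y z : ℕ} {a b s : List ℕ} (h : Over 0 (a ++ y :: b) (rowIns 0 z s).1)
    (hb : ∀ p ∈ b, z ≤ p) (hs : SortedRow 0 s) : Over 0 (a ++ z :: b) s := by
  -- the box of `z` in the lower row is not to the right of the box of `y`
  have left : ∀ u v : List ℕ, (rowIns 0 z s).1 = u ++ z :: v → u.length ≤ a.length := by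
    intro u v huv
    by_contra hlt
    obtain ⟨q, hq, hqz⟩ := h u.length z (by rw [huv, getElem?_append_cons]; simp)
    rw [getElem?_append_cons, if_neg (by omega), if_neg (by omega)] at hq
    have := hb q (List.mem_of_getElem? hq)
    omega
  rcases forall_or_exists_bump 0 z s with h1 | ⟨u, z', v, rfl, hu, hz'⟩
  · rw [rowIns_of_forall h1] at left h
    have h2 := left s [] rfl
    intro j q hj
    have hj' := (List.getElem?_eq_some_iff.1 hj).1
    obtain ⟨p, hp, hpq⟩ := h.of_append j q hj
    rw [getElem?_append_cons, if_pos (by omega)] at hp ⊢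
    exact ⟨p, hp, hpq⟩
  · rw [rowIns_append_cons hu hz'] at left h
    have h2 := left u v rfl
    have hs' := List.pairwise_append.1 hs
    have hs'' := List.pairwise_cons.1 hs'.2.1
    intro j q hj
    -- compare with the entry of the row after the insertion
    obtain ⟨q', hq', hle⟩ : ∃ q', (u ++ z :: v)[j]? = some q' ∧ q' ≤ q := by
      rw [getElem?_append_cons] at hj ⊢
      split_ifs at hj ⊢ with g1 g2
      · exact ⟨q, hj, le_rfl⟩
      · obtain rfl : z' = q := by simpa using hj
        exact ⟨z, rfl, by omega⟩
      · exact ⟨q, hj, le_rfl⟩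
    obtain ⟨p, hp, hpq⟩ := h j q' hq'
    rw [getElem?_append_cons] at hp ⊢
    split_ifs at hp ⊢ with g1 g2
    · exact ⟨p, hp, by omega⟩
    · refine ⟨z, rfl, ?_⟩
      rw [getElem?_append_cons, if_neg (by omega)] at hj
      split_ifs at hj with g3
      · obtain rfl : z' = q := by simpa using hj
        omega
      · have := hs''.1 q (List.mem_of_getElem? hj)
        omega
    · exact ⟨p, hp, by omega⟩

theorem headD_insT (d x : ℕ) (P : List (List ℕ)) :
    (insT d x P).headD [] = (rowIns d x (P.headD [])).1 := by
  obtain ⟨P', h⟩ := insT_eq_cons d x P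
  rw [h]
  rfl

theorem mem_rowIns (d x : ℕ) (r : List ℕ) : x ∈ (rowIns d x r).1 := by
  rcases forall_or_exists_bump d x r with h1 | ⟨a, z, b, rfl, ha, hz⟩
  · simp [rowIns_of_forall h1]
  · simp [rowIns_append_cons ha hz]

/-- Reverse insertion: a corner of a semistandard tableau can be removed by reverse bumping. -/
theorem exists_insT_of_isTab {k x : ℕ} {P Q : List (List ℕ)} (hP : IsTab 0 P) (hQ : IsTab 1 Q)
    (h : P.map List.length = (addAt k x Q).map List.length) :
    ∃ y P', insT 0 y P' = P ∧ newRow 0 y P' = k ∧ IsTab 0 P' ∧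
      P'.map List.length = Q.map List.length := by
  induction k generalizing P Q with
  | zero =>
    rcases P with _ | ⟨r, P⟩
    · simp [addAt] at h
    obtain ⟨h1, h2, h3, h4⟩ := isTab_cons.1 hP
    obtain ⟨s, y, rfl⟩ := (List.eq_nil_or_concat r).resolve_left h1
    rw [List.concat_eq_append] at *
    have h2' := List.pairwise_append.1 h2
    have hsy : ∀ p ∈ s, p + 0 ≤ y := fun p hp => h2'.2.2 p hp y (by simp)
    rcases Q with _ | ⟨q, Q⟩
    · simp [addAt] at h
      obtain ⟨rfl, rfl⟩ := h
      exact ⟨y, [], rfl, rfl, isTab_nil 0, rfl⟩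
    · simp only [addAt, List.headD_cons, List.tail_cons, List.map_cons, List.cons.injEq,
        List.length_append, List.length_singleton, Nat.add_right_cancel_iff] at h
      refine ⟨y, s :: P, insT_of_forall hsy, newRow_of_forall hsy,
        isTab_cons.2 ⟨?_, h2'.1, ?_, h4⟩, by simp [h]⟩
      · rintro rfl
        exact hQ.ne_nil q (by simp) (List.length_eq_zero_iff.1 h.1.symm)
      · intro j b hj
        obtain ⟨a, ha, hab⟩ := h3 j b hj
        refine ⟨a, ?_, hab⟩
        have hjs : j < s.length := by
          rw [h.1]
          rcases P with _ | ⟨p, P⟩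
          · simp at hj
          · rcases Q with _ | ⟨q', Q⟩
            · simp at h
            · have g1 := (List.pairwise_cons.1 hQ.pairwise_length).1 q' (by simp)
              have g2 := (List.getElem?_eq_some_iff.1 hj).1
              simp only [List.map_cons, List.cons.injEq, List.headD_cons] at h g2
              omega
        rwa [List.getElem?_append_left hjs] at ha
  | succ k ih =>
    rcases P with _ | ⟨r, P⟩
    · simp [addAt] at h
    obtain ⟨h1, h2, h3, h4⟩ := isTab_cons.1 hP
    rcases Q with _ | ⟨q, Q⟩
    · simp [addAt] at h
      exact absurd h.1 h1
    simp only [addAt, List.headD_cons, List.tail_cons, List.map_cons, List.cons.injEq] at h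
    obtain ⟨z, P', rfl, h5, h6, h7⟩ := ih h4 (isTab_cons.1 hQ).2.2.2 h.2
    rw [headD_insT] at h3
    obtain ⟨j, hj, hjz⟩ := List.getElem_of_mem (mem_rowIns 0 z (P'.headD []))
    obtain ⟨p, hp, hpz⟩ := h3 j z (by rw [List.getElem?_eq_getElem hj, hjz])
    obtain ⟨a, y, b, rfl, hy, hb⟩ :=
      exists_last_lt h2 ⟨p, List.mem_of_getElem? hp, by omega⟩
    have h2' := List.pairwise_append.1 h2
    have hay : ∀ p ∈ a, p + 0 ≤ y := fun p hp => h2'.2.2 p hp y (by simp)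
    have hP's : SortedRow 0 (P'.headD []) := by
      rcases P' with _ | ⟨p, P'⟩
      · exact List.Pairwise.nil
      · exact h6.sorted p (by simp)
    refine ⟨y, (a ++ z :: b) :: P', insT_bump hay (by omega),
      by rw [newRow_bump hay (by omega), h5],
      isTab_cons.2 ⟨by simp, ?_, h3.unbump hb hP's, h6⟩, ?_⟩
    · simp only [SortedRow, List.pairwise_append, List.pairwise_cons, List.mem_cons,
        forall_eq_or_imp]
      refine ⟨h2'.1, ⟨hb, (List.pairwise_cons.1 h2'.2.1).2⟩, fun p hp => ⟨?_, fun q hq => ?_⟩⟩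
      · have := hay p hp
        omega
      · exact h2'.2.2 p hp q (by simp [hq])
    · simpa [h7] using h.1

/-- Every pair of a semistandard tableau and a tableau of the same shape with semistandard
transpose comes from a Burge word. -/
theorem exists_run_eq {P Q : List (List ℕ)} (hP : IsTab 0 P) (hQ : IsTab 1 Q)
    (h : P.map List.length = Q.map List.length) :
    ∃ L : List (ℕ × ℕ), L.Pairwise BurgeAfter ∧ run 0 L = (P, Q) := by
  induction hn : Q.flatten.length generalizing P Q with
  | zero =>
    have h1 : Q = [] := by
      rcases Q with _ | ⟨q, Q⟩
      · rfl
      · have := hQ.ne_nil q (by simp)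
        simp [this] at hn
    subst h1
    obtain rfl : P = [] := by simpa using h
    exact ⟨[], .nil, rfl⟩
  | succ n ih =>
    obtain ⟨x, hx, hle⟩ : ∃ x ∈ Q.flatten, ∀ p ∈ Q.flatten, p ≤ x := by
      have hne : Q.flatten.toFinset.Nonempty := by
        rw [List.toFinset_nonempty_iff]
        intro h0
        simp [h0] at hn
      obtain ⟨x, hx, hle⟩ := Q.flatten.toFinset.exists_max_image id hne
      exact ⟨x, by simpa using hx, by simpa using hle⟩
    obtain ⟨k, Q', rfl, hQ', hlt⟩ := exists_addAt_of_isTab hQ hx hle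
    obtain ⟨y, P', rfl, hk, hP', hl⟩ := exists_insT_of_isTab hP hQ' h
    have hperm := flatten_addAt_perm k x Q'
    obtain ⟨L, hL, hrun⟩ := ih hP' hQ' hl (by
      have h9 := hperm.length_eq
      rw [hn, List.length_cons] at h9
      omega)
    refine ⟨(x, y) :: L, ?_, ?_⟩
    · refine List.pairwise_cons.2 ⟨?_, hL⟩
      rcases L with _ | ⟨c, L⟩
      · simp
      have hcx : c.1 ≤ x := by
        refine hle _ (hperm.mem_iff.2 (List.mem_cons_of_mem _ ?_))
        have := (flatten_run_snd_perm 0 (c :: L)).mem_iff (a := c.1)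
        rw [hrun] at this
        exact this.2 (by simp)
      have hc : BurgeAfter (x, y) c := by
        rcases hcx.lt_or_eq with hcx | hcx
        · exact .inl hcx
        · refine .inr ⟨hcx, ?_⟩
          -- otherwise `c.1 = x` was recorded in row `k` or below it
          by_contra hyc
          rw [run_cons, insRec, Prod.mk.injEq] at hrun
          have g1 := newRow_insT_le (d := 0) (x := c.2) (x' := y)
            (isTab_run (by omega) L).sorted (by omega)
          rw [hrun.1, hk] at g1
          refine absurd (hlt _ g1 x ?_) (by omega)
          rw [← hrun.2, getD_addAt, if_pos rfl, ← hcx]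
          simp
      intro e he
      rcases List.mem_cons.1 he with rfl | he
      · exact hc
      · have g1 := (List.pairwise_cons.1 hL).1 e he
        simp only [BurgeAfter] at hc g1 ⊢
        omega
    · rw [run_cons, hrun, insRec]
      simp only [hk]

theorem rsk_injective {W W' : List (ℕ × ℕ)} (hW : IsBurge W) (hW' : IsBurge W')
    (h : rsk W = rsk W') : W = W' := by
  rw [rsk_eq_run, rsk_eq_run] at h
  exact List.reverse_injective (run_injective (pairwise_burgeAfter_reverse hW.2.2 hW.2.1)
    (pairwise_burgeAfter_reverse hW'.2.2 hW'.2.1) h)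

theorem flatten_rsk_perm (W : List (ℕ × ℕ)) :
    (rsk W).1.flatten.Perm (W.map Prod.snd) ∧ (rsk W).2.flatten.Perm (W.map Prod.fst) := by
  rw [rsk_eq_run]
  exact ⟨(flatten_run_fst_perm 0 _).trans ((List.reverse_perm W).map _),
    (flatten_run_snd_perm 0 _).trans ((List.reverse_perm W).map _)⟩

theorem exists_rsk_eq {P Q : List (List ℕ)} (hP : IsTab 0 P) (hQ : IsTab 1 Q)
    (h : P.map List.length = Q.map List.length) (hP0 : ∀ p ∈ P.flatten, 0 < p)
    (hQ0 : ∀ p ∈ Q.flatten, 0 < p) : ∃ W, IsBurge W ∧ rsk W = (P, Q) := by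
  obtain ⟨L, hL, hrun⟩ := exists_run_eq hP hQ h
  have h0 : rsk L.reverse = (P, Q) := by rw [rsk_eq_run, List.reverse_reverse, hrun]
  obtain ⟨h1, h2⟩ := flatten_rsk_perm L.reverse
  rw [h0] at h1 h2
  refine ⟨L.reverse, ⟨fun b hb => ⟨?_, ?_⟩, ?_, ?_⟩, h0⟩
  · exact hQ0 _ (h2.mem_iff.2 (List.mem_map_of_mem hb))
  · exact hP0 _ (h1.mem_iff.2 (List.mem_map_of_mem hb))
  · rw [List.nodup_reverse]
    refine hL.imp ?_
    rintro ⟨a, b⟩ ⟨c, e⟩ h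
    simp only [BurgeAfter, ne_eq, Prod.mk.injEq] at *
    omega
  · rw [List.pairwise_reverse]
    refine hL.imp ?_
    rintro ⟨a, b⟩ ⟨c, e⟩ h
    simp only [BurgeAfter, burgeLE] at *
    omega

/-! ### Coinversion-free fillings and their biwords -/

theorem mem_skew_iff {lam mu : YoungDiagram} {i j : ℕ} :
    (i, j) ∈ lam.cells \ mu.cells ↔ mu.colLen j ≤ i ∧ i < lam.colLen j := by
  rw [Finset.mem_sdiff, YoungDiagram.mem_cells, YoungDiagram.mem_cells,
    YoungDiagram.mem_iff_lt_colLen, YoungDiagram.mem_iff_lt_colLen, not_lt, and_comm]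

/-- With `∞` on the left, the triple condition is that of the first column. -/
theorem isInversionTriple_top {b c : ℕ} : IsInversionTriple ⊤ b c ↔ c < b := by
  simp [IsInversionTriple]

theorem IsInversionTriple.asymm {a : ℕ∞} {b c : ℕ} (h : IsInversionTriple a b c) :
    ¬ IsInversionTriple a c b := by
  rcases eq_or_ne a ⊤ with rfl | ha
  · rw [isInversionTriple_top] at *
    omega
  · lift a to ℕ using ha
    simp only [IsInversionTriple, Nat.cast_lt, Nat.cast_le] at *
    omega

/-- A nonempty set of entries has a member that can be put on top of all the others: the largest
one that is at most the left neighbour `a`, or, if there is none, the largest one. -/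
theorem exists_isInversionTriple (a : ℕ∞) {S : Finset ℕ} (hS : S.Nonempty) :
    ∃ s ∈ S, ∀ c ∈ S, c ≠ s → IsInversionTriple a s c := by
  by_cases hT : (S.filter fun s : ℕ => (s : ℕ∞) ≤ a).Nonempty
  · obtain ⟨s, hs, hle⟩ := Finset.exists_max_image _ id hT
    rw [Finset.mem_filter] at hs
    refine ⟨s, hs.1, fun c hc hne => ?_⟩
    rcases le_or_gt (c : ℕ∞) a with h | h
    · have := hle c (Finset.mem_filter.2 ⟨hc, h⟩)
      exact .inr (.inl ⟨lt_of_le_of_ne this hne, hs.2⟩)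
    · exact .inr (.inr ⟨hs.2, h⟩)
  · obtain ⟨s, hs, hle⟩ := Finset.exists_max_image S id hS
    refine ⟨s, hs, fun c hc hne => .inl ⟨?_, lt_of_le_of_ne (hle c hc) hne⟩⟩
    by_contra hca
    exact hT ⟨c, Finset.mem_filter.2 ⟨hc, not_lt.1 hca⟩⟩

/-- A column with prescribed left neighbours and prescribed set of entries exists. -/
theorem exists_column (a : ℕ → ℕ∞) (n : ℕ) : ∀ (m : ℕ) (S : Finset ℕ), S.card = n →
    ∃ b : ℕ → ℕ, (∀ x, (∃ i, (m ≤ i ∧ i < m + n) ∧ b i = x) ↔ x ∈ S) ∧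
      ∀ i i', m ≤ i → i < i' → i' < m + n → IsInversionTriple (a i) (b i) (b i') := by
  induction n with
  | zero =>
    intro m S hS
    refine ⟨fun _ => 0, fun x => ?_, fun i i' _ _ _ => by omega⟩
    rw [Finset.card_eq_zero] at hS
    subst hS
    simp only [Finset.notMem_empty, iff_false]
    rintro ⟨i, hi, -⟩
    omega
  | succ n ih =>
    intro m S hS
    obtain ⟨s, hs, hsc⟩ := exists_isInversionTriple (a m)
      (Finset.card_pos.1 (by omega : 0 < S.card))
    obtain ⟨b, hb, hinv⟩ := ih (m + 1) (S.erase s) (by rw [Finset.card_erase_of_mem hs, hS]; rfl)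
    refine ⟨fun i => if i = m then s else b i, fun x => ?_, fun i i' hi hlt hi' => ?_⟩
    · constructor
      · rintro ⟨i, hi, rfl⟩
        dsimp only
        split_ifs with h
        · exact hs
        · exact Finset.mem_of_mem_erase ((hb _).1 ⟨i, by omega, rfl⟩)
      · intro hx
        by_cases hxs : x = s
        · exact ⟨m, by omega, by simp [hxs]⟩
        · obtain ⟨i, hi, rfl⟩ := (hb x).2 (Finset.mem_erase.2 ⟨hxs, hx⟩)
          exact ⟨i, by omega, if_neg (by omega)⟩
    · have hi'm : i' ≠ m := by omega
      rcases eq_or_ne i m with rfl | hne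
      · simp only [if_true, if_neg hi'm]
        have := Finset.mem_erase.1 ((hb (b i')).1 ⟨i', by omega, rfl⟩)
        exact hsc _ this.2 this.1
      · simp only [if_neg hne, if_neg hi'm]
        exact hinv i i' (by omega) hlt (by omega)

/-- A column is determined by its left neighbours and its set of entries. -/
theorem column_unique {a : ℕ → ℕ∞} {b b' : ℕ → ℕ} {s t : ℕ}
    (h : ∀ x, (∃ i, (s ≤ i ∧ i < t) ∧ b i = x) ↔ ∃ i, (s ≤ i ∧ i < t) ∧ b' i = x)
    (hb : ∀ i i', s ≤ i → i < i' → i' < t → IsInversionTriple (a i) (b i) (b i'))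
    (hb' : ∀ i i', s ≤ i → i < i' → i' < t → IsInversionTriple (a i) (b' i) (b' i'))
    (i : ℕ) (hs : s ≤ i) (ht : i < t) : b i = b' i := by
  induction i using Nat.strong_induction_on with
  | _ i ih =>
    obtain ⟨k, hk, hbk⟩ := (h (b i)).1 ⟨i, ⟨hs, ht⟩, rfl⟩
    obtain ⟨l, hl, hbl⟩ := (h (b' i)).2 ⟨i, ⟨hs, ht⟩, rfl⟩
    -- an entry already used further up cannot occur again, and neither `b i` nor `b' i` can be
    -- below the other one
    have irrefl : ∀ {a : ℕ∞} {b : ℕ}, ¬ IsInversionTriple a b b := fun h => h.asymm h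
    rcases lt_trichotomy k i with hki | rfl | hki
    · rw [← ih k hki hk.1 hk.2] at hbk
      exact absurd (hbk ▸ hb k i hk.1 hki ht) irrefl
    · exact hbk.symm
    rcases lt_trichotomy l i with hli | rfl | hli
    · rw [ih l hli hl.1 hl.2] at hbl
      exact absurd (hbl ▸ hb' l i hl.1 hli ht) irrefl
    · exact hbl
    have h1 := hb i l hs hli hl.2
    have h2 := hb' i k hs hki hk.2
    rw [hbl] at h1
    rw [hbk] at h2
    exact absurd h2 h1.asymm

/-- The entry to the left of the box `(i, j)` in a filling of `lam / mu`, and `∞` if this position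
is not in the skew diagram. -/
def leftEntry (lam mu : YoungDiagram) (E : ℕ → ℕ → ℕ) : ℕ → ℕ → ℕ∞
  | _, 0 => ⊤
  | i, j + 1 => if (i, j) ∈ lam.cells \ mu.cells then (E i j : ℕ∞) else ⊤

theorem COF.isInversionTriple {lam mu : YoungDiagram} (F : COF lam mu) {i i' j : ℕ} (h : i < i')
    (hi : (i, j) ∈ lam.cells \ mu.cells) (hi' : (i', j) ∈ lam.cells \ mu.cells) :
    IsInversionTriple (leftEntry lam mu F.entry i j) (F.entry i j) (F.entry i' j) := by
  rcases j with _ | j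
  · exact isInversionTriple_top.2 (F.first_column i i' h hi hi')
  · exact F.triple i i' j h hi hi'

/-- A filling is determined by the sets of entries of its columns. -/
theorem COF.ext_of_columns {lam mu : YoungDiagram} {F G : COF lam mu}
    (h : ∀ j x, (∃ i, (i, j) ∈ lam.cells \ mu.cells ∧ F.entry i j = x) ↔
      ∃ i, (i, j) ∈ lam.cells \ mu.cells ∧ G.entry i j = x) : F = G := by
  have key : ∀ j i, (i, j) ∈ lam.cells \ mu.cells → F.entry i j = G.entry i j := by
    intro j
    induction j using Nat.strong_induction_on with
    | _ j ih =>
      intro i hij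
      have hleft : ∀ i, leftEntry lam mu F.entry i j = leftEntry lam mu G.entry i j := by
        intro i
        rcases j with _ | j
        · rfl
        · simp only [leftEntry]
          split_ifs with hc
          · rw [ih j (by omega) i hc]
          · rfl
      have hij' := mem_skew_iff.1 hij
      refine column_unique (a := fun i => leftEntry lam mu F.entry i j)
        (b := fun i => F.entry i j) (b' := fun i => G.entry i j)
        (by simpa only [mem_skew_iff] using h j) ?_ ?_ i hij'.1 hij'.2
      · intro i i' h1 h2 h3
        exact F.isInversionTriple h2 (mem_skew_iff.2 (by omega)) (mem_skew_iff.2 (by omega))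
      · intro i i' h1 h2 h3
        rw [hleft]
        exact G.isInversionTriple h2 (mem_skew_iff.2 (by omega)) (mem_skew_iff.2 (by omega))
  ext i j
  by_cases hij : (i, j) ∈ lam.cells \ mu.cells
  · exact key j i hij
  · rw [F.zeros i j hij, G.zeros i j hij]

/-- The sets of entries of the columns of a filling can be prescribed. -/
theorem COF.exists_of_columns {lam mu : YoungDiagram} (S : ℕ → Finset ℕ)
    (hcard : ∀ j, (S j).card = lam.colLen j - mu.colLen j) (hpos : ∀ j, 0 ∉ S j) :
    ∃ F : COF lam mu, ∀ j x,
      (∃ i, (i, j) ∈ lam.cells \ mu.cells ∧ F.entry i j = x) ↔ x ∈ S j := by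
  have hcol : ∀ (j : ℕ) (a : ℕ → ℕ∞), ∃ b : ℕ → ℕ,
      (∀ x, (∃ i, (i, j) ∈ lam.cells \ mu.cells ∧ b i = x) ↔ x ∈ S j) ∧
      (∀ i i', i < i' → (i, j) ∈ lam.cells \ mu.cells → (i', j) ∈ lam.cells \ mu.cells →
        IsInversionTriple (a i) (b i) (b i')) ∧
      ∀ i, (i, j) ∉ lam.cells \ mu.cells → b i = 0 := by
    intro j a
    obtain ⟨b, hb, hinv⟩ := exists_column a _ (mu.colLen j) (S j) (hcard j)
    have hmem : ∀ i, (i, j) ∈ lam.cells \ mu.cells ↔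
        mu.colLen j ≤ i ∧ i < mu.colLen j + (lam.colLen j - mu.colLen j) := by
      intro i
      rw [mem_skew_iff]
      omega
    refine ⟨fun i => if (i, j) ∈ lam.cells \ mu.cells then b i else 0, fun x => ?_, ?_, ?_⟩
    · rw [← hb x]
      refine exists_congr fun i => ?_
      rw [← hmem]
      refine and_congr_right fun hi => ?_
      simp only [if_pos hi]
    · intro i i' h hi hi'
      simp only [if_pos hi, if_pos hi']
      exact hinv i i' ((hmem _).1 hi).1 h ((hmem _).1 hi').2
    · intro i hi
      exact if_neg hi
  choose b hb hinv hzero using hcol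
  -- the columns are filled from left to right
  let col : ℕ → ℕ → ℕ := fun j => Nat.rec (b 0 fun _ => ⊤)
    (fun j c => b (j + 1) fun i => if (i, j) ∈ lam.cells \ mu.cells then (c i : ℕ∞) else ⊤) j
  have hc : ∀ j, col j = b j fun i => leftEntry lam mu (fun i j => col j i) i j := by
    intro j
    rcases j with _ | j <;> rfl
  have htriple : ∀ i i' j, i < i' → (i, j) ∈ lam.cells \ mu.cells →
      (i', j) ∈ lam.cells \ mu.cells →
      IsInversionTriple (leftEntry lam mu (fun i j => col j i) i j) (col j i) (col j i') := by
    intro i i' j h hi hi'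
    rw [hc j]
    exact hinv _ _ i i' h hi hi'
  have hmem : ∀ j x, (∃ i, (i, j) ∈ lam.cells \ mu.cells ∧ col j i = x) ↔ x ∈ S j := by
    intro j x
    rw [hc j]
    exact hb _ _ x
  refine ⟨⟨fun i j => col j i, ?_, ?_, ?_, ?_, ?_⟩, hmem⟩
  · intro i j hij
    rw [hc j]
    exact hzero _ _ i hij
  · intro i j hij
    refine Nat.pos_of_ne_zero fun h0 => hpos j ((hmem j 0).1 ⟨i, hij, h0⟩)
  · intro i i' j h hi hi' heq
    have := htriple i i' j h hi hi'
    rw [← heq] at this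
    exact this.asymm this
  · intro i i' h hi hi'
    exact isInversionTriple_top.1 (htriple i i' 0 h hi hi')
  · intro i i' j h hi hi'
    exact htriple i i' (j + 1) h hi hi'

theorem count_map_toList {α : Type*} (s : Finset α) (f : α → ℕ) (k : ℕ) :
    (s.toList.map f).count k = (s.filter fun c => f c = k).card := by
  rw [← Multiset.coe_count, ← Multiset.map_coe, Finset.coe_toList, Multiset.count_map,
    Finset.card_def, Finset.filter_val]
  simp only [eq_comm]

theorem COF.mem_biletters {lam mu : YoungDiagram} {F : COF lam mu} {x y : ℕ} :
    (x, y) ∈ F.biletters ↔ ∃ j, y = j + 1 ∧ ∃ i, (i, j) ∈ lam.cells \ mu.cells ∧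
      F.entry i j = x := by
  simp only [COF.biletters, List.mem_map, Finset.mem_toList, Prod.exists, Prod.mk.injEq]
  constructor
  · rintro ⟨i, j, h, rfl, rfl⟩
    exact ⟨j, rfl, i, h, rfl⟩
  · rintro ⟨j, rfl, i, h, rfl⟩
    exact ⟨i, j, h, rfl, rfl⟩

theorem COF.nodup_biletters {lam mu : YoungDiagram} (F : COF lam mu) : F.biletters.Nodup := by
  refine List.Nodup.map_on ?_ (Finset.nodup_toList _)
  rintro ⟨i, j⟩ h ⟨i', j'⟩ h' heq
  rw [Finset.mem_toList] at h h'
  obtain ⟨h1, h2⟩ := Prod.mk.inj heq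
  obtain rfl : j = j' := by simpa using h2
  rcases lt_trichotomy i i' with hi | rfl | hi
  · exact absurd h1 (F.column_distinct i i' j hi h h')
  · rfl
  · exact absurd h1.symm (F.column_distinct i' i j hi h' h)

theorem COF.pos_of_mem_biletters {lam mu : YoungDiagram} {F : COF lam mu} :
    ∀ b ∈ F.biletters, 0 < b.1 ∧ 0 < b.2 := by
  rintro ⟨x, y⟩ h
  obtain ⟨j, rfl, i, hij, rfl⟩ := COF.mem_biletters.1 h
  exact ⟨F.pos i j hij, Nat.succ_pos j⟩

theorem COF.count_snd_biletters {lam mu : YoungDiagram} (F : COF lam mu) (j : ℕ) :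
    (F.biletters.map Prod.snd).count (j + 1) = lam.colLen j - mu.colLen j := by
  rw [COF.biletters, List.map_map, count_map_toList]
  rw [← Nat.card_Ico, ← Finset.card_map (s := Finset.Ico _ _)
    ⟨fun i => (i, j), fun _ _ h => (Prod.mk.inj h).1⟩]
  refine congrArg Finset.card ?_
  ext ⟨i, j'⟩
  simp only [Finset.mem_filter, mem_skew_iff, Function.comp_apply, Finset.mem_map,
    Finset.mem_Ico, Nat.add_right_cancel_iff]
  constructor
  · rintro ⟨h, rfl⟩
    exact ⟨i, h, rfl⟩
  · rintro ⟨i, h, heq⟩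
    obtain ⟨rfl, rfl⟩ := Prod.mk.inj heq
    exact ⟨h, rfl⟩

theorem COF.count_fst_biletters {lam mu : YoungDiagram} (F : COF lam mu) (k : ℕ) :
    (F.biletters.map Prod.fst).count k =
      ((lam.cells \ mu.cells).filter fun c => F.entry c.1 c.2 = k).card := by
  rw [COF.biletters, List.map_map, count_map_toList]
  rfl

theorem COF.eq_of_perm_biletters {lam mu : YoungDiagram} {F G : COF lam mu}
    (h : F.biletters.Perm G.biletters) : F = G := by
  refine COF.ext_of_columns fun j x => ?_
  have := h.mem_iff (a := (x, j + 1))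
  simpa only [COF.mem_biletters, Nat.add_right_cancel_iff, exists_eq_left'] using this

theorem COF.exists_biletters_perm {lam mu : YoungDiagram} {C : List (ℕ × ℕ)}
    (hpos : ∀ b ∈ C, 0 < b.1 ∧ 0 < b.2) (hC : C.Nodup)
    (hcount : ∀ j, (C.map Prod.snd).count (j + 1) = lam.colLen j - mu.colLen j) :
    ∃ F : COF lam mu, F.biletters.Perm C := by
  let S : ℕ → Finset ℕ := fun j => (C.toFinset.filter fun b => b.2 = j + 1).image Prod.fst
  have hmem : ∀ j x, x ∈ S j ↔ (x, j + 1) ∈ C := by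
    intro j x
    simp only [S, Finset.mem_image, Finset.mem_filter, List.mem_toFinset, Prod.exists]
    constructor
    · rintro ⟨a, b, ⟨h, rfl⟩, rfl⟩
      exact h
    · intro h
      exact ⟨x, j + 1, ⟨h, rfl⟩, rfl⟩
  have hcard : ∀ j, (S j).card = lam.colLen j - mu.colLen j := by
    intro j
    rw [← hcount j, Finset.card_image_of_injOn]
    · rw [← Multiset.coe_count, ← Multiset.map_coe,
        Multiset.count_map, Finset.card_def, Finset.filter_val, List.toFinset_val, hC.dedup]
      simp only [eq_comm]
    · rintro ⟨x, y⟩ h ⟨x', y'⟩ h' (rfl : x = x')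
      simp only [Finset.coe_filter, Set.mem_ofPred_eq] at h h'
      rw [h.2, h'.2]
  obtain ⟨F, hF⟩ := COF.exists_of_columns (lam := lam) (mu := mu) S hcard
    fun j h => absurd (hpos _ ((hmem j 0).1 h)).1 (lt_irrefl 0)
  refine ⟨F, (List.perm_ext_iff_of_nodup F.nodup_biletters hC).2 ?_⟩
  rintro ⟨x, y⟩
  rw [COF.mem_biletters]
  constructor
  · rintro ⟨j, rfl, h⟩
    exact (hmem j x).1 ((hF j x).1 h)
  · intro h
    obtain ⟨j, rfl⟩ := Nat.exists_eq_succ_of_ne_zero (hpos _ h).2.ne'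
    exact ⟨j, rfl, (hF j x).2 ((hmem j x).2 h)⟩

theorem COF.isCrystalWord {lam mu : YoungDiagram} (F : COF lam mu) :
    IsCrystalWord F.crystalBiword :=
  isCrystalWord_crystalSort F.pos_of_mem_biletters F.nodup_biletters

theorem COF.perm_burgeWord {lam mu : YoungDiagram} (F : COF lam mu) :
    F.burgeWord.Perm F.crystalBiword :=
  (perm_burgeSort _).trans (perm_crystalSort _).symm

theorem COF.isBurge {lam mu : YoungDiagram} (F : COF lam mu) : IsBurge F.burgeWord :=
  ⟨fun b hb => F.pos_of_mem_biletters b ((perm_burgeSort _).mem_iff.1 hb),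
    (perm_burgeSort _).nodup_iff.2 F.nodup_biletters, pairwise_burgeSort _⟩

theorem COF.crystalBiword_injective {lam mu : YoungDiagram} :
    Function.Injective (COF.crystalBiword : COF lam mu → List (ℕ × ℕ)) := fun _ _ h =>
  COF.eq_of_perm_biletters ((perm_crystalSort _).symm.trans
    ((List.Perm.of_eq h).trans (perm_crystalSort _)))

theorem COF.burgeWord_injective {lam mu : YoungDiagram} :
    Function.Injective (COF.burgeWord : COF lam mu → List (ℕ × ℕ)) := fun _ _ h =>
  COF.eq_of_perm_biletters ((perm_burgeSort _).symm.trans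
    ((List.Perm.of_eq h).trans (perm_burgeSort _)))

theorem COF.exists_crystalBiword_eq {lam mu : YoungDiagram} {C : List (ℕ × ℕ)}
    (hC : IsCrystalWord C)
    (hcount : ∀ j, (C.map Prod.snd).count (j + 1) = lam.colLen j - mu.colLen j) :
    ∃ F : COF lam mu, F.crystalBiword = C := by
  obtain ⟨F, hF⟩ := COF.exists_biletters_perm hC.1 hC.pairwise.2 hcount
  exact ⟨F, eq_of_perm_of_pairwise_crystalLE ((perm_crystalSort _).trans hF)
    F.isCrystalWord.pairwise.1 hC.pairwise.1⟩

theorem COF.exists_burgeWord_eq {lam mu : YoungDiagram} {W : List (ℕ × ℕ)} (hW : IsBurge W)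
    (hcount : ∀ j, (W.map Prod.snd).count (j + 1) = lam.colLen j - mu.colLen j) :
    ∃ F : COF lam mu, F.burgeWord = W := by
  obtain ⟨F, hF⟩ := COF.exists_biletters_perm hW.1 hW.2.1 hcount
  exact ⟨F, eq_of_perm_of_pairwise_burgeLE ((perm_burgeSort _).trans hF) F.isBurge.2.2 hW.2.2⟩

theorem COF.count_snd_crystalBiword {lam mu : YoungDiagram} (F : COF lam mu) (j : ℕ) :
    (F.crystalBiword.map Prod.snd).count (j + 1) = lam.colLen j - mu.colLen j := by
  rw [← F.count_snd_biletters j]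
  exact ((perm_crystalSort _).map _).count_eq _

/-! ### The crystal of coinversion-free fillings -/

theorem opIter_eq_some {X : Type*} {g : X → Option X} {r : X → ℕ}
    (h : ∀ x y, g x = some y → r x = r y + 1) {k : ℕ} {x y : X} (hk : opIter g k x = some y) :
    r x = r y + k := by
  induction k generalizing y with
  | zero =>
    obtain rfl : x = y := by simpa [opIter] using hk
    rfl
  | succ k ih =>
    obtain ⟨z, hz, hzy⟩ := Option.bind_eq_some_iff.1 hk
    have h1 := ih hz
    have h2 := h z y hzy
    omega

/-- If a rank drops by one with every application of a partial operator, and the operator is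
undefined exactly in rank zero, then the rank counts the possible applications. -/
theorem isGreatest_opIter {X : Type*} {g : X → Option X} {r : X → ℕ}
    (h : ∀ x y, g x = some y → r x = r y + 1) (h0 : ∀ x, r x ≠ 0 → g x ≠ none) (x : X) :
    IsGreatest {k | opIter g k x ≠ none} (r x) := by
  have key : ∀ k ≤ r x, opIter g k x ≠ none := by
    intro k
    induction k with
    | zero => simp [opIter]
    | succ k ih =>
      intro hk
      obtain ⟨y, hy⟩ := Option.ne_none_iff_exists'.1 (ih (by omega))
      have := opIter_eq_some h hy
      rw [opIter, hy]
      exact h0 y (by omega)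
  refine ⟨key _ le_rfl, fun k hk => ?_⟩
  obtain ⟨y, hy⟩ := Option.ne_none_iff_exists'.1 hk
  have := opIter_eq_some h hy
  omega

theorem COF.raise_eq_some {lam mu : YoungDiagram} {i : ℕ} {F G : COF lam mu} :
    F.raise i = some G ↔ topE i F.crystalBiword = some G.crystalBiword := by
  simp only [COF.raise, Option.bind_eq_some_iff, COF.crystalBiword_injective.isPartialInv _ _]
  constructor
  · rintro ⟨V, h, rfl⟩
    exact h
  · intro h
    exact ⟨_, h, rfl⟩

theorem COF.lower_eq_some {lam mu : YoungDiagram} {i : ℕ} {F G : COF lam mu} :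
    F.lower i = some G ↔ topF i F.crystalBiword = some G.crystalBiword := by
  simp only [COF.lower, Option.bind_eq_some_iff, COF.crystalBiword_injective.isPartialInv _ _]
  constructor
  · rintro ⟨V, h, rfl⟩
    exact h
  · intro h
    exact ⟨_, h, rfl⟩

theorem COF.map_raise {lam mu : YoungDiagram} {i : ℕ} (hi : 1 ≤ i) (F : COF lam mu) :
    (F.raise i).map COF.crystalBiword = topE i F.crystalBiword := by
  rcases h : topE i F.crystalBiword with _ | V
  · simp [COF.raise, h]
  · obtain ⟨h1, h2⟩ := topE_eq_some.1 h
    obtain ⟨G, rfl⟩ := COF.exists_crystalBiword_eq (lam := lam) (mu := mu)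
      (F.isCrystalWord.raises hi h1 h2) fun j => by rw [h1, F.count_snd_crystalBiword]
    rw [COF.raise_eq_some.2 h, Option.map_some]

theorem COF.map_lower {lam mu : YoungDiagram} (i : ℕ) (F : COF lam mu) :
    (F.lower i).map COF.crystalBiword = topF i F.crystalBiword := by
  rcases h : topF i F.crystalBiword with _ | V
  · simp [COF.lower, h]
  · obtain ⟨h1, h2⟩ := topF_eq_some.1 h
    obtain ⟨G, rfl⟩ := COF.exists_crystalBiword_eq (lam := lam) (mu := mu)
      (F.isCrystalWord.lowers h1 h2) fun j => by rw [h1, F.count_snd_crystalBiword]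
    rw [COF.lower_eq_some.2 h, Option.map_some]

theorem COF.raise_eq_none {lam mu : YoungDiagram} {i : ℕ} (hi : 1 ≤ i) {F : COF lam mu} :
    F.raise i = none ↔ topE i F.crystalBiword = none := by
  rw [← F.map_raise hi, Option.map_eq_none_iff]

theorem COF.lower_eq_none {lam mu : YoungDiagram} {i : ℕ} {F : COF lam mu} :
    F.lower i = none ↔ topF i F.crystalBiword = none := by
  rw [← F.map_lower i, Option.map_eq_none_iff]

theorem COF.raise_eq_some_iff_raises {lam mu : YoungDiagram} {i : ℕ} {F G : COF lam mu} :
    F.raise i = some G ↔ G.crystalBiword.map Prod.snd = F.crystalBiword.map Prod.snd ∧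
      Raises i (F.crystalBiword.map Prod.fst) (G.crystalBiword.map Prod.fst) :=
  COF.raise_eq_some.trans topE_eq_some

theorem COF.raise_eq_some_iff_lower {lam mu : YoungDiagram} {i : ℕ} {F G : COF lam mu} :
    F.raise i = some G ↔ G.lower i = some F := by
  rw [COF.raise_eq_some_iff_raises, COF.lower_eq_some, topF_eq_some, eq_comm]

theorem COF.wt_eq_count {lam mu : YoungDiagram} (F : COF lam mu) (k : ℕ) :
    (cofCrystal lam mu).wt F k = (F.crystalBiword.map Prod.fst).count k := by
  rw [COF.crystalBiword, ((perm_crystalSort F.biletters).map Prod.fst).count_eq k,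
    COF.count_fst_biletters]
  rfl

theorem isCrystal_cofCrystal (lam mu : YoungDiagram) : IsCrystal (cofCrystal lam mu) where
  e_iff_f _ _ _ _ := COF.raise_eq_some_iff_lower
  wt_e i _ F G h := by
    obtain ⟨h1, h2⟩ := COF.raise_eq_some_iff_raises.1 h
    obtain ⟨A, B, y, hF, hG, -, -⟩ := exists_of_raises_biword h1 h2
    funext k
    rw [Pi.sub_apply, Pi.add_apply, COF.wt_eq_count, COF.wt_eq_count, hF, hG]
    simp only [List.map_append, List.map_cons, List.count_append, List.count_cons,
      Pi.single_apply, beq_iff_eq, eq_comm (a := k)]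
    push_cast
    ring
  string i hi F := by
    refine ⟨eps i (F.crystalBiword.map Prod.fst), phi i (F.crystalBiword.map Prod.fst), ?_, ?_, ?_⟩
    · refine isGreatest_opIter (r := fun F : COF lam mu => eps i (F.crystalBiword.map Prod.fst))
        (fun F G h => ?_) (fun F h hn => ?_) F
      · exact (COF.raise_eq_some_iff_raises.1 h).2.eps_phi.1
      · exact h (topE_eq_none.1 ((COF.raise_eq_none hi).1 hn))
    · refine isGreatest_opIter (r := fun F : COF lam mu => phi i (F.crystalBiword.map Prod.fst))
        (fun F G h => ?_) (fun F h hn => ?_) F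
      · exact (COF.raise_eq_some_iff_raises.1
          (COF.raise_eq_some_iff_lower.2 h)).2.eps_phi.2
      · exact h (topF_eq_none.1 (COF.lower_eq_none.1 hn))
    · rw [phi_sub_eps, COF.wt_eq_count, COF.wt_eq_count]

/-- The raising operator on fillings fixes the insertion tableau and raises the recording
tableau. -/
theorem COF.rsk_of_raise {lam mu : YoungDiagram} {i : ℕ} {F G : COF lam mu}
    (h : F.raise i = some G) :
    G.insTab = F.insTab ∧
      tabE i (transposeRows F.recTab) = some (transposeRows G.recTab) ∧
      tabF i (transposeRows G.recTab) = some (transposeRows F.recTab) ∧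
      recE i F.recTab = some G.recTab ∧ recF i G.recTab = some F.recTab := by
  obtain ⟨h1, h2⟩ := COF.raise_eq_some_iff_raises.1 h
  exact rsk_of_raises F.isBurge G.isBurge F.isCrystalWord.pairwise.1 G.isCrystalWord.pairwise.1
    F.perm_burgeWord.symm G.perm_burgeWord.symm h1 h2

/-! ### Semistandard tableaux as lists of rows -/

theorem mem_iff_of_map_length_eq {nu : YoungDiagram} {P : List (List ℕ)}
    (h : P.map List.length = nu.rowLens) (i j : ℕ) :
    (i, j) ∈ nu ↔ j < (P.getD i []).length := by
  have hl : P.length = nu.colLen 0 := by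
    rw [← YoungDiagram.length_rowLens, ← h, List.length_map]
  rcases lt_or_ge i P.length with hi | hi
  · have h1 : (P.map List.length)[i]'(by simpa using hi) = nu.rowLen i := by
      rw [← YoungDiagram.get_rowLens (h := by simpa [hl] using hi)]
      simp only [h]
    rw [List.getElem_map] at h1
    rw [List.getD_eq_getElem _ _ hi, h1, YoungDiagram.mem_iff_lt_rowLen]
  · rw [List.getD_eq_default _ _ hi]
    simp only [List.length_nil, not_lt_zero, iff_false]
    intro hm
    have := YoungDiagram.mem_iff_lt_colLen.1 (nu.up_left_mem le_rfl (Nat.zero_le j) hm)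
    omega

theorem map_length_eq_of_mem_iff {nu : YoungDiagram} {P : List (List ℕ)}
    (hP : ∀ r ∈ P, r ≠ []) (h : ∀ i j, (i, j) ∈ nu ↔ j < (P.getD i []).length) :
    P.map List.length = nu.rowLens := by
  have hl : P.length = nu.colLen 0 := by
    refine eq_of_forall_lt_iff fun i => ?_
    rw [← YoungDiagram.mem_iff_lt_colLen, h i 0]
    rcases lt_or_ge i P.length with hi | hi
    · rw [List.getD_eq_getElem _ _ hi]
      exact iff_of_true hi (List.length_pos_iff.2 (hP _ (List.getElem_mem hi)))
    · rw [List.getD_eq_default _ _ hi]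
      simpa using hi
  refine List.ext_getElem (by rw [List.length_map, YoungDiagram.length_rowLens, hl]) ?_
  intro i h1 h2
  rw [List.length_map] at h1
  rw [List.getElem_map, YoungDiagram.get_rowLens]
  refine eq_of_forall_lt_iff fun j => ?_
  rw [← YoungDiagram.mem_iff_lt_rowLen, h i j, List.getD_eq_getElem _ _ h1]

theorem eq_of_rowLens_eq {nu nu' : YoungDiagram} (h : nu.rowLens = nu'.rowLens) : nu = nu' :=
  YoungDiagram.equivListRowLens.injective (Subtype.ext h)

theorem IsTab.exists_rowLens {d : ℕ} {P : List (List ℕ)} (h : IsTab d P) :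
    ∃ nu : YoungDiagram, P.map List.length = nu.rowLens := by
  have h1 : (P.map List.length).SortedGE :=
    List.sortedGE_iff_pairwise.2 (List.pairwise_map.2 h.pairwise_length)
  refine ⟨.ofRowLens _ h1, (YoungDiagram.rowLens_ofRowLens_eq_self ?_).symm⟩
  intro x hx
  obtain ⟨r, hr, rfl⟩ := List.mem_map.1 hx
  exact List.length_pos_iff.2 (h.ne_nil r hr)

theorem getElem?_getD_transposed {Q : List (List ℕ)}
    (h : Q.Pairwise fun r s => s.length ≤ r.length) (i j : ℕ) :
    ((transposed Q).getD j [])[i]? = (Q.getD i [])[j]? := by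
  induction Q generalizing i with
  | nil => simp [transposed]
  | cons q Q ih =>
    rw [List.pairwise_cons] at h
    rw [transposed_cons, List.getD_eq_getElem?_getD, getElem?_consCol]
    rcases hj : q[j]? with _ | a
    · rcases i with _ | i
      · simp [hj]
      · have hq : (Q.getD i []).length ≤ q.length := by
          rcases lt_or_ge i Q.length with hi | hi
          · rw [List.getD_eq_getElem _ _ hi]
            exact h.1 _ (List.getElem_mem hi)
          · rw [List.getD_eq_default _ _ hi]
            exact Nat.zero_le _
        rw [List.getD_cons_succ, List.getElem?_eq_none (hq.trans (List.getElem?_eq_none_iff.1 hj))]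
        rfl
    · rcases i with _ | i
      · simp [hj]
      · simpa using ih h.2 i

theorem map_length_transposeRows {d : ℕ} (hd : d ≤ 1) {Q : List (List ℕ)} (h : IsTab d Q)
    {nu : YoungDiagram} (hQ : Q.map List.length = nu.rowLens) :
    (transposeRows Q).map List.length = nu.transpose.rowLens := by
  refine map_length_eq_of_mem_iff (h.isTab_transposeRows (e := 1 - d) (by omega)).ne_nil ?_
  intro i j
  rw [YoungDiagram.mem_transpose, Prod.swap_prod_mk, mem_iff_of_map_length_eq hQ,
    h.transposeRows_eq, ← not_le, ← not_le, ← List.getElem?_eq_none_iff,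
    ← List.getElem?_eq_none_iff,
    getElem?_getD_transposed h.pairwise_length]

theorem flatten_transposeRows_perm {d : ℕ} {Q : List (List ℕ)} (h : IsTab d Q) :
    (transposeRows Q).flatten.Perm Q.flatten := by
  rw [h.transposeRows_eq]
  exact flatten_transposed_perm (f := id) h (by simp)

theorem PosSSYT.map_length_rows {nu : YoungDiagram} (T : PosSSYT nu) :
    T.rows.map List.length = nu.rowLens := by
  simp [PosSSYT.rows, YoungDiagram.rowLens, Function.comp_def]

theorem PosSSYT.getElem?_rows {nu : YoungDiagram} (T : PosSSYT nu) (i j : ℕ) :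
    (T.rows.getD i [])[j]? = if (i, j) ∈ nu then some (T.1 i j) else none := by
  split_ifs with h
  · have h1 := YoungDiagram.mem_iff_lt_colLen.1 (nu.up_left_mem le_rfl (Nat.zero_le j) h)
    have h2 := YoungDiagram.mem_iff_lt_rowLen.1 h
    simp [PosSSYT.rows, List.getD_eq_getElem?_getD, h1, h2]
  · rw [List.getElem?_eq_none_iff, ← not_lt, ← mem_iff_of_map_length_eq T.map_length_rows]
    exact h

theorem PosSSYT.rows_injective {nu : YoungDiagram} :
    Function.Injective (PosSSYT.rows : PosSSYT nu → List (List ℕ)) := by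
  intro T T' h
  refine Subtype.ext (SemistandardYoungTableau.ext fun i j => ?_)
  by_cases hij : (i, j) ∈ nu
  · have h1 := T.getElem?_rows i j
    rw [h, T'.getElem?_rows, if_pos hij, if_pos hij] at h1
    exact (Option.some.inj h1).symm
  · rw [T.1.zeros hij, T'.1.zeros hij]

theorem PosSSYT.isTab_rows {nu : YoungDiagram} (T : PosSSYT nu) : IsTab 0 T.rows := by
  refine ⟨?_, ?_, ?_⟩
  · intro r hr
    have h1 : r.length ∈ nu.rowLens := by
      rw [← T.map_length_rows]
      exact List.mem_map_of_mem hr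
    exact List.length_pos_iff.1 (nu.pos_of_mem_rowLens _ h1)
  · intro r hr
    obtain ⟨i, -, rfl⟩ := List.mem_map.1 hr
    rw [SortedRow, List.pairwise_map]
    refine List.pairwise_lt_range.imp_of_mem fun {j j'} _ hj' hlt => ?_
    exact T.1.row_weak hlt (YoungDiagram.mem_iff_lt_rowLen.2 (List.mem_range.1 hj'))
  · rw [PosSSYT.rows, List.isChain_map, List.isChain_range]
    intro i _ j b hj
    rw [List.getElem?_map, Option.map_eq_some_iff] at hj
    obtain ⟨j', hj', rfl⟩ := hj
    obtain ⟨hlt, rfl⟩ := List.getElem?_eq_some_iff.1 hj'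
    rw [List.length_range] at hlt
    rw [List.getElem_range]
    have h1 := YoungDiagram.mem_iff_lt_rowLen.2 hlt
    have h2 := YoungDiagram.mem_iff_lt_rowLen.1 (nu.up_left_mem (Nat.le_succ i) le_rfl h1)
    exact ⟨T.1 i j, by simp [h2], T.1.col_strict (Nat.lt_succ_self i) h1⟩

theorem PosSSYT.flatten_rows_perm {nu : YoungDiagram} (T : PosSSYT nu) :
    T.rows.flatten.Perm (nu.cells.toList.map fun c => T.1 c.1 c.2) := by
  have h : T.rows.flatten = ((List.range (nu.colLen 0)).flatMap fun i =>
      (List.range (nu.rowLen i)).map fun j => (i, j)).map fun c => T.1 c.1 c.2 := by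
    rw [List.map_flatMap, List.flatMap_def, PosSSYT.rows]
    simp [Function.comp_def]
  rw [h]
  refine List.Perm.map _ ((List.perm_ext_iff_of_nodup ?_ (Finset.nodup_toList _)).2 ?_)
  · rw [List.nodup_flatMap]
    refine ⟨fun i _ => List.nodup_range.map fun _ _ h => (Prod.mk.inj h).2, ?_⟩
    refine List.pairwise_lt_range.imp fun {i i'} hlt => ?_
    rw [Function.onFun, List.disjoint_left]
    simp only [List.mem_map]
    rintro _ ⟨j, -, rfl⟩ ⟨j', -, h⟩
    exact hlt.ne' (Prod.mk.inj h).1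
  · rintro ⟨i, j⟩
    simp only [List.mem_flatMap, List.mem_range, List.mem_map, Prod.mk.injEq, Finset.mem_toList,
      YoungDiagram.mem_cells]
    constructor
    · rintro ⟨i, -, j, hj, rfl, rfl⟩
      exact YoungDiagram.mem_iff_lt_rowLen.2 hj
    · intro h
      exact ⟨i, YoungDiagram.mem_iff_lt_colLen.1 (nu.up_left_mem le_rfl (Nat.zero_le j) h), j,
        YoungDiagram.mem_iff_lt_rowLen.1 h, rfl, rfl⟩

theorem PosSSYT.content_eq_count {nu : YoungDiagram} (T : PosSSYT nu) (k : ℕ) :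
    T.content k = T.rows.flatten.count k := by
  rw [T.flatten_rows_perm.count_eq, count_map_toList]
  rfl

theorem PosSSYT.pos_of_mem_flatten_rows {nu : YoungDiagram} (T : PosSSYT nu) :
    ∀ p ∈ T.rows.flatten, 0 < p := by
  intro p hp
  obtain ⟨⟨i, j⟩, h, rfl⟩ := List.mem_map.1 (T.flatten_rows_perm.mem_iff.1 hp)
  exact T.2 i j (YoungDiagram.mem_cells _ |>.1 (Finset.mem_toList.1 h))

theorem PosSSYT.exists_rows_eq {nu : YoungDiagram} {P : List (List ℕ)} (h : IsTab 0 P)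
    (hl : P.map List.length = nu.rowLens) (hpos : ∀ p ∈ P.flatten, 0 < p) :
    ∃ T : PosSSYT nu, T.rows = P := by
  let E : ℕ → ℕ → ℕ := fun i j => ((P.getD i [])[j]?).getD 0
  have hE : ∀ i j, (i, j) ∈ nu → (P.getD i [])[j]? = some (E i j) := by
    intro i j hij
    have := (mem_iff_of_map_length_eq hl i j).1 hij
    simp only [E]
    rw [List.getElem?_eq_getElem this, Option.getD_some]
  have hE0 : ∀ i j, (i, j) ∉ nu → (P.getD i [])[j]? = none := by
    intro i j hij
    rw [List.getElem?_eq_none_iff]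
    exact not_lt.1 fun hlt => hij ((mem_iff_of_map_length_eq hl i j).2 hlt)
  have hstep : ∀ i j, (i + 1, j) ∈ nu → E i j < E (i + 1) j := by
    intro i j hij
    have h1 := YoungDiagram.mem_iff_lt_colLen.1 (nu.up_left_mem le_rfl (Nat.zero_le j) hij)
    have h2 : P.length = nu.colLen 0 := by
      rw [← YoungDiagram.length_rowLens, ← hl, List.length_map]
    have h3 := List.isChain_iff_getElem.1 h.chain i (by omega)
    have h4 := hE _ _ hij
    rw [List.getD_eq_getElem _ _ (by omega)] at h4
    obtain ⟨a, ha, hlt⟩ := h3 j _ h4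
    have h5 := hE i j (nu.up_left_mem (Nat.le_succ i) le_rfl hij)
    rw [List.getD_eq_getElem _ _ (by omega), ha] at h5
    rw [← Option.some.inj h5]
    exact hlt
  let T : SemistandardYoungTableau nu :=
    { entry := E
      row_weak' := by
        intro i j j' hlt hij
        have h1 := (mem_iff_of_map_length_eq hl i j').1 hij
        have h2 := hE i j (nu.up_left_mem le_rfl hlt.le hij)
        have h3 := hE i j' hij
        have hi : i < P.length := by
          by_contra hi
          rw [List.getD_eq_default _ _ (not_lt.1 hi)] at h1
          simp at h1
        rw [List.getD_eq_getElem _ _ hi] at h1 h2 h3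
        have h4 := List.pairwise_iff_getElem.1 (h.sorted _ (List.getElem_mem hi)) j j'
          (by omega) h1 hlt
        rw [List.getElem?_eq_getElem (by omega)] at h2 h3
        rw [← Option.some.inj h2, ← Option.some.inj h3]
        exact h4
      col_strict' := by
        intro i i' j hlt hij
        induction i', hlt using Nat.le_induction with
        | base => exact hstep i j hij
        | succ i' _ ih =>
          exact (ih (nu.up_left_mem (Nat.le_succ i') le_rfl hij)).trans (hstep i' j hij)
      zeros' := by
        intro i j hij
        simp only [E]
        rw [hE0 i j hij, Option.getD_none] }
  refine ⟨⟨T, fun i j hij => hpos _ (mem_flatten_of_mem_getD (j := i) ?_)⟩, ?_⟩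
  · exact List.mem_of_getElem? (hE i j hij)
  · set T' : PosSSYT nu := ⟨T, _⟩ with hT'
    have hlen : T'.rows.length = P.length := by
      rw [← List.length_map (f := List.length), T'.map_length_rows, ← hl, List.length_map]
    refine List.ext_getElem hlen fun i h1 h2 => ?_
    refine List.ext_getElem? fun j => ?_
    have h3 := T'.getElem?_rows i j
    rw [List.getD_eq_getElem _ _ h1] at h3
    rw [h3, ← List.getD_eq_getElem _ [] h2]
    split_ifs with hij
    · exact (hE i j hij).symm
    · exact (hE0 i j hij).symm

/-! ### The isomorphism with tableau crystals -/

/-- The filling `F` corresponds to the pair `x` of tableaux: the first one is the insertion tableau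
and the second one the transpose of the recording tableau. -/
def COF.Corresponds {lam mu : YoungDiagram} (F : COF lam mu)
    (x : Σ nu : YoungDiagram, ColumnContentSSYT lam mu nu × PosSSYT nu.transpose) : Prop :=
  x.2.1.1.rows = F.insTab ∧ x.2.2.rows = transposeRows F.recTab

theorem COF.map_length_recTab {lam mu : YoungDiagram} (F : COF lam mu) :
    F.recTab.map List.length = F.insTab.map List.length := (map_length_rsk _).symm

theorem COF.pos_of_mem_recTab {lam mu : YoungDiagram} (F : COF lam mu) :
    ∀ p ∈ F.recTab.flatten, 0 < p := by
  intro p hp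
  obtain ⟨b, hb, rfl⟩ := List.mem_map.1 ((flatten_rsk_perm _).2.mem_iff.1 hp)
  exact (F.isBurge.1 b hb).1

theorem COF.isTab_recTab {lam mu : YoungDiagram} (F : COF lam mu) : IsTab 1 F.recTab :=
  (isTab_rsk F.isBurge).2

/-- The transposed recording tableau is a semistandard tableau of the transposed shape. -/
theorem COF.exists_rows_eq_transposeRows_recTab {lam mu nu : YoungDiagram} (F : COF lam mu)
    (h : F.insTab.map List.length = nu.rowLens) :
    ∃ T : PosSSYT nu.transpose, T.rows = transposeRows F.recTab := by
  have hQ := F.isTab_recTab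
  refine PosSSYT.exists_rows_eq (hQ.isTab_transposeRows rfl)
    (map_length_transposeRows le_rfl hQ (F.map_length_recTab.trans h)) fun p hp => ?_
  exact F.pos_of_mem_recTab p ((flatten_transposeRows_perm hQ).mem_iff.1 hp)

theorem COF.exists_corresponds {lam mu : YoungDiagram} (F : COF lam mu) :
    ∃ x, F.Corresponds x := by
  have hP := (isTab_rsk F.isBurge).1
  obtain ⟨nu, hnu⟩ := hP.exists_rowLens
  have hperm := (flatten_rsk_perm F.burgeWord).1
  obtain ⟨P, hPr⟩ := PosSSYT.exists_rows_eq hP hnu fun p hp => by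
    obtain ⟨b, hb, rfl⟩ := List.mem_map.1 (hperm.mem_iff.1 hp)
    exact (F.isBurge.1 b hb).2
  obtain ⟨T, hT⟩ := F.exists_rows_eq_transposeRows_recTab hnu
  refine ⟨⟨nu, ⟨P, fun j => ?_⟩, T⟩, hPr, hT⟩
  rw [P.content_eq_count, hPr, hperm.count_eq, ← F.count_snd_biletters j]
  exact ((perm_burgeSort _).map _).count_eq _

theorem COF.Corresponds.right_unique {lam mu : YoungDiagram} {F : COF lam mu}
    {x x' : Σ nu : YoungDiagram, ColumnContentSSYT lam mu nu × PosSSYT nu.transpose}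
    (h : F.Corresponds x) (h' : F.Corresponds x') : x = x' := by
  obtain ⟨nu, P, T⟩ := x
  obtain ⟨nu', P', T'⟩ := x'
  obtain ⟨h1, h2⟩ := h
  obtain ⟨h1', h2'⟩ := h'
  dsimp only at h1 h2 h1' h2'
  obtain rfl : nu = nu' :=
    eq_of_rowLens_eq (by rw [← P.1.map_length_rows, ← P'.1.map_length_rows, h1, h1'])
  obtain rfl : P = P' := Subtype.ext (PosSSYT.rows_injective (h1.trans h1'.symm))
  obtain rfl : T = T' := PosSSYT.rows_injective (h2.trans h2'.symm)
  rfl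

theorem COF.Corresponds.recTab_eq {lam mu : YoungDiagram} {F : COF lam mu}
    {x : Σ nu : YoungDiagram, ColumnContentSSYT lam mu nu × PosSSYT nu.transpose}
    (h : F.Corresponds x) : F.recTab = transposeRows x.2.2.rows := by
  rw [h.2, transposeRows_transposeRows le_rfl F.isTab_recTab]

theorem COF.Corresponds.left_unique {lam mu : YoungDiagram} {F G : COF lam mu}
    {x : Σ nu : YoungDiagram, ColumnContentSSYT lam mu nu × PosSSYT nu.transpose}
    (hF : F.Corresponds x) (hG : G.Corresponds x) : F = G :=
  COF.burgeWord_injective (rsk_injective F.isBurge G.isBurge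
    (Prod.ext (hF.1.symm.trans hG.1) (hF.recTab_eq.trans hG.recTab_eq.symm)))

theorem COF.corresponds_surjective {lam mu : YoungDiagram}
    (x : Σ nu : YoungDiagram, ColumnContentSSYT lam mu nu × PosSSYT nu.transpose) :
    ∃ F : COF lam mu, F.Corresponds x := by
  obtain ⟨nu, ⟨P, hP⟩, T⟩ := x
  have hT := T.isTab_rows
  have hl := map_length_transposeRows (Nat.zero_le 1) hT T.map_length_rows
  rw [YoungDiagram.transpose_transpose] at hl
  obtain ⟨W, hW, hrsk⟩ := exists_rsk_eq P.isTab_rows (hT.isTab_transposeRows (e := 1) rfl)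
    (P.map_length_rows.trans hl.symm) P.pos_of_mem_flatten_rows
    fun p hp => T.pos_of_mem_flatten_rows p ((flatten_transposeRows_perm hT).mem_iff.1 hp)
  obtain ⟨F, rfl⟩ := COF.exists_burgeWord_eq (lam := lam) (mu := mu) hW fun j => by
    rw [← (flatten_rsk_perm W).1.count_eq, hrsk, ← P.content_eq_count, hP]
  refine ⟨F, (congrArg Prod.fst hrsk).symm, ?_⟩
  change T.rows = transposeRows (rsk F.burgeWord).2
  rw [hrsk, transposeRows_transposeRows (Nat.zero_le 1) hT]

theorem COF.Corresponds.wt_eq {lam mu : YoungDiagram} {F : COF lam mu}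
    {x : Σ nu : YoungDiagram, ColumnContentSSYT lam mu nu × PosSSYT nu.transpose}
    (h : F.Corresponds x) : (cofCrystal lam mu).wt F = (tableauCrystal _).wt x.2.2 := by
  funext k
  rw [COF.wt_eq_count]
  change _ = ((x.2.2.content k : ℕ) : ℤ)
  rw [PosSSYT.content_eq_count, h.2,
    (flatten_transposeRows_perm F.isTab_recTab).count_eq,
    COF.recTab, (flatten_rsk_perm F.burgeWord).2.count_eq, (F.perm_burgeWord.map _).count_eq]

theorem partialInv_rows {nu : YoungDiagram} (T : PosSSYT nu) :
    Function.partialInv PosSSYT.rows T.rows = some T :=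
  Function.partialInv_left PosSSYT.rows_injective T

theorem COF.Corresponds.raise {lam mu : YoungDiagram} {i : ℕ} {F G : COF lam mu}
    {x : Σ nu : YoungDiagram, ColumnContentSSYT lam mu nu × PosSSYT nu.transpose}
    (h : F.Corresponds x) (hG : F.raise i = some G) :
    ∃ T, (tableauCrystal _).e i x.2.2 = some T ∧ G.Corresponds ⟨x.1, x.2.1, T⟩ := by
  obtain ⟨h1, h2, -⟩ := COF.rsk_of_raise hG
  obtain ⟨T, hT⟩ := G.exists_rows_eq_transposeRows_recTab (nu := x.1)
    (by rw [h1, ← h.1, x.2.1.1.map_length_rows])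
  refine ⟨T, ?_, h.1.trans h1.symm, hT⟩
  change (tabE i x.2.2.rows).bind (Function.partialInv PosSSYT.rows) = some T
  rw [h.2, h2, ← hT, Option.bind_some, partialInv_rows]

theorem COF.Corresponds.lower {lam mu : YoungDiagram} {i : ℕ} {F G : COF lam mu}
    {x : Σ nu : YoungDiagram, ColumnContentSSYT lam mu nu × PosSSYT nu.transpose}
    (h : F.Corresponds x) (hG : F.lower i = some G) :
    ∃ T, (tableauCrystal _).f i x.2.2 = some T ∧ G.Corresponds ⟨x.1, x.2.1, T⟩ := by
  obtain ⟨h1, -, h2, -⟩ := COF.rsk_of_raise (COF.raise_eq_some_iff_lower.2 hG)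
  obtain ⟨T, hT⟩ := G.exists_rows_eq_transposeRows_recTab (nu := x.1)
    (by rw [← h1, ← h.1, x.2.1.1.map_length_rows])
  refine ⟨T, ?_, h.1.trans h1, hT⟩
  change (tabF i x.2.2.rows).bind (Function.partialInv PosSSYT.rows) = some T
  rw [h.2, h2, ← hT, Option.bind_some, partialInv_rows]

theorem COF.Corresponds.e_eq_none {lam mu : YoungDiagram} {i : ℕ} (hi : 1 ≤ i) {F : COF lam mu}
    {x : Σ nu : YoungDiagram, ColumnContentSSYT lam mu nu × PosSSYT nu.transpose}
    (h : F.Corresponds x) (hF : F.raise i = none) : (tableauCrystal _).e i x.2.2 = none := by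
  change (tabE i x.2.2.rows).bind (Function.partialInv PosSSYT.rows) = none
  rw [h.2, COF.recTab, (tab_rsk_eq_none F.isBurge F.isCrystalWord.pairwise.1
    F.perm_burgeWord.symm).1.2 ((COF.raise_eq_none hi).1 hF), Option.bind_none]

theorem COF.Corresponds.f_eq_none {lam mu : YoungDiagram} {i : ℕ} {F : COF lam mu}
    {x : Σ nu : YoungDiagram, ColumnContentSSYT lam mu nu × PosSSYT nu.transpose}
    (h : F.Corresponds x) (hF : F.lower i = none) : (tableauCrystal _).f i x.2.2 = none := by
  change (tabF i x.2.2.rows).bind (Function.partialInv PosSSYT.rows) = none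
  rw [h.2, COF.recTab, (tab_rsk_eq_none F.isBurge F.isCrystalWord.pairwise.1
    F.perm_burgeWord.symm).2.2 (COF.lower_eq_none.1 hF), Option.bind_none]

/-- RSK as a bijection from fillings to pairs of semistandard tableaux. -/
theorem COF.exists_equiv (lam mu : YoungDiagram) :
    ∃ Φ : COF lam mu ≃ (Σ nu : YoungDiagram, ColumnContentSSYT lam mu nu × PosSSYT nu.transpose),
      ∀ F : COF lam mu, F.Corresponds (Φ F) := by
  choose φ hφ using COF.exists_corresponds (lam := lam) (mu := mu)
  refine ⟨Equiv.ofBijective φ ⟨fun F G h => ?_, fun x => ?_⟩, hφ⟩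
  · exact (hφ F).left_unique (h ▸ hφ G)
  · obtain ⟨F, hF⟩ := COF.corresponds_surjective x
    exact ⟨F, (hφ F).right_unique hF⟩

theorem mainTheorem10 (lam mu : YoungDiagram) (hmu : mu ≤ lam) :
    -- the crystal operators on fillings are well defined by the operators on crystal biwords
    (Function.Injective (COF.crystalBiword : COF lam mu → List (ℕ × ℕ)) ∧
      ∀ i, 1 ≤ i → ∀ F : COF lam mu,
        (F.raise i).map COF.crystalBiword = topE i F.crystalBiword ∧
        (F.lower i).map COF.crystalBiword = topF i F.crystalBiword) ∧
    -- they fix the insertion tableau and act as crystal operators on the recording tableau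
    (∀ i, 1 ≤ i → ∀ F : COF lam mu,
      (∀ G, F.raise i = some G →
        G.insTab = F.insTab ∧ recE i F.recTab = some G.recTab) ∧
      (F.raise i = none → recE i F.recTab = none) ∧
      (∀ G, F.lower i = some G →
        G.insTab = F.insTab ∧ recF i F.recTab = some G.recTab) ∧
      (F.lower i = none → recF i F.recTab = none)) ∧
    -- the same for Burge words
    (∀ i, 1 ≤ i → ∀ W : List (ℕ × ℕ), IsBurge W →
      (∀ V, topE i (crystalSort W) = some V →
        IsBurge (burgeSort V) ∧ (rsk (burgeSort V)).1 = (rsk W).1 ∧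
          recE i (rsk W).2 = some (rsk (burgeSort V)).2) ∧
      (topE i (crystalSort W) = none → recE i (rsk W).2 = none) ∧
      (∀ V, topF i (crystalSort W) = some V →
        IsBurge (burgeSort V) ∧ (rsk (burgeSort V)).1 = (rsk W).1 ∧
          recF i (rsk W).2 = some (rsk (burgeSort V)).2) ∧
      (topF i (crystalSort W) = none → recF i (rsk W).2 = none)) ∧
    -- the fillings form a crystal, isomorphic through RSK to a disjoint union of tableau crystals
    IsCrystal (cofCrystal lam mu) ∧
    ∃ Φ : COF lam mu ≃ (Σ nu : YoungDiagram, ColumnContentSSYT lam mu nu × PosSSYT nu.transpose),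
      ∀ F : COF lam mu,
        F.insTab = (Φ F).2.1.1.rows ∧
        F.recTab = transposeRows (Φ F).2.2.rows ∧
        (cofCrystal lam mu).wt F = (tableauCrystal _).wt (Φ F).2.2 ∧
        ∀ i, 1 ≤ i →
          ((cofCrystal lam mu).e i F).map Φ =
            ((tableauCrystal _).e i (Φ F).2.2).map (fun T => ⟨(Φ F).1, (Φ F).2.1, T⟩) ∧
          ((cofCrystal lam mu).f i F).map Φ =
            ((tableauCrystal _).f i (Φ F).2.2).map (fun T => ⟨(Φ F).1, (Φ F).2.1, T⟩) := by
  refine ⟨⟨COF.crystalBiword_injective, fun i hi F => ⟨F.map_raise hi, F.map_lower i⟩⟩,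
    fun i hi F => ⟨?_, ?_, ?_, ?_⟩, fun i hi W hW => ⟨?_, ?_, ?_, ?_⟩,
    isCrystal_cofCrystal lam mu, ?_⟩
  · intro G h
    obtain ⟨h1, -, -, h2, -⟩ := COF.rsk_of_raise h
    exact ⟨h1, h2⟩
  · intro h
    exact (rec_rsk_eq_none F.isBurge F.isCrystalWord.pairwise.1 F.perm_burgeWord.symm).1.2
      ((COF.raise_eq_none hi).1 h)
  · intro G h
    obtain ⟨h1, -, -, -, h2⟩ := COF.rsk_of_raise (COF.raise_eq_some_iff_lower.2 h)
    exact ⟨h1.symm, h2⟩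
  · intro h
    exact (rec_rsk_eq_none F.isBurge F.isCrystalWord.pairwise.1 F.perm_burgeWord.symm).2.2
      (COF.lower_eq_none.1 h)
  · intro V h
    exact rsk_topE hi hW h
  · exact (rec_rsk_eq_none hW (pairwise_crystalSort W) (perm_crystalSort W)).1.2
  · intro V h
    exact rsk_topF hW h
  · exact (rec_rsk_eq_none hW (pairwise_crystalSort W) (perm_crystalSort W)).2.2
  · obtain ⟨Φ, hΦ⟩ := COF.exists_equiv lam mu
    refine ⟨Φ, fun F => ⟨(hΦ F).1.symm, (hΦ F).recTab_eq, (hΦ F).wt_eq, fun i hi => ⟨?_, ?_⟩⟩⟩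
    · change (F.raise i).map Φ = _
      rcases h : F.raise i with _ | G
      · rw [(hΦ F).e_eq_none hi h]
        rfl
      · obtain ⟨T, hT, hG⟩ := (hΦ F).raise h
        rw [hT, Option.map_some, Option.map_some, (hΦ G).right_unique hG]
    · change (F.lower i).map Φ = _
      rcases h : F.lower i with _ | G
      · rw [(hΦ F).f_eq_none h]
        rfl
      · obtain ⟨T, hT, hG⟩ := (hΦ F).lower h
        rw [hT, Option.map_some, Option.map_some, (hΦ G).right_unique hG]
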